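/- **Lemma 3.7 (triads).** All graphs are finite and simple. A graph is *subcubic* if its maximum degree is at most $3$, and *$2$-connected* if it has more than two vertices and stays connected after the deletion of any set of fewer than two vertices. A *skewed theta* in a graph $G$ is a (not necessarily induced) subgraph of $G$ that is the union of three pairwise edge-disjoint paths linking two vertices, two of the paths having odd length and one having even length. Given a bipartition $\mathcal P=(A,B)$ of $V(G)$, where $A$ or $B$ may be empty, an edge of $G$ is *$\mathcal P$-even* if its endvertices lie in distinct classes of $\mathcal P$, and *$\mathcal P$-odd* otherwise. An *edge cut* of $G$ is the set of all edges of $G$ between $X$ and $Y$ for some partition of $V(G)$ into two non-empty sets $X,Y$. There is a polynomial-time algorithm that takes as input a $2$-connected subcubic graph $G$, a bipartition $\mathcal P$ of $V(G)$ and three distinct $\mathcal P$-odd edges $o_1,o_2,o_3$ of $G$, and that on every such input (a) either correctly decides that $G$ contains a skewed theta, (b) or computes an edge cut $F$ of $G$ that contains more $\mathcal P$-odd edges than $\mathcal P$-even edges. Here an algorithm is a program for a random access machine (with indirect addressing) with addition, subtraction and comparison as unit-cost operations (no multiplication); $G$ is given by its adjacency matrix, and the edge cut $F$ is output as a list of its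 edges without repetitions. "Polynomial-time" means that there is a single polynomial $p$ such that the algorithm halts after at most $p(\ell)$ steps on every admissible input word of length $\ell$. -/

import Mathlib

/-! ## Graphs -/

namespace SkewedTheta

variable {V : Type*}

/-- A graph is subcubic if every vertex has degree at most three. -/
def Subcubic (G : SimpleGraph V) : Prop :=
  ∀ v, (G.neighborSet v).encard ≤ 3

/-- A graph is `2`-connected if it has more than two vertices and remains connected after the
deletion of any set of fewer than two vertices. -/
def TwoConnected (G : SimpleGraph V) : Prop :=
  2 < ENat.card V ∧ G.Connected ∧ ∀ v, (G.induce {v}ᶜ).Connected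

/-- `G` contains a skewed theta: a subgraph that is the union of three pairwise edge-disjoint paths
linking two vertices `u` and `v`, two of odd length and one of even length. (As a path of odd length
is not trivial, `u ≠ v`.) -/
def ContainsSkewedTheta (G : SimpleGraph V) : Prop :=
  ∃ (u v : V) (p q r : G.Walk u v),
    p.IsPath ∧ q.IsPath ∧ r.IsPath ∧
    p.edges.Disjoint q.edges ∧ p.edges.Disjoint r.edges ∧ q.edges.Disjoint r.edges ∧
    Odd p.length ∧ Odd q.length ∧ Even r.length

/-- The edges of `G` whose endvertices lie in distinct classes of the bipartition
`(side⁻¹ true, side⁻¹ false)` of the vertex set; one of the classes may be empty. -/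
def evenEdges (G : SimpleGraph V) (side : V → Bool) : Set (Sym2 V) :=
  {e | ∃ u v, G.Adj u v ∧ side u ≠ side v ∧ e = s(u, v)}

/-- The edges of `G` whose endvertices lie in the same class of the bipartition. -/
def oddEdges (G : SimpleGraph V) (side : V → Bool) : Set (Sym2 V) :=
  {e | ∃ u v, G.Adj u v ∧ side u = side v ∧ e = s(u, v)}

/-- The set `E(X, V ∖ X)` of the edges of `G` with one end in `X` and the other end outside `X`. -/
def edgesLeaving (G : SimpleGraph V) (X : Set V) : Set (Sym2 V) :=
  {e | ∃ u v, G.Adj u v ∧ u ∈ X ∧ v ∉ X ∧ e = s(u, v)}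

/-- An edge cut of `G` is the set of all edges between the two sides of a partition of the vertex
set into two non-empty sets. -/
def IsEdgeCut (G : SimpleGraph V) (F : Set (Sym2 V)) : Prop :=
  ∃ X : Set V, X.Nonempty ∧ Xᶜ.Nonempty ∧ F = edgesLeaving G X

end SkewedTheta

/-! ## A random access machine with step count

Programs are while-programs over finitely many unbounded arrays of natural numbers with indirect
addressing. Every constant, memory access, arithmetic operation, comparison and command takes one
unit of time. The arithmetic consists of addition and truncated subtraction (there is no
multiplication), so that the numbers in memory have a number of binary digits that is at most linear
in the running time and in the length of the numbers in the input. -/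

namespace Ram

/-- Memory content: `s a i` is the entry at index `i` of the array `a`. -/
abbrev Store := ℕ → ℕ → ℕ

/-- Expressions. -/
inductive Expr where
  | const (n : ℕ)
  | read (a : ℕ) (i : Expr)
  | add (x y : Expr)
  | sub (x y : Expr)
  | lt (x y : Expr)
  | eq (x y : Expr)

namespace Expr

/-- The value of an expression; a comparison yields `1` if it holds and `0` if it does not. -/
def eval (s : Store) : Expr → ℕ
  | const n => n
  | read a i => s a (i.eval s)
  | add x y => x.eval s + y.eval s
  | sub x y => x.eval s - y.eval s
  | lt x y => if x.eval s < y.eval s then 1 else 0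
  | eq x y => if x.eval s = y.eval s then 1 else 0

/-- The number of steps taken by the evaluation of an expression. -/
def cost : Expr → ℕ
  | const _ => 1
  | read _ i => i.cost + 1
  | add x y => x.cost + y.cost + 1
  | sub x y => x.cost + y.cost + 1
  | lt x y => x.cost + y.cost + 1
  | eq x y => x.cost + y.cost + 1

end Expr

/-- The store in which entry `i` of array `a` has been overwritten with `x`. -/
def Store.write (s : Store) (a i x : ℕ) : Store :=
  fun b j => if b = a ∧ j = i then x else s b j

/-- Programs. The condition of a branch or a loop counts as true when its value is not `0`. -/
inductive Program where
  | skip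
  | write (a : ℕ) (i x : Expr)
  | seq (c d : Program)
  | ite (b : Expr) (c d : Program)
  | while (b : Expr) (c : Program)

/-- `Exec c s t s'`: started in the store `s`, the program `c` halts after exactly `t` steps in the
store `s'`. -/
inductive Exec : Program → Store → ℕ → Store → Prop where
  | skip (s : Store) : Exec .skip s 1 s
  | write (a : ℕ) (i x : Expr) (s : Store) :
      Exec (.write a i x) s (i.cost + x.cost + 1) (s.write a (i.eval s) (x.eval s))
  | seq {c d : Program} {s s' s'' : Store} {t t' : ℕ} (hc : Exec c s t s') (hd : Exec d s' t' s'') :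
      Exec (.seq c d) s (t + t' + 1) s''
  | ite_true {b : Expr} {c d : Program} {s s' : Store} {t : ℕ} (hb : b.eval s ≠ 0)
      (hc : Exec c s t s') : Exec (.ite b c d) s (b.cost + t + 1) s'
  | ite_false {b : Expr} {c d : Program} {s s' : Store} {t : ℕ} (hb : b.eval s = 0)
      (hd : Exec d s t s') : Exec (.ite b c d) s (b.cost + t + 1) s'
  | while_true {b : Expr} {c : Program} {s s' s'' : Store} {t t' : ℕ} (hb : b.eval s ≠ 0)
      (hc : Exec c s t s') (hw : Exec (.while b c) s' t' s'') :
      Exec (.while b c) s (b.cost + t + t' + 1) s''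
  | while_false {b : Expr} {c : Program} {s : Store} (hb : b.eval s = 0) :
      Exec (.while b c) s (b.cost + 1) s

/-- The initial store on input `w`: array `0` holds the word `w`, everything else is `0`. -/
def initial (w : List ℕ) : Store :=
  fun a i => if a = 0 then w.getD i 0 else 0

/-- The output word of a store: its length is the first entry of array `1`, and its letters are the
entries that follow. -/
def output (s : Store) : List ℕ :=
  (List.range (s 1 0)).map fun i => s 1 (i + 1)

/-- The program `c` halts on the input word `w` after at most `m` steps, with output word `w'`. -/
def OutputsWithin (c : Program) (w w' : List ℕ) (m : ℕ) : Prop :=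
  ∃ (t : ℕ) (s : Store), Exec c (initial w) t s ∧ t ≤ m ∧ output s = w'

end Ram

/-! ## The computational problem -/

namespace SkewedTheta

/-- The data on which the algorithm runs: a graph on the vertices `0, …, n - 1`, a bipartition of
its vertex set, and three pairs of vertices. -/
structure Input where
  n : ℕ
  graph : SimpleGraph (Fin n)
  side : Fin n → Bool
  fst : Fin 3 → Fin n
  snd : Fin 3 → Fin n

namespace Input

/-- The unordered pair with index `i`. -/
def edge (I : Input) (i : Fin 3) : Sym2 (Fin I.n) := s(I.fst i, I.snd i)

/-- The inputs that are admitted: the graph is `2`-connected and subcubic, and the three pairs are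
distinct odd edges. -/
def Admissible (I : Input) : Prop :=
  TwoConnected I.graph ∧ Subcubic I.graph ∧
    (∀ i, I.edge i ∈ oddEdges I.graph I.side) ∧ Function.Injective I.edge

open Classical in
/-- The input word: the number of vertices, the adjacency matrix row by row, the classes of the
vertices, and the endvertices of the three edges. All letters are at most the length of the word. -/
noncomputable def encode (I : Input) : List ℕ :=
  I.n ::
    ((List.finRange I.n).flatMap fun i =>
      (List.finRange I.n).map fun j => if I.graph.Adj i j then 1 else 0) ++
    ((List.finRange I.n).map fun i => if I.side i then 1 else 0) ++
    ((List.finRange 3).flatMap fun i => [(I.fst i : ℕ), (I.snd i : ℕ)])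

end Input

/-- The possible answers for a graph on `0, …, n - 1`: the verdict that the graph contains a skewed
theta, or a list of edges, given by their endvertices. -/
inductive Answer (n : ℕ) where
  | skewedTheta
  | edges (L : List (Fin n × Fin n))

namespace Answer

/-- The output word of an answer: `0` for the verdict; `1` followed by the endvertices of the edges
in the list. -/
def encode {n : ℕ} : Answer n → List ℕ
  | skewedTheta => [0]
  | edges L => 1 :: L.flatMap fun e => [(e.1 : ℕ), (e.2 : ℕ)]

/-- The answer is correct for the input: if it is the verdict, then the graph contains a skewed
theta; if it is a list of edges, then this lists without repetition the edges of an edge cut with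
more odd than even edges. -/
def Correct (I : Input) : Answer I.n → Prop
  | skewedTheta => ContainsSkewedTheta I.graph
  | edges L =>
      (L.map fun e => s(e.1, e.2)).Nodup ∧
      ∃ F : Set (Sym2 (Fin I.n)), (∀ e, e ∈ F ↔ e ∈ L.map fun e => s(e.1, e.2)) ∧
        IsEdgeCut I.graph F ∧
        (F ∩ evenEdges I.graph I.side).ncard < (F ∩ oddEdges I.graph I.side).ncard

end Answer

end SkewedTheta

/-!
The algorithm looks for an edge cut among polynomially many candidates. For vertices `u₁`, `w₁`,
`u₂`, `w₂`, the hull is the set of the vertices that are reached from `u₁` and `u₂` along even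
edges, with the steps from `u₁` to `w₁` and from `u₂` to `w₂` forbidden. If some hull is left by
more odd than even edges, then the edges leaving it are the output; otherwise the verdict is that
the graph contains a skewed theta.

The hulls suffice because of two facts. First (`cut_le_of_hull`), if some vertex set is left by at
most two even edges and by more odd edges than even ones, then so is a hull: when the even edges
form a connected graph, the set is the hull of the inner ends of the even edges that leave it;
otherwise a component of that graph is a hull, and it is left by odd edges only. Secondly
(`containsSkewedTheta_of_cut_le`), if there is no such vertex set and there are three odd edges,
then there is a skewed theta. The connectivity of the even edges with respect to the ends of the
odd edges `aᵢbᵢ` is then large: every set that separates `k` of the three pairs is left by at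
least `k` even edges.

For the second fact, let `G` be without skewed theta. As `G` is subcubic, edge-disjoint trails
hardly meet, so that any two edge-disjoint odd closed walks would contain vertex-disjoint odd
cycles, which by Menger's theorem and `2`-connectivity are linked by two disjoint paths and yield
a skewed theta (`containsSkewedTheta_of_disjoint_odd_walks`). Hence no two pairs are joined by
edge-disjoint walks of even edges. Likewise a walk that avoids the edges of an odd cycle but has
its ends on it is even (`even_of_odd_cycle`). The odd edges are generalized to edge-disjoint
walks, the ears of a configuration (`Config`), so that a single even edge that separates terminals
can be removed: either it has a pair on each side, which gives disjoint walks, or it cuts off a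
single terminal, which is moved across it while the ear is prolonged
(`Config.two_le_cut_or_exists_smaller`).

In a configuration without such edges (`Bridgeless`), there cannot be three edge-disjoint walks
from `{a₁, b₂}` to `{a₂, b₁}`; the decisive case is that of two walks from `a₁` to `a₂` and one
from `b₂` to `b₁`, where further linking walks lead to contradictory parities
(`Bridgeless.false_of_parallel`). So by Menger's theorem a cut of two even edges separates `{a₁,
b₂}` from `{a₂, b₁}` (`Bridgeless.exists_cut`), and another one `{a₁, a₂}` from `{b₁, b₂}`.
Neither separates the third pair, which therefore lies in one of the four corners. By
submodularity that corner is left by at most two even edges, so the third pair is joined inside it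
and another pair outside (`Bridgeless.false_of_corner`), which is impossible.
-/

/-! ### Walks in subcubic graphs -/

namespace SkewedTheta

open SimpleGraph

section Walks

variable {V : Type*} [DecidableEq V] {G : SimpleGraph V}

/-- Each visit of a walk to `x` uses two edges at `x`, up to the ends of the walk. -/
theorem countP_edges_add (x : V) {u v : V} (p : G.Walk u v) :
    p.edges.countP (x ∈ ·) + (if x = u then 1 else 0) + (if x = v then 1 else 0) =
      2 * p.support.count x := by
  induction p with
  | nil => simp [List.count_singleton]; split_ifs <;> simp_all
  | @cons u v w h p ih =>
    have hne : u ≠ v := h.ne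
    simp only [Walk.edges_cons, Walk.support_cons, List.countP_cons, List.count_cons,
      Sym2.mem_iff, beq_iff_eq, decide_eq_true_eq]
    by_cases h1 : x = u
    · subst h1
      simp [hne] at ih ⊢
      omega
    · by_cases h2 : x = v
      · subst h2
        simp [hne, hne.symm] at ih ⊢
        omega
      · simp [h1, h2, Ne.symm h1] at ih ⊢
        omega

theorem countP_le_three (hG : Subcubic G) (x : V) {l : List (Sym2 V)} (hl : l.Nodup)
    (hlG : ∀ e ∈ l, e ∈ G.edgeSet) : l.countP (x ∈ ·) ≤ 3 := by
  have h1 : (l.filter (x ∈ ·)).Nodup := hl.filter _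
  rw [List.countP_eq_length_filter, ← List.toFinset_card_of_nodup h1]
  have h2 : ((l.filter (x ∈ ·)).toFinset : Set (Sym2 V)) ⊆ G.incidenceSet x := by
    intro e he
    simp only [List.coe_toFinset, List.mem_filter, decide_eq_true_eq, Set.mem_ofPred_eq] at he
    exact ⟨hlG e he.1, he.2⟩
  have h3 : (G.incidenceSet x).encard = (G.neighborSet x).encard :=
    Set.encard_congr (G.incidenceSetEquivNeighborSet x)
  have h4 := (Set.encard_le_encard h2).trans (h3.le.trans (hG x))
  rw [Set.encard_coe_eq_coe_finsetCard] at h4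
  exact_mod_cast h4

theorem mem_support_of_countP {x u v : V} {p : G.Walk u v} (hx : x ∈ p.support) :
    2 ≤ p.edges.countP (x ∈ ·) + (if x = u then 1 else 0) + (if x = v then 1 else 0) := by
  rw [countP_edges_add]
  have := List.count_pos_iff.2 hx
  omega

/-- In a subcubic graph, a trail is a path if further edges meet its ends: a vertex that is visited
twice would be incident with four edges. -/
theorem isPath_of_nodup_edges (hG : Subcubic G) {u v : V} (huv : u ≠ v) {p : G.Walk u v}
    {l : List (Sym2 V)} (hl : ∀ e ∈ l, e ∈ G.edgeSet) (hp : (p.edges ++ l).Nodup)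
    (hu : 1 ≤ l.countP (u ∈ ·)) (hv : 1 ≤ l.countP (v ∈ ·)) : p.IsPath := by
  rw [Walk.isPath_def, List.nodup_iff_count_le_one]
  intro x
  have h1 := countP_edges_add x p
  have h2 := countP_le_three hG x hp (by
    intro e he
    rcases List.mem_append.1 he with h | h
    · exact p.edges_subset_edgeSet h
    · exact hl e h)
  rw [List.countP_append] at h2
  split_ifs at h1 with h3 h4 h4
  · exact absurd (h3.symm.trans h4) huv
  · subst h3; omega
  · subst h4; omega
  · omega

theorem isCycle_of_nodup_edges (hG : Subcubic G) {u : V} {p : G.Walk u u}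
    (hp : p.edges.Nodup) (hne : p.edges ≠ []) : p.IsCycle := by
  rw [Walk.isCycle_def]
  refine ⟨⟨hp⟩, ?_, ?_⟩
  · rintro rfl
    simp at hne
  · rw [List.nodup_iff_count_le_one]
    intro x
    have h1 := countP_edges_add x p
    have h2 := countP_le_three hG x hp fun e he => p.edges_subset_edgeSet he
    have h3 : p.support.count x = p.support.tail.count x + if x = u then 1 else 0 := by
      conv_lhs => rw [← Walk.cons_tail_support, List.count_cons]
      by_cases hxu : x = u
      · simp [hxu]
      · simp [hxu, Ne.symm hxu]
    split_ifs at h1 h3 <;> omega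

/-- A walk either has the same parity as the path obtained from it by removing detours, or its
edges contain those of an odd cycle. -/
theorem bypass_parity {u v : V} (p : G.Walk u v) :
    (Even p.bypass.length ↔ Even p.length) ∨
      ∃ (c : V) (C : G.Walk c c), C.IsCycle ∧ Odd C.length ∧ C.edges ⊆ p.edges := by
  induction p with
  | nil => simp [Walk.bypass]
  | @cons u v w h p ih =>
    rcases ih with ih | ⟨c, C, h1, h2, h3⟩
    · simp only [Walk.bypass]
      split_ifs with hs
      · have hlen := congrArg Walk.length (p.bypass.take_spec hs)
        rw [Walk.length_append] at hlen
        by_cases hpar : Even ((p.bypass.takeUntil u hs).length)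
        · right
          refine ⟨u, Walk.cons h (p.bypass.takeUntil u hs), ?_, ?_, ?_⟩
          · rw [Walk.cons_isCycle_iff]
            refine ⟨(p.bypass_isPath).takeUntil hs, fun hmem => ?_⟩
            have := ((p.bypass_isPath).takeUntil hs).length_eq_one_of_mem_edges
              (by rwa [Sym2.eq_swap])
            rw [this] at hpar
            exact absurd hpar (by decide)
          · rw [Walk.length_cons]
            exact hpar.add_one
          · intro e he
            rw [Walk.edges_cons, List.mem_cons] at he ⊢
            exact he.imp_right fun he =>
              p.edges_bypass_subset_edges (Walk.edges_takeUntil_subset_edges _ hs he)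
        · left
          rw [Walk.length_cons]
          grind
      · left
        rw [Walk.length_cons, Walk.length_cons]
        grind
    · exact Or.inr ⟨c, C, h1, h2, fun e he => by simp [h3 he]⟩

theorem exists_odd_cycle {u : V} (p : G.Walk u u) (hp : Odd p.length) :
    ∃ (c : V) (C : G.Walk c c), C.IsCycle ∧ Odd C.length ∧ C.edges ⊆ p.edges := by
  refine (bypass_parity p).resolve_left fun h => ?_
  have h1 : p.bypass.length = 0 := by
    exact Walk.length_eq_zero_iff.2 (Walk.isPath_iff_nil.1 p.bypass_isPath)
  rw [h1] at h
  exact (Nat.not_even_iff_odd.2 hp) (h.1 (by decide))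

/-- An odd cycle together with an odd path that links two of its vertices and is edge-disjoint
from it forms a skewed theta. -/
theorem containsSkewedTheta_of_odd_ear {c x y : V} {C : G.Walk c c} (hC : C.IsCycle)
    (hodd : Odd C.length) (hx : x ∈ C.support) (hy : y ∈ C.support) (hxy : x ≠ y)
    {R : G.Walk x y} (hR : R.IsPath) (hRodd : Odd R.length) (hd : R.edges.Disjoint C.edges) :
    ContainsSkewedTheta G := by
  have hD : (C.rotate x hx).IsCycle := (Walk.isCycle_rotate hx).2 hC
  have hlen : (C.rotate x hx).length = C.length := by simp
  have hed : ∀ e, e ∈ (C.rotate x hx).edges → e ∈ C.edges := fun e he =>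
    (C.rotate_edges x hx).mem_iff.1 he
  have hyD : y ∈ (C.rotate x hx).support := (C.mem_support_rotate_iff x hx).2 hy
  generalize C.rotate x hx = D at *
  have hl := congrArg Walk.length (D.take_spec hyD)
  rw [Walk.length_append, hlen] at hl
  have hp : (D.takeUntil y hyD).IsPath := hD.isPath_takeUntil hyD
  have hq : (D.dropUntil y hyD).reverse.IsPath := by
    rw [Walk.isPath_reverse_iff]
    refine Walk.IsCycle.isPath_of_append_right (p := D.takeUntil y hyD) ?_ (by rwa [D.take_spec])
    intro hnil
    exact hxy hnil.eq
  have hdis : (D.takeUntil y hyD).edges.Disjoint (D.dropUntil y hyD).reverse.edges := by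
    have := hD.isTrail.disjoint_edges_takeUntil_dropUntil hyD
    rwa [Walk.edges_reverse, List.disjoint_reverse_right]
  have hpR : (D.takeUntil y hyD).edges.Disjoint R.edges := fun e h1 h2 =>
    hd h2 (hed e (Walk.edges_takeUntil_subset_edges _ hyD h1))
  have hqR : (D.dropUntil y hyD).reverse.edges.Disjoint R.edges := fun e h1 h2 => by
    rw [Walk.edges_reverse, List.mem_reverse] at h1
    exact hd h2 (hed e (Walk.edges_dropUntil_subset_edges _ hyD h1))
  by_cases hpar : Even (D.takeUntil y hyD).length
  · refine ⟨x, y, (D.dropUntil y hyD).reverse, R, D.takeUntil y hyD, hq, hR, hp, hqR, hdis.symm,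
      hpR.symm, ?_, hRodd, hpar⟩
    rw [Walk.length_reverse]
    grind
  · refine ⟨x, y, D.takeUntil y hyD, R, (D.dropUntil y hyD).reverse, hp, hR, hq, hpR, hdis,
      hqR.symm, by grind, hRodd, ?_⟩
    rw [Walk.length_reverse]
    grind

end Walks

end SkewedTheta

/-! ### Menger's theorem for edge-disjoint paths -/

namespace SkewedTheta

open SimpleGraph

section Menger

variable {V : Type*} [DecidableEq V] {G : SimpleGraph V}

/-- The unit flow along a walk, as an antisymmetric function on ordered pairs of vertices: each
traversed dart contributes `1` and its reverse contributes `-1`. -/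
def unitFlow : {u v : V} → G.Walk u v → V → V → ℤ
  | _, _, .nil => fun _ _ => 0
  | _, _, .cons (u := u) (v := w) _ p => fun x y =>
      (if x = u ∧ y = w then 1 else 0) - (if x = w ∧ y = u then 1 else 0) + unitFlow p x y

theorem unitFlow_antisymm {u v : V} (p : G.Walk u v) (x y : V) :
    unitFlow p x y = - unitFlow p y x := by
  induction p with
  | nil => simp [unitFlow]
  | cons h p ih =>
    simp only [unitFlow]
    rw [ih]
    split_ifs <;> first | omega | tauto

theorem sum_unitFlow [Fintype V] {u v : V} (p : G.Walk u v) (x : V) :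
    ∑ y, unitFlow p x y = (if x = u then 1 else 0) - (if x = v then 1 else 0) := by
  induction p with
  | nil => simp [unitFlow]
  | @cons u v w h p ih =>
    have h1 : ∑ y, (if x = u ∧ y = v then (1 : ℤ) else 0) = if x = u then 1 else 0 := by
      by_cases hx : x = u <;> simp [hx]
    have h2 : ∑ y, (if x = v ∧ y = u then (1 : ℤ) else 0) = if x = v then 1 else 0 := by
      by_cases hx : x = v <;> simp [hx]
    simp only [unitFlow, Finset.sum_add_distrib, Finset.sum_sub_distrib, ih, h1, h2]
    ring

theorem unitFlow_eq_zero {u v : V} (p : G.Walk u v) {x y : V} (h : s(x, y) ∉ p.edges) :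
    unitFlow p x y = 0 := by
  induction p with
  | nil => simp [unitFlow]
  | @cons u v w hadj p ih =>
    simp only [Walk.edges_cons, List.mem_cons, not_or, Sym2.eq_iff] at h
    have h1 : ¬ (x = u ∧ y = v) := h.1.1
    have h2 : ¬ (x = v ∧ y = u) := h.1.2
    simp [unitFlow, h1, h2, ih h.2]

theorem unitFlow_eq_one {u v : V} {p : G.Walk u v} (hp : p.IsTrail) {d : G.Dart}
    (hd : d ∈ p.darts) : unitFlow p d.fst d.snd = 1 := by
  induction p with
  | nil => simp at hd
  | @cons u v w hadj p ih =>
    rw [Walk.isTrail_cons] at hp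
    rw [Walk.darts_cons, List.mem_cons] at hd
    rcases hd with rfl | hd
    · have hne := hadj.ne
      have hne' : ¬ (u = v ∧ v = u) := fun h => hne h.1
      simp [unitFlow, unitFlow_eq_zero p hp.2, hne']
    · have hmem : s(d.fst, d.snd) ∈ p.edges := List.mem_map.2 ⟨d, hd, rfl⟩
      have h1 : ¬ (d.fst = u ∧ d.snd = v) := by
        rintro ⟨h1, h2⟩
        rw [h1, h2] at hmem
        exact hp.2 hmem
      have h2 : ¬ (d.fst = v ∧ d.snd = u) := by
        rintro ⟨h1, h2⟩
        rw [h1, h2, Sym2.eq_swap] at hmem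
        exact hp.2 hmem
      simp [unitFlow, h1, h2, ih hp.1 hd]

theorem unitFlow_cases {u v : V} {p : G.Walk u v} (hp : p.IsTrail) (x y : V) :
    (s(x, y) ∉ p.edges ∧ unitFlow p x y = 0) ∨
      (∃ d ∈ p.darts, d.fst = x ∧ d.snd = y ∧ unitFlow p x y = 1) ∨
      (∃ d ∈ p.darts, d.fst = y ∧ d.snd = x ∧ unitFlow p x y = -1) := by
  by_cases h : s(x, y) ∈ p.edges
  · right
    obtain ⟨d, hd, hde⟩ := List.mem_map.1 h
    have h1 := unitFlow_eq_one hp hd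
    rcases Sym2.eq_iff.1 (show s(d.fst, d.snd) = s(x, y) from hde) with ⟨rfl, rfl⟩ | ⟨rfl, rfl⟩
    · exact Or.inl ⟨d, hd, rfl, rfl, h1⟩
    · exact Or.inr ⟨d, hd, rfl, rfl, by rw [unitFlow_antisymm, h1]⟩
  · exact Or.inl ⟨h, unitFlow_eq_zero p h⟩

variable [Fintype V]

/-- The number of edges in `S` with exactly one end in `X`, counted as ordered pairs that point
out of `X`. -/
def cut (S : Finset (Sym2 V)) (X : Finset V) : ℕ :=
  (Finset.univ.filter fun p : V × V => p.1 ∈ X ∧ p.2 ∉ X ∧ s(p.1, p.2) ∈ S).card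

/-- `f` is an integral flow from `A` to `B` along the edges in `S`, of capacity one. -/
structure IsFlow (S : Finset (Sym2 V)) (A B : Finset V) (f : V → V → ℤ) : Prop where
  antisymm : ∀ x y, f x y = - f y x
  le_one : ∀ x y, f x y ≤ 1
  supp : ∀ x y, f x y ≠ 0 → s(x, y) ∈ S
  conserved : ∀ x, x ∉ A → x ∉ B → ∑ y, f x y = 0

/-- There are `k` pairwise edge-disjoint paths from `A` to `B` with edges in `S`. -/
def Linked (G : SimpleGraph V) : ℕ → Finset (Sym2 V) → Finset V → Finset V → Prop
  | 0, _, _, _ => True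
  | k + 1, S, A, B => ∃ a ∈ A, ∃ b ∈ B, ∃ p : G.Walk a b, p.IsPath ∧ (∀ e ∈ p.edges, e ∈ S) ∧
      Linked G k (S \ p.edges.toFinset) A B

/-- The value of a flow is the net flow out of every set that separates `A` from `B`. -/
theorem IsFlow.sum_eq {S : Finset (Sym2 V)} {A B X : Finset V} {f : V → V → ℤ}
    (hf : IsFlow S A B f) (hA : A ⊆ X) (hB : Disjoint X B) :
    ∑ x ∈ A, ∑ y, f x y = ∑ x ∈ X, ∑ y ∈ Xᶜ, f x y := by
  have h1 : ∑ x ∈ A, ∑ y, f x y = ∑ x ∈ X, ∑ y, f x y :=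
    Finset.sum_subset hA fun x hx hxA => hf.conserved x hxA (Finset.disjoint_left.1 hB hx)
  have h2 : ∑ x ∈ X, ∑ y ∈ X, f x y = 0 := by
    have : ∑ x ∈ X, ∑ y ∈ X, f x y = - ∑ x ∈ X, ∑ y ∈ X, f x y := by
      conv_lhs => rw [Finset.sum_comm]
      simp only [← Finset.sum_neg_distrib]
      exact Finset.sum_congr rfl fun x _ => Finset.sum_congr rfl fun y _ => hf.antisymm _ _
    omega
  rw [h1]
  have h3 : ∀ x, ∑ y, f x y = ∑ y ∈ X, f x y + ∑ y ∈ Xᶜ, f x y := fun x =>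
    (Finset.sum_add_sum_compl X _).symm
  simp only [h3, Finset.sum_add_distrib, h2, zero_add]

/-- Reachability along the relation `r` from `A`: either `B` is reached, or the set of the reached
vertices is a barrier. -/
theorem exists_path_or_separated (r : V → V → Prop) (hr : ∀ x y, r x y → G.Adj x y)
    (A B : Finset V) :
    (∃ a ∈ A, ∃ b ∈ B, ∃ p : G.Walk a b, p.IsPath ∧ ∀ d ∈ p.darts, r d.fst d.snd) ∨
      ∃ X : Finset V, A ⊆ X ∧ Disjoint X B ∧ ∀ x ∈ X, ∀ y ∉ X, ¬ r x y := by
  classical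
  by_cases h : ∃ a ∈ A, ∃ b ∈ B, ∃ p : G.Walk a b, ∀ d ∈ p.darts, r d.fst d.snd
  · obtain ⟨a, ha, b, hb, p, hp⟩ := h
    exact Or.inl ⟨a, ha, b, hb, p.bypass, p.bypass_isPath, fun d hd =>
      hp d (p.darts_bypass_subset_darts hd)⟩
  · right
    refine ⟨Finset.univ.filter fun x => ∃ a ∈ A, ∃ p : G.Walk a x, ∀ d ∈ p.darts, r d.fst d.snd,
      fun a ha => ?_, ?_, fun x hx y hy hxy => hy ?_⟩
    · simp only [Finset.mem_filter, Finset.mem_univ, true_and]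
      exact ⟨a, ha, .nil, by simp⟩
    · rw [Finset.disjoint_left]
      intro b hb hbB
      simp only [Finset.mem_filter, Finset.mem_univ, true_and] at hb
      obtain ⟨a, ha, p, hp⟩ := hb
      exact h ⟨a, ha, b, hbB, p, hp⟩
    · simp only [Finset.mem_filter, Finset.mem_univ, true_and] at hx ⊢
      obtain ⟨a, ha, p, hp⟩ := hx
      refine ⟨a, ha, p.concat (hr x y hxy), fun d hd => ?_⟩
      rw [Walk.darts_concat, List.concat_eq_append, List.mem_append, List.mem_singleton] at hd
      rcases hd with hd | rfl
      · exact hp d hd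
      · exact hxy

theorem sum_sum_unitFlow {A B : Finset V} (hAB : Disjoint A B) {a b : V} (ha : a ∈ A)
    (hb : b ∈ B) (p : G.Walk a b) : ∑ x ∈ A, ∑ y, unitFlow p x y = 1 := by
  have hbA : b ∉ A := Finset.disjoint_right.1 hAB hb
  simp [sum_unitFlow, Finset.sum_sub_distrib, ha, hbA]

/-- The flow is built by augmenting paths. -/
theorem exists_flow {S : Finset (Sym2 V)} (hS : ∀ x y, s(x, y) ∈ S → G.Adj x y) {A B : Finset V}
    (hAB : Disjoint A B) {k : ℕ} (hcut : ∀ X, A ⊆ X → Disjoint X B → k ≤ cut S X) :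
    ∀ j ≤ k, ∃ f, IsFlow S A B f ∧ ∑ x ∈ A, ∑ y, f x y = j := by
  intro j
  induction j with
  | zero => exact fun _ => ⟨fun _ _ => 0, ⟨by simp, by simp, by simp, by simp⟩, by simp⟩
  | succ j ih =>
    intro hj
    obtain ⟨f, hf, hval⟩ := ih (by omega)
    rcases exists_path_or_separated (fun x y => s(x, y) ∈ S ∧ f x y ≤ 0)
      (fun x y h => hS x y h.1) A B with ⟨a, ha, b, hb, p, hp, hr⟩ | ⟨X, hAX, hXB, hX⟩
    · refine ⟨fun x y => f x y + unitFlow p x y, ⟨fun x y => ?_, fun x y => ?_, fun x y hne => ?_,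
        fun x hxA hxB => ?_⟩, ?_⟩
      · rw [hf.antisymm, unitFlow_antisymm]; ring
      · rcases unitFlow_cases hp.isTrail x y with
          ⟨-, h⟩ | ⟨d, hd, rfl, rfl, h⟩ | ⟨d, hd, rfl, rfl, h⟩
        · rw [h]; linarith [hf.le_one x y]
        · rw [h]; linarith [(hr d hd).2]
        · rw [h]; linarith [hf.le_one d.snd d.fst]
      · rcases unitFlow_cases hp.isTrail x y with
          ⟨-, h⟩ | ⟨d, hd, rfl, rfl, h⟩ | ⟨d, hd, rfl, rfl, h⟩
        · rw [h, add_zero] at hne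
          exact hf.supp x y hne
        · exact (hr d hd).1
        · rw [Sym2.eq_swap]; exact (hr d hd).1
      · have hxa : x ≠ a := fun h => hxA (h ▸ ha)
        have hxb : x ≠ b := fun h => hxB (h ▸ hb)
        simp [Finset.sum_add_distrib, hf.conserved x hxA hxB, sum_unitFlow, hxa, hxb]
      · simp only [Finset.sum_add_distrib]
        rw [hval, sum_sum_unitFlow hAB ha hb]
        push_cast; ring
    · exfalso
      have h1 := hcut X hAX hXB
      have h2 := hf.sum_eq hAX hXB
      have h3 : ∑ x ∈ X, ∑ y ∈ Xᶜ, f x y = cut S X := by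
        rw [cut, Finset.card_filter, Nat.cast_sum, ← Finset.univ_product_univ,
          Finset.sum_product, ← Finset.sum_subset (Finset.subset_univ X)]
        · refine Finset.sum_congr rfl fun x hx => ?_
          rw [← Finset.sum_subset (Finset.subset_univ Xᶜ)]
          · refine Finset.sum_congr rfl fun y hy => ?_
            have hy' : y ∉ X := Finset.mem_compl.1 hy
            by_cases hxy : s(x, y) ∈ S
            · have h4 := hX x hx y hy'
              have h5 := hf.le_one x y
              have : f x y = 1 := by
                have : ¬ f x y ≤ 0 := fun h => h4 ⟨hxy, h⟩
                omega
              simp [this, hx, hy', hxy]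
            · have : f x y = 0 := by
                by_contra h
                exact hxy (hf.supp x y h)
              simp [this, hxy]
          · intro y _ hy
            have : y ∈ X := by simpa using hy
            simp [this]
        · intro x _ hx
          simp [hx]
      rw [hval, h3] at h2
      have : j = cut S X := by exact_mod_cast h2
      omega

/-- A flow decomposes into paths. -/
theorem IsFlow.linked {A B : Finset V} (hAB : Disjoint A B) {k : ℕ} :
    ∀ {S : Finset (Sym2 V)} (_ : ∀ x y, s(x, y) ∈ S → G.Adj x y) {f : V → V → ℤ}
      (_ : IsFlow S A B f) (_ : ∑ x ∈ A, ∑ y, f x y = k), Linked G k S A B := by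
  induction k with
  | zero => intros; trivial
  | succ k ih =>
    intro S hS f hf hval
    rcases exists_path_or_separated (fun x y => f x y = 1)
      (fun x y h => hS x y (hf.supp x y (by omega))) A B with
      ⟨a, ha, b, hb, p, hp, hr⟩ | ⟨X, hAX, hXB, hX⟩
    · refine ⟨a, ha, b, hb, p, hp, fun e he => ?_, ?_⟩
      · obtain ⟨d, hd, rfl⟩ := List.mem_map.1 he
        exact hf.supp d.fst d.snd (by rw [hr d hd]; decide)
      · refine ih (f := fun x y => f x y - unitFlow p x y)
          (fun x y h => hS x y (Finset.mem_sdiff.1 h).1)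
          ⟨fun x y => ?_, fun x y => ?_, fun x y hne => ?_, fun x hxA hxB => ?_⟩ ?_
        · rw [hf.antisymm, unitFlow_antisymm]; ring
        · rcases unitFlow_cases hp.isTrail x y with
            ⟨-, h⟩ | ⟨d, hd, rfl, rfl, h⟩ | ⟨d, hd, rfl, rfl, h⟩
          · rw [h]; linarith [hf.le_one x y]
          · rw [h]; linarith [hr d hd]
          · rw [h, hf.antisymm]; linarith [hr d hd]
        · rcases unitFlow_cases hp.isTrail x y with
            ⟨h', h⟩ | ⟨d, hd, rfl, rfl, h⟩ | ⟨d, hd, rfl, rfl, h⟩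
          · rw [h, sub_zero] at hne
            exact Finset.mem_sdiff.2 ⟨hf.supp x y hne, by simpa using h'⟩
          · rw [h, hr d hd] at hne
            exact absurd rfl hne
          · rw [h, hf.antisymm, hr d hd] at hne
            exact absurd rfl hne
        · have hxa : x ≠ a := fun h => hxA (h ▸ ha)
          have hxb : x ≠ b := fun h => hxB (h ▸ hb)
          simp [Finset.sum_sub_distrib, hf.conserved x hxA hxB, sum_unitFlow, hxa, hxb]
        · simp only [Finset.sum_sub_distrib]
          rw [hval, sum_sum_unitFlow hAB ha hb]
          push_cast; ring
    · exfalso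
      have h2 := hf.sum_eq hAX hXB
      have h3 : ∑ x ∈ X, ∑ y ∈ Xᶜ, f x y ≤ 0 :=
        Finset.sum_nonpos fun x hx => Finset.sum_nonpos fun y hy => by
          have h4 := hX x hx y (Finset.mem_compl.1 hy)
          have h5 := hf.le_one x y
          omega
      rw [hval] at h2
      push_cast at h2
      omega

/-- Menger's theorem for edge-disjoint paths between two disjoint sets of vertices. -/
theorem linked_of_le_cut {S : Finset (Sym2 V)} (hS : ∀ x y, s(x, y) ∈ S → G.Adj x y)
    {A B : Finset V} (hAB : Disjoint A B) {k : ℕ}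
    (hcut : ∀ X, A ⊆ X → Disjoint X B → k ≤ cut S X) : Linked G k S A B := by
  obtain ⟨f, hf, hval⟩ := exists_flow hS hAB hcut k le_rfl
  exact hf.linked hAB hS hval

end Menger

end SkewedTheta

/-! ### Odd cycles and skewed thetas -/

namespace SkewedTheta

open SimpleGraph

section OddCycles

variable {V : Type*} [DecidableEq V] {G : SimpleGraph V}

/-- The two arcs of an odd cycle between two of its vertices have different parities, so that one
of them has the parity that is asked for. -/
theorem exists_arc_of_parity {d d₁ d₂ : V} {D : G.Walk d d} (hD : D.IsCycle) (hodd : Odd D.length)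
    (h₁ : d₁ ∈ D.support) (h₂ : d₂ ∈ D.support) (n : ℕ) :
    ∃ Z : G.Walk d₁ d₂, Z.edges.Nodup ∧ Z.edges ⊆ D.edges ∧ Odd (n + Z.length) := by
  have hed : ∀ e, e ∈ (D.rotate d₁ h₁).edges → e ∈ D.edges := fun e he =>
    (D.rotate_edges d₁ h₁).mem_iff.1 he
  have hD' : (D.rotate d₁ h₁).IsTrail := ((Walk.isCycle_rotate h₁).2 hD).isTrail
  have hlen : (D.rotate d₁ h₁).length = D.length := by simp
  have h₂' : d₂ ∈ (D.rotate d₁ h₁).support := (D.mem_support_rotate_iff d₁ h₁).2 h₂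
  generalize D.rotate d₁ h₁ = D' at *
  have hl := congrArg Walk.length (D'.take_spec h₂')
  rw [Walk.length_append, hlen] at hl
  by_cases hpar : Odd (n + (D'.takeUntil d₂ h₂').length)
  · exact ⟨_, (hD'.takeUntil h₂').edges_nodup, fun e he =>
      hed e (Walk.edges_takeUntil_subset_edges _ h₂' he), hpar⟩
  · refine ⟨(D'.dropUntil d₂ h₂').reverse, ?_, fun e he => ?_, ?_⟩
    · rw [Walk.edges_reverse, List.nodup_reverse]
      exact (hD'.dropUntil h₂').edges_nodup
    · rw [Walk.edges_reverse, List.mem_reverse] at he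
      exact hed e (Walk.edges_dropUntil_subset_edges _ h₂' he)
    · rw [Walk.length_reverse]
      grind

theorem two_le_countP_of_isCycle {c x : V} {C : G.Walk c c} (hC : C.IsCycle)
    (hx : x ∈ C.support) : 2 ≤ C.edges.countP (x ∈ ·) := by
  have h1 := countP_edges_add x C
  by_cases h : x = c
  · subst h
    rw [hC.count_support] at h1
    simp at h1
    omega
  · have := List.count_pos_iff.2 hx
    simp [h] at h1
    omega

theorem one_le_countP_left {u v : V} (p : G.Walk u v) (huv : u ≠ v) :
    1 ≤ p.edges.countP (u ∈ ·) := by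
  have := mem_support_of_countP (p := p) p.start_mem_support
  rw [if_pos rfl, if_neg huv] at this
  omega

theorem one_le_countP_right {u v : V} (p : G.Walk u v) (huv : u ≠ v) :
    1 ≤ p.edges.countP (v ∈ ·) := by
  have := mem_support_of_countP (p := p) p.end_mem_support
  rw [if_neg huv.symm, if_pos rfl] at this
  omega

variable [Fintype V]

/-- In a `2`-connected graph, a set with at least two vertices and non-empty complement is left by
two edges with distinct ends in the set. -/
theorem two_le_cut (h2 : TwoConnected G) {S : Finset (Sym2 V)} {X : Finset V}
    (hS : ∀ u ∈ X, ∀ v ∉ X, G.Adj u v → s(u, v) ∈ S) {x₁ x₂ y : V} (hx₁ : x₁ ∈ X) (hx₂ : x₂ ∈ X)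
    (hne : x₁ ≠ x₂) (hy : y ∉ X) : 2 ≤ cut S X := by
  obtain ⟨p⟩ := h2.2.1.preconnected x₁ y
  obtain ⟨d, -, hd1, hd2⟩ := p.exists_boundary_dart X hx₁ hy
  obtain ⟨x, hx, hxd⟩ : ∃ x ∈ X, x ≠ d.fst := by
    by_cases h : x₁ = d.fst
    · exact ⟨x₂, hx₂, fun h' => hne (h.trans h'.symm)⟩
    · exact ⟨x₁, hx₁, h⟩
  have hyd : y ≠ d.fst := fun h => hy (h ▸ hd1)
  obtain ⟨q⟩ := (h2.2.2 d.fst).preconnected ⟨x, hxd⟩ ⟨y, hyd⟩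
  obtain ⟨d', -, hd1', hd2'⟩ := q.exists_boundary_dart {z | (z : V) ∈ X} hx hy
  have hmem : ∀ u ∈ X, ∀ v ∉ X, G.Adj u v → (u, v) ∈ Finset.univ.filter fun p : V × V =>
      p.1 ∈ X ∧ p.2 ∉ X ∧ s(p.1, p.2) ∈ S := fun u hu v hv h => by simp [hu, hv, hS u hu v hv h]
  refine Finset.one_lt_card.2 ⟨(d.fst, d.snd), hmem _ hd1 _ hd2 d.adj,
    (d'.fst, d'.snd), hmem _ hd1' _ hd2' d'.adj, fun h => ?_⟩
  exact d'.fst.2 (congrArg Prod.fst h).symm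

/-- Two edge-disjoint odd cycles yield a skewed theta: they are vertex-disjoint and, by Menger's
theorem, linked by two disjoint paths; one of the two arcs of the second cycle completes these to an
odd ear of the first. -/
theorem containsSkewedTheta_of_disjoint_odd_cycles (hG : Subcubic G) (h2 : TwoConnected G)
    {c d : V} {C : G.Walk c c} {D : G.Walk d d} (hC : C.IsCycle) (hD : D.IsCycle)
    (hCodd : Odd C.length) (hDodd : Odd D.length) (hCD : C.edges.Disjoint D.edges) :
    ContainsSkewedTheta G := by
  classical
  have hsupp : ∀ x ∈ C.support, x ∉ D.support := by
    intro x hxC hxD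
    have h1 := two_le_countP_of_isCycle hC hxC
    have h2 := two_le_countP_of_isCycle hD hxD
    have h3 := countP_le_three hG x (l := C.edges ++ D.edges)
      (List.nodup_append'.2 ⟨hC.isTrail.edges_nodup, hD.isTrail.edges_nodup, hCD⟩)
      (fun e he => (List.mem_append.1 he).elim (fun h => C.edges_subset_edgeSet h)
        fun h => D.edges_subset_edgeSet h)
    rw [List.countP_append] at h3
    omega
  set S : Finset (Sym2 V) := Finset.univ.filter fun e =>
    e ∈ G.edgeSet ∧ e ∉ C.edges ∧ e ∉ D.edges with hSdef
  have hSmem : ∀ e, e ∈ S ↔ e ∈ G.edgeSet ∧ e ∉ C.edges ∧ e ∉ D.edges := by simp [hSdef]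
  have hlink : Linked G 2 S C.support.toFinset D.support.toFinset := by
    refine linked_of_le_cut (fun x y h => ((hSmem _).1 h).1) ?_ fun X hCX hXD => ?_
    · rw [Finset.disjoint_left]
      intro x hx
      simpa using hsupp x (by simpa using hx)
    · have hXC : ∀ x ∈ C.support, x ∈ X := fun x hx => hCX (by simpa using hx)
      have hXD' : ∀ x ∈ D.support, x ∉ X := fun x hx =>
        Finset.disjoint_right.1 hXD (by simpa using hx)
      refine two_le_cut h2 (X := X) (x₁ := c) (x₂ := C.snd) (y := d) (fun u hu v hv huv => ?_)
        (hXC _ C.start_mem_support) (hXC _ (C.getVert_mem_support 1)) ?_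
        (hXD' _ D.start_mem_support)
      · refine (hSmem _).2 ⟨huv, fun h => ?_, fun h => ?_⟩
        · exact hv (hXC _ (C.snd_mem_support_of_mem_edges h))
        · exact hXD' _ (D.fst_mem_support_of_mem_edges h) hu
      · exact (C.adj_snd hC.not_nil).ne
  obtain ⟨c₁, hc₁, d₁, hd₁, Q₁, hQ₁, hQ₁S, c₂, hc₂, d₂, hd₂, Q₂, hQ₂, hQ₂S, -⟩ := hlink
  rw [List.mem_toFinset] at hc₁ hc₂ hd₁ hd₂
  have hne₁ : c₁ ≠ d₁ := fun h => hsupp _ hc₁ (h ▸ hd₁)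
  have hne₂ : c₂ ≠ d₂ := fun h => hsupp _ hc₂ (h ▸ hd₂)
  have hQ₁n := hQ₁.isTrail.edges_nodup
  have hQ₂n := hQ₂.isTrail.edges_nodup
  have hCn := hC.isTrail.edges_nodup
  have hQ₂S' : ∀ e ∈ Q₂.edges, e ∈ S ∧ e ∉ Q₁.edges := fun e he => by
    simpa using hQ₂S e he
  obtain ⟨Z, hZn, hZD, hZodd⟩ := exists_arc_of_parity hD hDodd hd₁ hd₂ (Q₁.length + Q₂.length)
  have hRe : (Q₁.append (Z.append Q₂.reverse)).edges =
      Q₁.edges ++ (Z.edges ++ Q₂.edges.reverse) := by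
    simp
  have hRC : ((Q₁.append (Z.append Q₂.reverse)).edges ++ C.edges).Nodup := by
    rw [hRe]
    simp only [List.nodup_append', List.nodup_reverse, List.disjoint_append_left,
      List.disjoint_append_right, List.disjoint_reverse_right, List.disjoint_reverse_left]
    refine ⟨⟨hQ₁n, ⟨hZn, hQ₂n, ?_⟩, ?_, ?_⟩, hCn, ?_, ?_, ?_⟩
    · exact fun e h h' => ((hSmem e).1 (hQ₂S' e h').1).2.2 (hZD h)
    · exact fun e h h' => ((hSmem e).1 (hQ₁S e h)).2.2 (hZD h')
    · exact fun e h h' => (hQ₂S' e h').2 h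
    · exact fun e h h' => ((hSmem e).1 (hQ₁S e h)).2.1 h'
    · exact fun e h h' => hCD h' (hZD h)
    · exact fun e h h' => ((hSmem e).1 (hQ₂S' e h).1).2.1 h'
  have hcc : c₁ ≠ c₂ := by
    rintro rfl
    have e1 := two_le_countP_of_isCycle hC hc₁
    have e2 := one_le_countP_left Q₁ hne₁
    have e3 := one_le_countP_left Q₂ hne₂
    have e4 := countP_le_three hG c₁ hRC (by
      intro e he
      rcases List.mem_append.1 he with h | h
      · exact Walk.edges_subset_edgeSet _ h
      · exact Walk.edges_subset_edgeSet _ h)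
    rw [hRe] at e4
    simp only [List.countP_append, List.countP_reverse] at e4
    omega
  refine containsSkewedTheta_of_odd_ear hC hCodd hc₁ hc₂ hcc
    (R := Q₁.append (Z.append Q₂.reverse)) ?_ ?_ (List.nodup_append'.1 hRC).2.2
  · refine isPath_of_nodup_edges hG hcc (fun e he => C.edges_subset_edgeSet he) hRC ?_ ?_
    · exact le_trans (by decide) (two_le_countP_of_isCycle hC hc₁)
    · exact le_trans (by decide) (two_le_countP_of_isCycle hC hc₂)
  · simp only [Walk.length_append, Walk.length_reverse]
    convert hZodd using 1
    ring

theorem containsSkewedTheta_of_disjoint_odd_walks (hG : Subcubic G) (h2 : TwoConnected G)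
    {u v : V} (p : G.Walk u u) (q : G.Walk v v) (hp : Odd p.length) (hq : Odd q.length)
    (hpq : p.edges.Disjoint q.edges) : ContainsSkewedTheta G := by
  obtain ⟨c, C, hC, hCodd, hCp⟩ := exists_odd_cycle p hp
  obtain ⟨d, D, hD, hDodd, hDq⟩ := exists_odd_cycle q hq
  exact containsSkewedTheta_of_disjoint_odd_cycles hG h2 hC hD hCodd hDodd
    fun e h h' => hpq (hCp h) (hDq h')

/-- Without a skewed theta, every walk that links two vertices of an odd cycle and avoids its edges
is even. -/
theorem even_of_odd_cycle (hG : Subcubic G) (h2 : TwoConnected G) (hθ : ¬ ContainsSkewedTheta G)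
    {c v w : V} {C : G.Walk c c} (hC : C.edges.Nodup) (hodd : Odd C.length) (hv : v ∈ C.support)
    (hw : w ∈ C.support) (W : G.Walk v w) (hW : W.edges.Disjoint C.edges) : Even W.length := by
  by_contra hWodd
  have hC' : C.IsCycle := isCycle_of_nodup_edges hG hC fun h => by
    have : C.length = 0 := by rw [← Walk.length_edges, h]; rfl
    rw [this] at hodd
    exact absurd hodd (by decide)
  have hb : W.bypass.edges.Disjoint C.edges := fun e h h' =>
    hW (W.edges_bypass_subset_edges h) h'
  by_cases hpar : Odd W.bypass.length
  · by_cases hvw : v = w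
    · subst hvw
      rw [Walk.length_eq_zero_iff.2 (Walk.isPath_iff_nil.1 W.bypass_isPath)] at hpar
      exact absurd hpar (by decide)
    · exact hθ (containsSkewedTheta_of_odd_ear hC' hodd hv hw hvw W.bypass_isPath hpar hb)
  · refine hθ (containsSkewedTheta_of_disjoint_odd_walks hG h2 C (W.append W.bypass.reverse) hodd
      ?_ ?_)
    · rw [Walk.length_append, Walk.length_reverse]
      grind
    · rw [Walk.edges_append, Walk.edges_reverse, List.disjoint_append_right,
        List.disjoint_reverse_right]
      exact ⟨hW.symm, hb.symm⟩

end OddCycles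

end SkewedTheta

/-! ### Configurations of three pairs of terminals -/

namespace SkewedTheta

open SimpleGraph

section Configurations

variable {V : Type*} {G : SimpleGraph V}

/-- The vertices `x` and `y` are joined by a walk of `G` with edges in `S`. -/
def Conn (G : SimpleGraph V) (S : Finset (Sym2 V)) (x y : V) : Prop :=
  ∃ p : G.Walk x y, ∀ e ∈ p.edges, e ∈ S

theorem even_length_iff {side : V → Bool} {x y : V} (p : G.Walk x y)
    (hp : ∀ u v, s(u, v) ∈ p.edges → side u ≠ side v) : Even p.length ↔ side x = side y := by
  induction p with
  | nil => simp
  | @cons u v w h p ih =>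
    have h1 := ih fun x y hxy => hp x y (by simp [hxy])
    have h2 := hp u v (by simp)
    rw [Walk.length_cons, Nat.even_add_one, h1]
    revert h2
    cases side u <;> cases side v <;> cases side w <;> simp

variable [DecidableEq V]

/-- The number of pairs among `(a, b)` that are separated by `X`: one or zero. -/
def sepNum (X : Finset V) (a b : V) : ℕ := if (a ∈ X ↔ b ∈ X) then 0 else 1

theorem sepNum_comm (X : Finset V) (a b : V) : sepNum X a b = sepNum X b a := by
  simp only [sepNum, iff_comm]

theorem sepNum_eq_one {X : Finset V} {a b : V} (h : ¬ (a ∈ X ↔ b ∈ X)) : sepNum X a b = 1 :=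
  if_neg h

/-- The edges in `S` with both ends in `X`. -/
def inside (S : Finset (Sym2 V)) (X : Finset V) : Finset (Sym2 V) := S ∩ X.sym2

theorem mem_inside {S : Finset (Sym2 V)} {X : Finset V} {x y : V} :
    s(x, y) ∈ inside S X ↔ s(x, y) ∈ S ∧ x ∈ X ∧ y ∈ X := by
  simp [inside]

theorem inside_subset (S : Finset (Sym2 V)) (X : Finset V) : inside S X ⊆ S :=
  Finset.inter_subset_left

variable [Fintype V]

theorem disjoint_inside (S : Finset (Sym2 V)) (X : Finset V) :
    Disjoint (inside S X) (inside S Xᶜ) := by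
  rw [Finset.disjoint_left]
  intro e
  induction e with
  | h x y =>
    rw [mem_inside, mem_inside, Finset.mem_compl]
    exact fun h h' => h'.2.1 h.2.1

theorem cut_compl (S : Finset (Sym2 V)) (X : Finset V) : cut S Xᶜ = cut S X := by
  refine Finset.card_nbij' Prod.swap Prod.swap ?_ ?_ (fun _ _ => rfl) (fun _ _ => rfl)
  · rintro ⟨x, y⟩ h
    simp only [Finset.coe_filter, Finset.mem_univ, true_and, Set.mem_ofPred_eq, Finset.mem_compl,
      not_not, Prod.fst_swap, Prod.snd_swap] at h ⊢
    exact ⟨h.2.1, h.1, Sym2.eq_swap ▸ h.2.2⟩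
  · rintro ⟨x, y⟩ h
    simp only [Finset.coe_filter, Finset.mem_univ, true_and, Set.mem_ofPred_eq, Finset.mem_compl,
      not_not, Prod.fst_swap, Prod.snd_swap] at h ⊢
    exact ⟨h.2.1, h.1, Sym2.eq_swap ▸ h.2.2⟩

/-- The number of edges leaving a set is submodular. -/
theorem cut_inter_add_cut_union (S : Finset (Sym2 V)) (X Y : Finset V) :
    cut S (X ∩ Y) + cut S (X ∪ Y) ≤ cut S X + cut S Y := by
  simp only [cut, Finset.card_filter, ← Finset.sum_add_distrib]
  refine Finset.sum_le_sum fun p _ => ?_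
  simp only [Finset.mem_inter, Finset.mem_union]
  by_cases h1 : p.1 ∈ X <;> by_cases h2 : p.2 ∈ X <;> by_cases h3 : p.1 ∈ Y <;>
    by_cases h4 : p.2 ∈ Y <;> by_cases h5 : s(p.1, p.2) ∈ S <;> simp [h1, h2, h3, h4, h5]

/-- If `Z` sends out fewer than `2 * m` edges and every set that separates two vertices `p` and `q`
of `Z` sends out at least `m` edges, then `p` and `q` are joined inside `Z`. -/
theorem conn_inside {S : Finset (Sym2 V)} (hS : ∀ x y, s(x, y) ∈ S → G.Adj x y) {Z : Finset V}
    {p q : V} (hp : p ∈ Z) (hq : q ∈ Z) {m : ℕ} (hZ : cut S Z < 2 * m)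
    (hpq : ∀ U, p ∈ U → q ∉ U → m ≤ cut S U) (hqp : ∀ U, q ∈ U → p ∉ U → m ≤ cut S U) :
    Conn G (inside S Z) p q := by
  rcases exists_path_or_separated (G := G) (fun x y => s(x, y) ∈ inside S Z)
    (fun x y h => hS x y (mem_inside.1 h).1) {p} {q} with
    ⟨a, ha, b, hb, w, -, hw⟩ | ⟨X, hpX, hqX, hX⟩
  · rw [Finset.mem_singleton] at ha hb
    subst ha hb
    refine ⟨w, fun e he => ?_⟩
    obtain ⟨d, hd, rfl⟩ := List.mem_map.1 he
    exact hw d hd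
  · exfalso
    have hpX' : p ∈ X := hpX (Finset.mem_singleton_self p)
    have hqX' : q ∉ X := Finset.disjoint_right.1 hqX (Finset.mem_singleton_self q)
    have h1 := hpq (X ∩ Z) (by simp [hpX', hp]) (by simp [hqX'])
    have h2 := hqp (Z \ X) (by simp [hqX', hq]) (by simp [hpX'])
    have h3 : cut S (X ∩ Z) + cut S (Z \ X) ≤ cut S Z := by
      simp only [cut]
      rw [← Finset.card_union_of_disjoint]
      · refine Finset.card_le_card fun e he => ?_
        simp only [Finset.mem_union, Finset.mem_filter, Finset.mem_univ, true_and,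
          Finset.mem_inter, Finset.mem_sdiff] at he ⊢
        rcases he with ⟨⟨h4, h5⟩, h6, h7⟩ | ⟨⟨h4, h5⟩, h6, h7⟩
        · refine ⟨h5, fun h8 => hX _ h4 _ (fun h9 => h6 ⟨h9, h8⟩) (mem_inside.2 ⟨h7, h5, h8⟩), h7⟩
        · refine ⟨h4, fun h8 => ?_, h7⟩
          have h9 : e.2 ∈ X := by
            by_contra h9
            exact h6 ⟨h8, h9⟩
          exact hX _ h9 _ h5 (mem_inside.2 ⟨by rwa [Sym2.eq_swap], h8, h4⟩)
      · rw [Finset.disjoint_left]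
        intro e he he'
        simp only [Finset.mem_filter, Finset.mem_univ, true_and,
          Finset.mem_inter, Finset.mem_sdiff] at he he'
        exact he'.1.2 he.1.1
    omega

/-- The standing assumptions on the graph in the search for a contradiction. -/
structure Host (G : SimpleGraph V) : Prop where
  subcubic : Subcubic G
  twoConnected : TwoConnected G
  noTheta : ¬ ContainsSkewedTheta G

/-- A set `S` of edges that all change sides, with three pairs of terminals. Each pair is joined by
a walk outside `S` whose parity is such that it closes up to odd walks along `S`; these walks are
edge-disjoint. Every vertex set is left by at least as many edges in `S` as it separates pairs. -/
structure Config (G : SimpleGraph V) (side : V → Bool) (S : Finset (Sym2 V))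
    (a₁ b₁ a₂ b₂ a₃ b₃ : V) : Prop where
  adj : ∀ x y, s(x, y) ∈ S → G.Adj x y
  flip : ∀ x y, s(x, y) ∈ S → side x ≠ side y
  ears : ∃ (O₁ : G.Walk a₁ b₁) (O₂ : G.Walk a₂ b₂) (O₃ : G.Walk a₃ b₃),
    (O₁.edges ++ (O₂.edges ++ O₃.edges)).Nodup ∧
    (∀ e ∈ S, e ∉ O₁.edges ∧ e ∉ O₂.edges ∧ e ∉ O₃.edges) ∧
    (Odd O₁.length ↔ side a₁ = side b₁) ∧ (Odd O₂.length ↔ side a₂ = side b₂) ∧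
    (Odd O₃.length ↔ side a₃ = side b₃)
  cuts : ∀ X, sepNum X a₁ b₁ + sepNum X a₂ b₂ + sepNum X a₃ b₃ ≤ cut S X

namespace Config

variable {side : V → Bool} {S : Finset (Sym2 V)} {a₁ b₁ a₂ b₂ a₃ b₃ : V}

theorem rotate (h : Config G side S a₁ b₁ a₂ b₂ a₃ b₃) : Config G side S a₂ b₂ a₃ b₃ a₁ b₁ := by
  obtain ⟨O₁, O₂, O₃, hn, hO, p₁, p₂, p₃⟩ := h.ears
  refine ⟨h.adj, h.flip, ⟨O₂, O₃, O₁, ?_, fun e he => ?_, p₂, p₃, p₁⟩, fun X => ?_⟩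
  · rw [← List.append_assoc]
    exact (List.perm_append_comm.nodup_iff).1 hn
  · exact ⟨(hO e he).2.1, (hO e he).2.2, (hO e he).1⟩
  · have := h.cuts X
    omega

theorem flip₁ (h : Config G side S a₁ b₁ a₂ b₂ a₃ b₃) : Config G side S b₁ a₁ a₂ b₂ a₃ b₃ := by
  obtain ⟨O₁, O₂, O₃, hn, hO, p₁, p₂, p₃⟩ := h.ears
  refine ⟨h.adj, h.flip, ⟨O₁.reverse, O₂, O₃, ?_, ?_, ?_, p₂, p₃⟩, fun X => ?_⟩
  · rw [Walk.edges_reverse]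
    exact (((List.reverse_perm _).append_right _).nodup_iff).2 hn
  · simpa using hO
  · rw [Walk.length_reverse, p₁, eq_comm]
  · rw [sepNum_comm X b₁]
    exact h.cuts X

theorem exchange (h : Config G side S a₁ b₁ a₂ b₂ a₃ b₃) : Config G side S a₂ b₂ a₁ b₁ a₃ b₃ := by
  obtain ⟨O₁, O₂, O₃, hn, hO, p₁, p₂, p₃⟩ := h.ears
  refine ⟨h.adj, h.flip, ⟨O₂, O₁, O₃, ?_, fun e he => ?_, p₂, p₁, p₃⟩, fun X => ?_⟩
  · rw [← List.append_assoc] at hn ⊢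
    exact ((List.perm_append_comm.append_right _).nodup_iff).1 hn
  · exact ⟨(hO e he).2.1, (hO e he).1, (hO e he).2.2⟩
  · have := h.cuts X
    omega

theorem even_iff (h : Config G side S a₁ b₁ a₂ b₂ a₃ b₃) {x y : V} {p : G.Walk x y}
    (hp : ∀ e ∈ p.edges, e ∈ S) : Even p.length ↔ side x = side y :=
  even_length_iff p fun u v huv => h.flip u v (hp _ huv)

/-- Disjoint connections of two pairs close up along the ears to disjoint odd walks. -/
theorem false_of_disjoint (h : Config G side S a₁ b₁ a₂ b₂ a₃ b₃) (hG : Host G)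
    {S₁ S₂ : Finset (Sym2 V)} (h₁ : S₁ ⊆ S) (h₂ : S₂ ⊆ S) (hd : Disjoint S₁ S₂)
    (c₁ : Conn G S₁ a₁ b₁) (c₂ : Conn G S₂ a₂ b₂) : False := by
  obtain ⟨O₁, O₂, O₃, hn, hO, p₁, p₂, p₃⟩ := h.ears
  obtain ⟨P₁, hP₁⟩ := c₁
  obtain ⟨P₂, hP₂⟩ := c₂
  have e₁ := h.even_iff fun e he => h₁ (hP₁ e he)
  have e₂ := h.even_iff fun e he => h₂ (hP₂ e he)
  refine hG.noTheta (containsSkewedTheta_of_disjoint_odd_walks hG.subcubic hG.twoConnected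
    (O₁.append P₁.reverse) (O₂.append P₂.reverse) ?_ ?_ ?_)
  · rw [Walk.length_append, Walk.length_reverse]
    grind
  · rw [Walk.length_append, Walk.length_reverse]
    grind
  · simp only [Walk.edges_append, Walk.edges_reverse, List.disjoint_append_left,
      List.disjoint_append_right, List.disjoint_reverse_left, List.disjoint_reverse_right]
    refine ⟨⟨?_, ?_⟩, ?_, ?_⟩
    · simp only [List.nodup_append', List.disjoint_append_right] at hn
      exact hn.2.2.1
    · exact fun e he he' => (hO e (h₁ (hP₁ e he))).2.1 he'
    · exact fun e he he' => (hO e (h₂ (hP₂ e he'))).1 he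
    · exact fun e he he' => Finset.disjoint_left.1 hd (hP₁ e he) (hP₂ e he')

/-- A single edge in `S` cannot have one pair on each side, since both would be connected on their
own sides. -/
theorem false_of_apart (h : Config G side S a₁ b₁ a₂ b₂ a₃ b₃) (hG : Host G) {X : Finset V}
    (ha₁ : a₁ ∈ X) (hb₁ : b₁ ∈ X) (ha₂ : a₂ ∉ X) (hb₂ : b₂ ∉ X) (hX : cut S X ≤ 1) : False := by
  have hsep : ∀ {a b : V} (U : Finset V), a ∈ U → b ∉ U → sepNum U a b = 1 :=
    fun U ha hb => sepNum_eq_one (by simp [ha, hb])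
  have hsep' : ∀ {a b : V} (U : Finset V), b ∈ U → a ∉ U → sepNum U a b = 1 :=
    fun U ha hb => sepNum_eq_one (by simp [ha, hb])
  refine h.false_of_disjoint hG (inside_subset S X) (inside_subset S Xᶜ) (disjoint_inside S X)
    (conn_inside (m := 1) h.adj ha₁ hb₁ (by omega) (fun U ha hb => ?_) (fun U ha hb => ?_))
    (conn_inside (m := 1) h.adj (by simpa using ha₂) (by simpa using hb₂)
      (by rw [cut_compl]; omega) (fun U ha hb => ?_) (fun U ha hb => ?_))
  · have := h.cuts U; rw [hsep U ha hb] at this; omega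
  · have := h.cuts U; rw [hsep' U ha hb] at this; omega
  · have := h.cuts U; rw [hsep U ha hb] at this; omega
  · have := h.cuts U; rw [hsep' U ha hb] at this; omega

/-- A terminal that is cut off from all others by a single edge in `S` can be moved to the other
end of that edge. -/
theorem shift (h : Config G side S a₁ b₁ a₂ b₂ a₃ b₃) {X : Finset V}
    (ha₁ : a₁ ∈ X) (hb₁ : b₁ ∉ X) (ha₂ : a₂ ∉ X) (hb₂ : b₂ ∉ X) (ha₃ : a₃ ∉ X) (hb₃ : b₃ ∉ X)
    (hX : cut S X ≤ 1) :
    ∃ (v : V) (S' : Finset (Sym2 V)), Config G side S' v b₁ a₂ b₂ a₃ b₃ ∧ S'.card < S.card := by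
  have hX1 : cut S X = 1 := by
    have := h.cuts X
    rw [sepNum_eq_one (a := a₁) (b := b₁) (by simp [ha₁, hb₁])] at this
    omega
  obtain ⟨⟨u, v⟩, huv⟩ := Finset.card_eq_one.1 hX1
  have huv' : ∀ x y, (x ∈ X ∧ y ∉ X ∧ s(x, y) ∈ S) ↔ (x = u ∧ y = v) := fun x y => by
    have := Finset.ext_iff.1 huv (x, y)
    simpa using this
  obtain ⟨huX, hvX, huvS⟩ := (huv' u v).2 ⟨rfl, rfl⟩
  obtain ⟨p, hp, hpX⟩ : ∃ p : G.Walk u a₁, p.IsPath ∧ ∀ e ∈ p.edges, e ∈ inside S X := by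
    rcases exists_path_or_separated (G := G) (fun x y => s(x, y) ∈ inside S X)
      (fun x y h' => h.adj x y (mem_inside.1 h').1) {u} {a₁} with
      ⟨a, ha, b, hb, w, hw, hwX⟩ | ⟨X', huX', haX', hX'⟩
    · rw [Finset.mem_singleton] at ha hb
      subst ha hb
      refine ⟨w, hw, fun e he => ?_⟩
      obtain ⟨d, hd, rfl⟩ := List.mem_map.1 he
      exact hwX d hd
    · exfalso
      have huX'' : u ∈ X' := huX' (Finset.mem_singleton_self u)
      have haX'' : a₁ ∉ X' := Finset.disjoint_right.1 haX' (Finset.mem_singleton_self a₁)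
      have h1 := h.cuts (X \ X')
      rw [sepNum_eq_one (a := a₁) (b := b₁) (by simp [ha₁, hb₁, haX''])] at h1
      have h2 : cut S (X \ X') = 0 := by
        refine Finset.card_eq_zero.2 (Finset.filter_eq_empty_iff.2 ?_)
        rintro ⟨x, y⟩ - ⟨hx, hy, hxy⟩
        simp only [Finset.mem_sdiff] at hx hy hxy
        by_cases hyX : y ∈ X
        · have hy' : y ∈ X' := by
            by_contra h'
            exact hy ⟨hyX, h'⟩
          exact hX' y hy' x hx.2 (mem_inside.2 ⟨by rwa [Sym2.eq_swap], hyX, hx.1⟩)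
        · exact hx.2 (((huv' x y).1 ⟨hx.1, hyX, hxy⟩).1 ▸ huX'')
      omega
  have hvu : G.Adj v u := (h.adj u v huvS).symm
  have hout : ∀ e ∈ inside S Xᶜ, e ∈ S ∧ e ∉ inside S X ∧ e ≠ s(v, u) := by
    intro e he
    refine ⟨inside_subset _ _ he, Finset.disjoint_right.1 (disjoint_inside S X) he, ?_⟩
    rintro rfl
    exact (Finset.mem_compl.1 (mem_inside.1 he).2.2) huX
  -- The new ear runs from `v` through `u` and inside `X` to `a₁`, and then along the old ear.
  refine ⟨v, inside S Xᶜ, ⟨fun x y hxy => h.adj x y (mem_inside.1 hxy).1,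
    fun x y hxy => h.flip x y (mem_inside.1 hxy).1, ?_, fun Z => ?_⟩, ?_⟩
  · obtain ⟨O₁, O₂, O₃, hn, hO, p₁, p₂, p₃⟩ := h.ears
    refine ⟨Walk.cons hvu (p.append O₁), O₂, O₃, ?_, fun e he => ?_, ?_, p₂, p₃⟩
    · simp only [Walk.edges_cons, Walk.edges_append, List.cons_append, List.append_assoc,
        List.nodup_cons]
      refine ⟨fun hmem => ?_, List.nodup_append'.2 ⟨hp.isTrail.edges_nodup, hn, fun e he he' => ?_⟩⟩
      · have h3 := hO s(u, v) huvS
        rw [Sym2.eq_swap] at hmem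
        simp only [List.mem_append] at hmem
        rcases hmem with h4 | h4 | h4 | h4
        · exact hvX (mem_inside.1 (hpX _ h4)).2.2
        · exact h3.1 h4
        · exact h3.2.1 h4
        · exact h3.2.2 h4
      · have h3 := hO e (inside_subset _ _ (hpX e he))
        simp only [List.mem_append] at he'
        tauto
    · have h3 := hout e he
      have h4 := hO e h3.1
      refine ⟨?_, h4.2⟩
      simp only [Walk.edges_cons, Walk.edges_append, List.mem_cons, List.mem_append, not_or]
      exact ⟨h3.2.2, fun h5 => h3.2.1 (hpX e h5), h4.1⟩
    · have h3 := h.even_iff fun e he => inside_subset _ _ (hpX e he)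
      have h4 := h.flip u v huvS
      rw [Walk.length_cons, Walk.length_append]
      have h5 : Odd (p.length + O₁.length + 1) ↔ (Even p.length ↔ ¬ Odd O₁.length) := by
        grind
      rw [h5, h3, p₁]
      revert h4
      cases side u <;> cases side v <;> cases side a₁ <;> cases side b₁ <;> simp
  -- the set that agrees with `Z` outside `X`, and on which `X` behaves like `v`
  · set Z' : Finset V := (Z \ X) ∪ (if v ∈ Z then X else ∅) with hZ'
    have hmem : ∀ x, x ∉ X → (x ∈ Z' ↔ x ∈ Z) := fun x hx => by
      by_cases hvZ : v ∈ Z <;> simp [hZ', hx, hvZ]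
    have hmem' : ∀ x, x ∈ X → (x ∈ Z' ↔ v ∈ Z) := fun x hx => by
      by_cases hvZ : v ∈ Z <;> simp [hZ', hx, hvZ]
    have h1 := h.cuts Z'
    have h2 : cut S Z' ≤ cut (inside S Xᶜ) Z := by
      refine Finset.card_le_card ?_
      rintro ⟨x, y⟩ hxy
      simp only [Finset.mem_filter, Finset.mem_univ, true_and] at hxy ⊢
      obtain ⟨hx, hy, hxyS⟩ := hxy
      by_cases hxX : x ∈ X
      · exfalso
        rw [hmem' x hxX] at hx
        have hyX : y ∉ X := fun h' => hy ((hmem' y h').2 hx)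
        obtain ⟨-, rfl⟩ := (huv' x y).1 ⟨hxX, hyX, hxyS⟩
        exact hy ((hmem y hyX).2 hx)
      · rw [hmem x hxX] at hx
        by_cases hyX : y ∈ X
        · exfalso
          rw [hmem' y hyX] at hy
          obtain ⟨-, rfl⟩ := (huv' y x).1 ⟨hyX, hxX, by rwa [Sym2.eq_swap]⟩
          exact hy hx
        · rw [hmem y hyX] at hy
          exact ⟨hx, hy, mem_inside.2 ⟨hxyS, by simpa using hxX, by simpa using hyX⟩⟩
    simp only [sepNum, hmem _ hb₁, hmem _ ha₂, hmem _ hb₂, hmem _ ha₃, hmem _ hb₃,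
      hmem' _ ha₁] at h1 ⊢
    omega
  · refine Finset.card_lt_card ⟨inside_subset _ _, fun h' => ?_⟩
    exact (Finset.mem_compl.1 (mem_inside.1 (h' huvS)).2.1) huX

theorem exists_smaller_of_separated (h : Config G side S a₁ b₁ a₂ b₂ a₃ b₃) (hG : Host G)
    {X : Finset V} (h₁ : ¬ (a₁ ∈ X ↔ b₁ ∈ X)) (h₂ : a₂ ∈ X ↔ b₂ ∈ X) (h₃ : a₃ ∈ X ↔ b₃ ∈ X)
    (hX : cut S X ≤ 1) :
    ∃ (S' : Finset (Sym2 V)) (a₁ b₁ a₂ b₂ a₃ b₃ : V), Config G side S' a₁ b₁ a₂ b₂ a₃ b₃ ∧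
      S'.card < S.card := by
  by_cases ha₂ : a₂ ∈ X <;> by_cases ha₃ : a₃ ∈ X
  · have hX' : cut S Xᶜ ≤ 1 := by rwa [cut_compl]
    have hb₂ := h₂.1 ha₂
    have hb₃ := h₃.1 ha₃
    by_cases ha₁ : a₁ ∈ X
    · obtain ⟨v, S', hc, hS'⟩ := h.flip₁.shift (X := Xᶜ) (by simp; tauto) (by simp [ha₁])
        (by simp [ha₂]) (by simp [hb₂]) (by simp [ha₃]) (by simp [hb₃]) hX'
      exact ⟨S', _, _, _, _, _, _, hc, hS'⟩
    · obtain ⟨v, S', hc, hS'⟩ := h.shift (X := Xᶜ) (by simp [ha₁]) (by simp; tauto)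
        (by simp [ha₂]) (by simp [hb₂]) (by simp [ha₃]) (by simp [hb₃]) hX'
      exact ⟨S', _, _, _, _, _, _, hc, hS'⟩
  · exact (h.rotate.false_of_apart hG ha₂ (h₂.1 ha₂) ha₃ (mt h₃.2 ha₃) hX).elim
  · exact (h.rotate.exchange.false_of_apart hG ha₃ (h₃.1 ha₃) ha₂ (mt h₂.2 ha₂) hX).elim
  · have hb₂ := mt h₂.2 ha₂
    have hb₃ := mt h₃.2 ha₃
    by_cases ha₁ : a₁ ∈ X
    · obtain ⟨v, S', hc, hS'⟩ := h.shift ha₁ (by tauto) ha₂ hb₂ ha₃ hb₃ hX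
      exact ⟨S', _, _, _, _, _, _, hc, hS'⟩
    · obtain ⟨v, S', hc, hS'⟩ := h.flip₁.shift (X := X) (by tauto) ha₁ ha₂ hb₂ ha₃ hb₃ hX
      exact ⟨S', _, _, _, _, _, _, hc, hS'⟩

/-- Either every set that contains some but not all terminals is left by at least two edges in `S`,
or there is a smaller configuration. -/
theorem two_le_cut_or_exists_smaller (h : Config G side S a₁ b₁ a₂ b₂ a₃ b₃) (hG : Host G) :
    (∀ X : Finset V, ∀ t ∈ ({a₁, b₁, a₂, b₂, a₃, b₃} : Set V),
      ∀ t' ∈ ({a₁, b₁, a₂, b₂, a₃, b₃} : Set V), t ∈ X → t' ∉ X → 2 ≤ cut S X) ∨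
    ∃ (S' : Finset (Sym2 V)) (a₁ b₁ a₂ b₂ a₃ b₃ : V), Config G side S' a₁ b₁ a₂ b₂ a₃ b₃ ∧
      S'.card < S.card := by
  by_contra! hcon
  obtain ⟨⟨X, t, ht, t', ht', htX, htX', hX⟩, hno⟩ := hcon
  have hX1 : cut S X ≤ 1 := by omega
  have hc := h.cuts X
  have hno' : ¬ ∃ (S' : Finset (Sym2 V)) (a₁ b₁ a₂ b₂ a₃ b₃ : V),
      Config G side S' a₁ b₁ a₂ b₂ a₃ b₃ ∧ S'.card < S.card := by
    rintro ⟨S', a₁, b₁, a₂, b₂, a₃, b₃, h1, h2⟩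
    exact absurd h2 (not_lt.2 (hno S' a₁ b₁ a₂ b₂ a₃ b₃ h1))
  by_cases h₁ : a₁ ∈ X ↔ b₁ ∈ X
  · by_cases h₂ : a₂ ∈ X ↔ b₂ ∈ X
    · by_cases h₃ : a₃ ∈ X ↔ b₃ ∈ X
      · have e₁ := h.false_of_apart hG (X := X)
        have e₂ := h.exchange.false_of_apart hG (X := X)
        have e₃ := h.rotate.false_of_apart hG (X := X)
        have e₄ := h.rotate.exchange.false_of_apart hG (X := X)
        have e₅ := h.rotate.rotate.false_of_apart hG (X := X)
        have e₆ := h.rotate.rotate.exchange.false_of_apart hG (X := X)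
        simp only [Set.mem_insert_iff, Set.mem_singleton_iff] at ht ht'
        by_cases k₁ : a₁ ∈ X <;> by_cases k₂ : a₂ ∈ X <;> by_cases k₃ : a₃ ∈ X <;>
          simp_all <;> grind
      · exact hno' (h.rotate.rotate.exists_smaller_of_separated hG h₃ h₁ h₂ hX1)
    · have h₃ : a₃ ∈ X ↔ b₃ ∈ X := by
        by_contra h₃
        rw [sepNum_eq_one h₂, sepNum_eq_one h₃] at hc
        omega
      exact hno' (h.rotate.exists_smaller_of_separated hG h₂ h₃ h₁ hX1)
  · have h₂ : a₂ ∈ X ↔ b₂ ∈ X := by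
      by_contra h₂
      rw [sepNum_eq_one h₂, sepNum_eq_one h₁] at hc
      omega
    have h₃ : a₃ ∈ X ↔ b₃ ∈ X := by
      by_contra h₃
      rw [sepNum_eq_one h₁, sepNum_eq_one h₃] at hc
      omega
    exact hno' (h.exists_smaller_of_separated hG h₁ h₂ h₃ hX1)

end Config

end Configurations

end SkewedTheta

/-! ### Parities along crossing walks -/

namespace SkewedTheta

open SimpleGraph

section Crossings

set_option linter.unusedSimpArgs false

variable {V : Type*} {G : SimpleGraph V}

/-- The parity of a walk whose edges all change sides, in a form suitable for linear arithmetic. -/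
theorem length_add_toNat_mod_two {side : V → Bool} {x y : V} (p : G.Walk x y)
    (hp : ∀ u v, s(u, v) ∈ p.edges → side u ≠ side v) :
    (p.length + (side x).toNat + (side y).toNat) % 2 = 0 := by
  have h := even_length_iff p hp
  rw [Nat.even_iff] at h
  revert h
  cases side x <;> cases side y <;> simp <;> omega

variable [DecidableEq V]

/-- Two vertices of a walk split it into three parts, in one of the two orders. -/
theorem exists_split {x y t t' : V} (p : G.Walk x y) (ht : t ∈ p.support) (ht' : t' ∈ p.support) :
    (∃ (α : G.Walk x t) (μ : G.Walk t t') (ω : G.Walk t' y),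
      p.edges = α.edges ++ (μ.edges ++ ω.edges)) ∨
    ∃ (α : G.Walk x t') (μ : G.Walk t' t) (ω : G.Walk t y),
      p.edges = α.edges ++ (μ.edges ++ ω.edges) := by
  have h := p.take_spec ht
  rw [← h, Walk.mem_support_append_iff] at ht'
  rcases ht' with h' | h'
  · right
    refine ⟨(p.takeUntil t ht).takeUntil t' h', (p.takeUntil t ht).dropUntil t' h',
      p.dropUntil t ht, ?_⟩
    rw [← List.append_assoc, ← Walk.edges_append, Walk.take_spec, ← Walk.edges_append, h]
  · left
    refine ⟨p.takeUntil t ht, (p.dropUntil t ht).takeUntil t' h',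
      (p.dropUntil t ht).dropUntil t' h', ?_⟩
    rw [← Walk.edges_append, Walk.take_spec, ← Walk.edges_append, h]

theorem false_of_four (hG : Subcubic G) (x : V) {l₁ l₂ l₃ l₄ : List (Sym2 V)}
    (hl : (l₁ ++ (l₂ ++ (l₃ ++ l₄))).Nodup)
    (hlG : ∀ e ∈ l₁ ++ (l₂ ++ (l₃ ++ l₄)), e ∈ G.edgeSet)
    (h₁ : 1 ≤ l₁.countP (x ∈ ·)) (h₂ : 1 ≤ l₂.countP (x ∈ ·)) (h₃ : 1 ≤ l₃.countP (x ∈ ·))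
    (h₄ : 1 ≤ l₄.countP (x ∈ ·)) : False := by
  have h := countP_le_three hG x hl hlG
  simp only [List.countP_append] at h
  omega

variable [Fintype V]

/-- A walk between vertices of `P` is even when `P` and `O` close up to an odd cycle. -/
theorem even_of_route (hG : Host G) {a b v w : V} {O P : G.Walk a b}
    (W : G.Walk v w) (hn : (W.edges ++ (P.edges ++ O.edges)).Nodup)
    (hodd : Odd (P.length + O.length)) (hv : v ∈ P.support) (hw : w ∈ P.support) :
    Even W.length := by
  obtain ⟨-, hn, hd⟩ := List.nodup_append'.1 hn
  rw [List.disjoint_append_right] at hd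
  refine even_of_odd_cycle hG.subcubic hG.twoConnected hG.noTheta (C := P.append O.reverse)
    ?_ ?_ ?_ ?_ W ?_
  · rw [Walk.edges_append, Walk.edges_reverse]
    exact (((List.reverse_perm _).append_left _).nodup_iff).2 hn
  · rwa [Walk.length_append, Walk.length_reverse]
  · exact (Walk.mem_support_append_iff _ _).2 (Or.inl hv)
  · exact (Walk.mem_support_append_iff _ _).2 (Or.inl hw)
  · rw [Walk.edges_append, Walk.edges_reverse, List.disjoint_append_right,
      List.disjoint_reverse_right]
    exact hd

/-- The crossing pattern: `a₁` and `a₂` are joined by the two walks `α μ ω` and `w`, the vertices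
`b₂` and `b₁` by the walk `γ ν β`, and the walks `R` and `R'` cross between them. The parities of
walks that avoid suitable odd cycles are incompatible. -/
theorem false_of_crossing (hG : Host G) {side : V → Bool} {S : Finset (Sym2 V)}
    (hS : ∀ x y, s(x, y) ∈ S → side x ≠ side y) {a₁ b₁ a₂ b₂ t t' r r' : V}
    {O₁ : G.Walk a₁ b₁} {O₂ : G.Walk a₂ b₂} (α : G.Walk a₁ t) (μ : G.Walk t t') (ω : G.Walk t' a₂)
    (w : G.Walk a₁ a₂) (R : G.Walk t r) (R' : G.Walk t' r') (γ : G.Walk b₂ r) (ν : G.Walk r r')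
    (β : G.Walk r' b₁)
    (hn : (α.edges ++ (μ.edges ++ (ω.edges ++ (w.edges ++ (R.edges ++ (R'.edges ++ (γ.edges ++
      (ν.edges ++ (β.edges ++ (O₁.edges ++ O₂.edges)))))))))).Nodup)
    (hα : ∀ e ∈ α.edges, e ∈ S) (hμ : ∀ e ∈ μ.edges, e ∈ S) (hω : ∀ e ∈ ω.edges, e ∈ S)
    (hw : ∀ e ∈ w.edges, e ∈ S) (hR : ∀ e ∈ R.edges, e ∈ S) (hR' : ∀ e ∈ R'.edges, e ∈ S)
    (hγ : ∀ e ∈ γ.edges, e ∈ S) (hν : ∀ e ∈ ν.edges, e ∈ S) (hβ : ∀ e ∈ β.edges, e ∈ S)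
    (hO₁ : Odd O₁.length) (hO₂ : Odd O₂.length) (s₁ : side a₁ = side b₁)
    (s₂ : side a₂ = side b₂) : False := by
  have par : ∀ {x y : V} (p : G.Walk x y), (∀ e ∈ p.edges, e ∈ S) →
      (p.length + (side x).toNat + (side y).toNat) % 2 = 0 := fun p hp =>
    length_add_toNat_mod_two p fun u v huv => hS u v (hp _ huv)
  replace hα := par α hα
  replace hμ := par μ hμ
  replace hω := par ω hω
  replace hw := par w hw
  replace hR := par R hR
  replace hR' := par R' hR'
  replace hγ := par γ hγ
  replace hν := par ν hν
  replace hβ := par β hβ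
  replace s₁ := congrArg Bool.toNat s₁
  replace s₂ := congrArg Bool.toNat s₂
  rw [Nat.odd_iff] at hO₁ hO₂
  clear par hS
  simp only [List.nodup_append', List.disjoint_append_left, List.disjoint_append_right] at hn
  casesm* _ ∧ _
  -- Two odd cycles through `O₁` and one through `O₂`; the five even walks express incompatible
  -- relations between the sides of `a₁`, `a₂`, `r`, `r'` and `t'`.
  have F₁ := even_of_route hG (O := O₁) (P := α.append (R.append (ν.append β))) (v := r') (w := a₁)
    (R'.reverse.append (ω.append w.reverse))
    (by
      simp only [Walk.edges_append, Walk.edges_reverse, List.nodup_append', List.nodup_reverse,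
        List.disjoint_append_left, List.disjoint_append_right, List.disjoint_reverse_left,
        List.disjoint_reverse_right]
      constructorm* _ ∧ _ <;> first | assumption | exact List.Disjoint.symm (by assumption))
    (by
      simp only [Walk.length_append, Walk.length_reverse, Nat.odd_iff]
      omega)
    (by simp [Walk.mem_support_append_iff]) (by simp [Walk.mem_support_append_iff])
  have F₂ := even_of_route hG (O := O₁) (P := α.append (R.append (ν.append β))) (v := r') (w := r)
    (R'.reverse.append (ω.append (O₂.append γ)))
    (by
      simp only [Walk.edges_append, Walk.edges_reverse, List.nodup_append', List.nodup_reverse,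
        List.disjoint_append_left, List.disjoint_append_right, List.disjoint_reverse_left,
        List.disjoint_reverse_right]
      constructorm* _ ∧ _ <;> first | assumption | exact List.Disjoint.symm (by assumption))
    (by
      simp only [Walk.length_append, Walk.length_reverse, Nat.odd_iff]
      omega)
    (by simp [Walk.mem_support_append_iff]) (by simp [Walk.mem_support_append_iff])
  have F₃ := even_of_route hG (O := O₁)
    (P := w.append (ω.reverse.append (R'.append β))) (v := a₁) (w := t')
    (α.append μ)
    (by
      simp only [Walk.edges_append, Walk.edges_reverse, List.nodup_append', List.nodup_reverse,
        List.disjoint_append_left, List.disjoint_append_right, List.disjoint_reverse_left,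
        List.disjoint_reverse_right]
      constructorm* _ ∧ _ <;> first | assumption | exact List.Disjoint.symm (by assumption))
    (by
      simp only [Walk.length_append, Walk.length_reverse, Nat.odd_iff]
      omega)
    (by simp [Walk.mem_support_append_iff]) (by simp [Walk.mem_support_append_iff])
  have F₄ := even_of_route hG (O := O₂)
    (P := ω.reverse.append (R'.append (ν.reverse.append γ.reverse))) (v := a₂) (w := t')
    (w.reverse.append (α.append μ))
    (by
      simp only [Walk.edges_append, Walk.edges_reverse, List.nodup_append', List.nodup_reverse,
        List.disjoint_append_left, List.disjoint_append_right, List.disjoint_reverse_left,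
        List.disjoint_reverse_right]
      constructorm* _ ∧ _ <;> first | assumption | exact List.Disjoint.symm (by assumption))
    (by
      simp only [Walk.length_append, Walk.length_reverse, Nat.odd_iff]
      omega)
    (by simp [Walk.mem_support_append_iff]) (by simp [Walk.mem_support_append_iff])
  have F₅ := even_of_route hG (O := O₂)
    (P := ω.reverse.append (R'.append (ν.reverse.append γ.reverse))) (v := r) (w := a₂)
    (R.reverse.append (α.reverse.append w))
    (by
      simp only [Walk.edges_append, Walk.edges_reverse, List.nodup_append', List.nodup_reverse,
        List.disjoint_append_left, List.disjoint_append_right, List.disjoint_reverse_left,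
        List.disjoint_reverse_right]
      constructorm* _ ∧ _ <;> first | assumption | exact List.Disjoint.symm (by assumption))
    (by
      simp only [Walk.length_append, Walk.length_reverse, Nat.odd_iff]
      omega)
    (by simp [Walk.mem_support_append_iff]) (by simp [Walk.mem_support_append_iff])
  simp only [Walk.length_append, Walk.length_reverse, Nat.even_iff] at F₁ F₂ F₃ F₄ F₅
  omega

end Crossings

end SkewedTheta

/-! ### Configurations without bridges -/

namespace SkewedTheta

open SimpleGraph

section Bridgeless

set_option linter.unusedSimpArgs false

variable {V : Type*} [DecidableEq V] {G : SimpleGraph V} [Fintype V]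

theorem cut_singleton_le (S : Finset (Sym2 V)) (x : V) :
    cut S {x} ≤ (S.filter (x ∈ ·)).card := by
  refine Finset.card_le_card_of_injOn (fun p => s(p.1, p.2)) ?_ ?_
  · rintro ⟨y, z⟩ h
    simp only [Finset.coe_filter, Finset.mem_univ, true_and, Set.mem_ofPred_eq,
      Finset.mem_singleton] at h ⊢
    obtain ⟨rfl, -, h⟩ := h
    exact ⟨h, by simp⟩
  · rintro ⟨y, z⟩ h ⟨y', z'⟩ h' heq
    simp only [Finset.coe_filter, Finset.mem_univ, true_and, Set.mem_ofPred_eq,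
      Finset.mem_singleton] at h h' heq
    obtain ⟨rfl, -, -⟩ := h
    obtain ⟨rfl, -, -⟩ := h'
    rw [Sym2.congr_right] at heq
    rw [heq]

theorem cut_univ (S : Finset (Sym2 V)) : cut S Finset.univ = 0 := by
  simp [cut]

namespace Config

variable {side : V → Bool} {S : Finset (Sym2 V)} {a₁ b₁ a₂ b₂ a₃ b₃ : V}

theorem conn (h : Config G side S a₁ b₁ a₂ b₂ a₃ b₃) : Conn G S a₁ b₁ := by
  obtain ⟨p, hp⟩ := conn_inside (m := 1) h.adj (Finset.mem_univ a₁) (Finset.mem_univ b₁)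
    (by simp [cut_univ])
    (fun U ha hb => by
      have := h.cuts U
      rw [sepNum_eq_one (a := a₁) (b := b₁) (by simp [ha, hb])] at this
      omega)
    (fun U ha hb => by
      have := h.cuts U
      rw [sepNum_eq_one (a := a₁) (b := b₁) (by simp [ha, hb])] at this
      omega)
  exact ⟨p, fun e he => inside_subset _ _ (hp e he)⟩

theorem ne_pair (h : Config G side S a₁ b₁ a₂ b₂ a₃ b₃) (hG : Host G) : a₁ ≠ b₁ := by
  rintro rfl
  exact h.false_of_disjoint hG (Finset.empty_subset S) subset_rfl (Finset.disjoint_empty_left S)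
    ⟨.nil, by simp⟩ h.exchange.conn

/-- Terminals of different pairs are distinct: a common terminal would be incident with both ears
and with two edges in `S`. -/
theorem ne_left (h : Config G side S a₁ b₁ a₂ b₂ a₃ b₃) (hG : Host G) : a₁ ≠ a₂ := by
  rintro rfl
  have n₁ := h.ne_pair hG
  have n₂ := h.exchange.ne_pair hG
  obtain ⟨O₁, O₂, O₃, hn, hO, -, -, -⟩ := h.ears
  have h1 := h.cuts {a₁}
  rw [sepNum_eq_one (a := a₁) (b := b₁) (by simp [n₁.symm]),
    sepNum_eq_one (a := a₁) (b := b₂) (by simp [n₂.symm])] at h1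
  have h2 := cut_singleton_le S a₁
  have h3 := countP_le_three hG.subcubic a₁
    (l := (S.filter (a₁ ∈ ·)).toList ++ (O₁.edges ++ O₂.edges)) ?_ ?_
  · rw [List.countP_append, List.countP_append, List.countP_eq_length.2, Finset.length_toList] at h3
    · have h4 := one_le_countP_left O₁ n₁
      have h5 := one_le_countP_left O₂ n₂
      omega
    · intro e he
      simpa using (Finset.mem_filter.1 (Finset.mem_toList.1 he)).2
  · rw [← List.append_assoc] at hn
    refine List.nodup_append'.2 ⟨Finset.nodup_toList _, (List.nodup_append'.1 hn).1, ?_⟩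
    intro e he he'
    have := hO e (Finset.mem_filter.1 (Finset.mem_toList.1 he)).1
    rcases List.mem_append.1 he' with h4 | h4 <;> tauto
  · intro e he
    rcases List.mem_append.1 he with he | he
    · have h4 := (Finset.mem_filter.1 (Finset.mem_toList.1 he)).1
      revert h4
      induction e with
      | h x y => exact fun h4 => h.adj x y h4
    · rcases List.mem_append.1 he with he | he
      · exact Walk.edges_subset_edgeSet _ he
      · exact Walk.edges_subset_edgeSet _ he

theorem false_of_walks (h : Config G side S a₁ b₁ a₂ b₂ a₃ b₃) (hG : Host G)
    (P₁ : G.Walk a₁ b₁) (P₂ : G.Walk a₂ b₂) (h₁ : ∀ e ∈ P₁.edges, e ∈ S)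
    (h₂ : ∀ e ∈ P₂.edges, e ∈ S) (hd : P₁.edges.Disjoint P₂.edges) : False := by
  refine h.false_of_disjoint hG (S₁ := P₁.edges.toFinset) (S₂ := P₂.edges.toFinset)
    (fun e he => h₁ e (by simpa using he)) (fun e he => h₂ e (by simpa using he)) ?_
    ⟨P₁, by simp⟩ ⟨P₂, by simp⟩
  rw [Finset.disjoint_left]
  intro e he he'
  exact hd (by simpa using he) (by simpa using he')

end Config

/-- A configuration in which no edge in `S` separates two terminals along `S`. -/
structure Bridgeless (G : SimpleGraph V) (side : V → Bool) (S : Finset (Sym2 V))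
    (a₁ b₁ a₂ b₂ a₃ b₃ : V) : Prop extends Config G side S a₁ b₁ a₂ b₂ a₃ b₃ where
  two_le : ∀ X : Finset V, ∀ t ∈ ({a₁, b₁, a₂, b₂, a₃, b₃} : Set V),
    ∀ t' ∈ ({a₁, b₁, a₂, b₂, a₃, b₃} : Set V), t ∈ X → t' ∉ X → 2 ≤ cut S X

namespace Bridgeless

variable {side : V → Bool} {S : Finset (Sym2 V)} {a₁ b₁ a₂ b₂ a₃ b₃ : V}

theorem exchange (h : Bridgeless G side S a₁ b₁ a₂ b₂ a₃ b₃) :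
    Bridgeless G side S a₂ b₂ a₁ b₁ a₃ b₃ := by
  refine ⟨h.toConfig.exchange, fun X t ht t' ht' => h.two_le X t ?_ t' ?_⟩
  · simp only [Set.mem_insert_iff, Set.mem_singleton_iff] at ht ⊢; tauto
  · simp only [Set.mem_insert_iff, Set.mem_singleton_iff] at ht' ⊢; tauto

theorem flip₁ (h : Bridgeless G side S a₁ b₁ a₂ b₂ a₃ b₃) :
    Bridgeless G side S b₁ a₁ a₂ b₂ a₃ b₃ := by
  refine ⟨h.toConfig.flip₁, fun X t ht t' ht' => h.two_le X t ?_ t' ?_⟩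
  · simp only [Set.mem_insert_iff, Set.mem_singleton_iff] at ht ⊢; tauto
  · simp only [Set.mem_insert_iff, Set.mem_singleton_iff] at ht' ⊢; tauto

theorem flip₂ (h : Bridgeless G side S a₁ b₁ a₂ b₂ a₃ b₃) :
    Bridgeless G side S a₁ b₁ b₂ a₂ a₃ b₃ := h.exchange.flip₁.exchange

/-- The terminals of a pair lie on the same side. By Menger's theorem there are two edge-disjoint
walks between them along `S`, which have the same parity. The ear and one of them form an odd cycle,
so the other one is even. -/
theorem side_eq (h : Bridgeless G side S a₁ b₁ a₂ b₂ a₃ b₃) (hG : Host G) :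
    side a₁ = side b₁ := by
  have hne := h.ne_pair hG
  obtain ⟨O₁, O₂, O₃, hn, hO, p₁, -, -⟩ := h.ears
  have hl : Linked G 2 S {a₁} {b₁} := by
    refine linked_of_le_cut h.adj (by simpa using hne) fun X ha hb => ?_
    exact h.two_le X a₁ (by simp) b₁ (by simp) (ha (by simp))
      (Finset.disjoint_right.1 hb (by simp))
  obtain ⟨a, ha, b, hb, P, hP, hPS, a', ha', b', hb', P', hP', hPS', -⟩ := hl
  rw [Finset.mem_singleton] at ha hb ha' hb'
  subst ha hb ha' hb'
  have e₁ := h.even_iff hPS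
  have e₂ := h.even_iff fun e he => (Finset.mem_sdiff.1 (hPS' e he)).1
  rw [← e₂]
  refine even_of_route hG (O := O₁) (P := P) P' ?_ ?_ P.start_mem_support P.end_mem_support
  · simp only [List.nodup_append', List.disjoint_append_right] at hn ⊢
    refine ⟨hP'.isTrail.edges_nodup, ⟨hP.isTrail.edges_nodup, hn.1, fun e he he' => ?_⟩,
      fun e he he' => ?_, fun e he he' => ?_⟩
    · exact (hO e (hPS e he)).1 he'
    · exact (Finset.mem_sdiff.1 (hPS' e he)).2 (by simpa using he')
    · exact (hO e (Finset.mem_sdiff.1 (hPS' e he)).1).1 he'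
  · grind

/-- Two of the ears, now known to be odd. -/
theorem exists_ears (h : Bridgeless G side S a₁ b₁ a₂ b₂ a₃ b₃) (hG : Host G) :
    ∃ (O₁ : G.Walk a₁ b₁) (O₂ : G.Walk a₂ b₂), O₁.edges.Nodup ∧ O₂.edges.Nodup ∧
      O₁.edges.Disjoint O₂.edges ∧ Odd O₁.length ∧ Odd O₂.length ∧
      ∀ l : List (Sym2 V), (∀ e ∈ l, e ∈ S) → l.Disjoint O₁.edges ∧ l.Disjoint O₂.edges := by
  obtain ⟨O₁, O₂, O₃, hn, hO, p₁, p₂, -⟩ := h.ears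
  simp only [List.nodup_append', List.disjoint_append_right] at hn
  exact ⟨O₁, O₂, hn.1, hn.2.1.1, hn.2.2.1, p₁.2 (h.side_eq hG), p₂.2 (h.exchange.side_eq hG),
    fun l hl => ⟨fun e he he' => (hO e (hl e he)).1 he', fun e he he' => (hO e (hl e he)).2.1 he'⟩⟩

/-- The walk `W₁ O₂ W₃` from `a₁` to `b₁` is odd and avoids the odd cycle that consists of `W₂` and
the ear `O₁`. -/
theorem false_of_fork (h : Bridgeless G side S a₁ b₁ a₂ b₂ a₃ b₃) (hG : Host G)
    {W₁ : G.Walk a₁ a₂} {W₂ : G.Walk a₁ b₁} {W₃ : G.Walk b₂ b₁}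
    (n₁ : W₁.edges.Nodup) (n₂ : W₂.edges.Nodup) (n₃ : W₃.edges.Nodup)
    (s₁ : ∀ e ∈ W₁.edges, e ∈ S) (s₂ : ∀ e ∈ W₂.edges, e ∈ S) (s₃ : ∀ e ∈ W₃.edges, e ∈ S)
    (d₁₂ : W₁.edges.Disjoint W₂.edges) (d₁₃ : W₁.edges.Disjoint W₃.edges)
    (d₂₃ : W₂.edges.Disjoint W₃.edges) : False := by
  obtain ⟨O₁, O₂, m₁, m₂, m, o₁, o₂, hO⟩ := h.exists_ears hG
  obtain ⟨x₁, y₁⟩ := hO _ s₁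
  obtain ⟨x₂, y₂⟩ := hO _ s₂
  obtain ⟨x₃, y₃⟩ := hO _ s₃
  have e₁ := h.even_iff s₁
  have e₂ := h.even_iff s₂
  have e₃ := h.even_iff s₃
  have k₁ := h.side_eq hG
  have k₂ := h.exchange.side_eq hG
  have := even_of_route hG (O := O₁) (P := W₂) (W₁.append (O₂.append W₃))
    (by
      simp only [Walk.edges_append, List.nodup_append', List.disjoint_append_left,
        List.disjoint_append_right]
      constructorm* _ ∧ _ <;> first | assumption | exact List.Disjoint.symm (by assumption))
    (by grind) (by simp) (by simp)
  simp only [Walk.length_append] at this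
  grind

/-- Disjoint walks from `a₁` to `a₂` and from `b₂` to `b₁` do not meet: at a common vertex they
could be exchanged to join the pairs. -/
theorem disjoint_support (h : Bridgeless G side S a₁ b₁ a₂ b₂ a₃ b₃) (hG : Host G)
    {W : G.Walk a₁ a₂} {W₃ : G.Walk b₂ b₁} (n : W.edges.Nodup) (n₃ : W₃.edges.Nodup)
    (s : ∀ e ∈ W.edges, e ∈ S) (s₃ : ∀ e ∈ W₃.edges, e ∈ S) (d : W.edges.Disjoint W₃.edges)
    {z : V} (hz : z ∈ W.support) (hz' : z ∈ W₃.support) : False := by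
  have t : W.IsTrail := ⟨n⟩
  have t₃ : W₃.IsTrail := ⟨n₃⟩
  have i₁ := Walk.edges_takeUntil_subset_edges W hz
  have i₂ := Walk.edges_dropUntil_subset_edges W hz
  have i₃ := Walk.edges_takeUntil_subset_edges W₃ hz'
  have i₄ := Walk.edges_dropUntil_subset_edges W₃ hz'
  have j := t.disjoint_edges_takeUntil_dropUntil hz
  have j₃ := t₃.disjoint_edges_takeUntil_dropUntil hz'
  refine h.false_of_walks hG ((W.takeUntil z hz).append (W₃.dropUntil z hz'))
    ((W.dropUntil z hz).reverse.append (W₃.takeUntil z hz').reverse) ?_ ?_ ?_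
  · intro e he
    rw [Walk.edges_append, List.mem_append] at he
    exact he.elim (fun he => s e (i₁ he)) fun he => s₃ e (i₄ he)
  · intro e he
    rw [Walk.edges_append, List.mem_append, Walk.edges_reverse, Walk.edges_reverse,
      List.mem_reverse, List.mem_reverse] at he
    exact he.elim (fun he => s e (i₂ he)) fun he => s₃ e (i₃ he)
  · simp only [Walk.edges_append, Walk.edges_reverse, List.disjoint_append_left,
      List.disjoint_append_right, List.disjoint_reverse_right]
    exact ⟨⟨j, fun e he he' => d (i₂ he') (i₄ he)⟩, fun e he he' => d (i₁ he) (i₃ he'), j₃.symm⟩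

/-- Two links from a walk between `a₁` and `a₂` to the walk between `b₂` and `b₁`: depending on
their order, they form the crossing pattern or join the pairs disjointly. -/
theorem false_of_links_same (h : Bridgeless G side S a₁ b₁ a₂ b₂ a₃ b₃) (hG : Host G)
    {t t' r r' : V} {W w : G.Walk a₁ a₂} {R : G.Walk t r} {R' : G.Walk t' r'} {γ : G.Walk b₂ r}
    {ν : G.Walk r r'} {β : G.Walk r' b₁}
    (hn : (W.edges ++ (w.edges ++ (R.edges ++ (R'.edges ++ (γ.edges ++ (ν.edges ++
      β.edges)))))).Nodup)
    (hS : ∀ e ∈ W.edges ++ (w.edges ++ (R.edges ++ (R'.edges ++ (γ.edges ++ (ν.edges ++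
      β.edges))))), e ∈ S) (ht : t ∈ W.support) (ht' : t' ∈ W.support) : False := by
  simp only [List.mem_append] at hS
  rcases exists_split W ht ht' with ⟨α, μ, ω, hW⟩ | ⟨α, μ, ω, hW⟩
  · obtain ⟨O₁, O₂, m₁, m₂, m, o₁, o₂, hO⟩ := h.exists_ears hG
    rw [hW] at hn hS
    simp only [List.mem_append] at hS
    refine false_of_crossing hG h.flip (O₁ := O₁) (O₂ := O₂) α μ ω w R R' γ ν β ?_
      (fun e he => hS e (by simp [he])) (fun e he => hS e (by simp [he]))
      (fun e he => hS e (by simp [he])) (fun e he => hS e (by simp [he]))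
      (fun e he => hS e (by simp [he])) (fun e he => hS e (by simp [he]))
      (fun e he => hS e (by simp [he])) (fun e he => hS e (by simp [he]))
      (fun e he => hS e (by simp [he])) o₁ o₂ (h.side_eq hG) (h.exchange.side_eq hG)
    obtain ⟨q₁, q₂⟩ := hO ((α.edges ++ (μ.edges ++ ω.edges)) ++ (w.edges ++ (R.edges ++ (R'.edges ++
      (γ.edges ++ (ν.edges ++ β.edges))))))
      (fun e he => hS e (by simp only [List.mem_append] at he ⊢; tauto))
    have := List.nodup_append'.2 ⟨hn, List.nodup_append'.2 ⟨m₁, m₂, m⟩,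
      List.disjoint_append_right.2 ⟨q₁, q₂⟩⟩
    simpa only [List.append_assoc] using this
  · rw [hW] at hn hS
    simp only [List.mem_append] at hS
    simp only [List.nodup_append', List.disjoint_append_left, List.disjoint_append_right] at hn
    casesm* _ ∧ _
    refine h.false_of_walks hG (α.append (R'.append β)) (ω.reverse.append (R.append γ.reverse))
      (fun e he => hS e ?_) (fun e he => hS e ?_) ?_
    · simp only [Walk.edges_append, List.mem_append] at he
      tauto
    · simp only [Walk.edges_append, Walk.edges_reverse, List.mem_append, List.mem_reverse] at he
      tauto
    · simp only [Walk.edges_append, Walk.edges_reverse, List.disjoint_append_left,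
        List.disjoint_append_right, List.disjoint_reverse_left, List.disjoint_reverse_right]
      constructorm* _ ∧ _ <;> first | assumption | exact List.Disjoint.symm (by assumption)

/-- Two links from different walks between `a₁` and `a₂` to the walk between `b₂` and `b₁` join the
pairs disjointly. -/
theorem false_of_links_diff (h : Bridgeless G side S a₁ b₁ a₂ b₂ a₃ b₃) (hG : Host G)
    {t t' r r' : V} {W w : G.Walk a₁ a₂} {R : G.Walk t r} {R' : G.Walk t' r'} {γ : G.Walk b₂ r}
    {ν : G.Walk r r'} {β : G.Walk r' b₁}
    (hn : (W.edges ++ (w.edges ++ (R.edges ++ (R'.edges ++ (γ.edges ++ (ν.edges ++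
      β.edges)))))).Nodup)
    (hS : ∀ e ∈ W.edges ++ (w.edges ++ (R.edges ++ (R'.edges ++ (γ.edges ++ (ν.edges ++
      β.edges))))), e ∈ S) (ht : t ∈ W.support) (ht' : t' ∈ w.support) : False := by
  simp only [List.mem_append] at hS
  have i₁ := Walk.edges_dropUntil_subset_edges W ht
  have i₂ := Walk.edges_takeUntil_subset_edges w ht'
  simp only [List.nodup_append', List.disjoint_append_left, List.disjoint_append_right] at hn
  casesm* _ ∧ _
  refine h.false_of_walks hG ((w.takeUntil t' ht').append (R'.append β))
    ((W.dropUntil t ht).reverse.append (R.append γ.reverse)) (fun e he => hS e ?_)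
    (fun e he => hS e ?_) ?_
  · simp only [Walk.edges_append, List.mem_append] at he
    have := @i₂ e
    tauto
  · simp only [Walk.edges_append, Walk.edges_reverse, List.mem_append, List.mem_reverse] at he
    have := @i₁ e
    tauto
  · have hd : (w.edges ++ (R'.edges ++ β.edges)).Disjoint (W.edges ++ (R.edges ++ γ.edges)) := by
      simp only [List.disjoint_append_left, List.disjoint_append_right]
      constructorm* _ ∧ _ <;> first | assumption | exact List.Disjoint.symm (by assumption)
    intro e he he'
    simp only [Walk.edges_append, Walk.edges_reverse, List.mem_append, List.mem_reverse] at he he'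
    refine hd (a := e) ?_ ?_
    · simp only [List.mem_append]
      exact he.imp_left fun he => i₂ he
    · simp only [List.mem_append]
      exact he'.imp_left fun he => i₁ he

theorem false_of_links (h : Bridgeless G side S a₁ b₁ a₂ b₂ a₃ b₃) (hG : Host G)
    {t t' r r' : V} {W w : G.Walk a₁ a₂} {R : G.Walk t r} {R' : G.Walk t' r'} {γ : G.Walk b₂ r}
    {ν : G.Walk r r'} {β : G.Walk r' b₁}
    (hn : (W.edges ++ (w.edges ++ (R.edges ++ (R'.edges ++ (γ.edges ++ (ν.edges ++
      β.edges)))))).Nodup)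
    (hS : ∀ e ∈ W.edges ++ (w.edges ++ (R.edges ++ (R'.edges ++ (γ.edges ++ (ν.edges ++
      β.edges))))), e ∈ S)
    (ht : t ∈ W.support ∨ t ∈ w.support) (ht' : t' ∈ W.support ∨ t' ∈ w.support) :
    False := by
  have hn' : (w.edges ++ (W.edges ++ (R.edges ++ (R'.edges ++ (γ.edges ++ (ν.edges ++
      β.edges)))))).Nodup := by
    rw [← List.append_assoc] at hn ⊢
    exact ((List.perm_append_comm.append_right _).nodup_iff).1 hn
  have hS' : ∀ e ∈ w.edges ++ (W.edges ++ (R.edges ++ (R'.edges ++ (γ.edges ++ (ν.edges ++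
      β.edges))))), e ∈ S := fun e he => hS e (by simp only [List.mem_append] at he ⊢; tauto)
  rcases ht with ht | ht <;> rcases ht' with ht' | ht'
  · exact h.false_of_links_same hG hn hS ht ht'
  · exact h.false_of_links_diff hG hn hS ht ht'
  · exact h.false_of_links_diff hG hn' hS' ht ht'
  · exact h.false_of_links_same hG hn' hS' ht ht'

/-- Two walks from `a₁` to `a₂` and one from `b₂` to `b₁`: as every set separating the former from
the latter separates both pairs, there are two links between them, by Menger's theorem. -/
theorem false_of_parallel (h : Bridgeless G side S a₁ b₁ a₂ b₂ a₃ b₃) (hG : Host G)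
    {W₁ W₂ : G.Walk a₁ a₂} {W₃ : G.Walk b₂ b₁}
    (n₁ : W₁.edges.Nodup) (n₂ : W₂.edges.Nodup) (n₃ : W₃.edges.Nodup)
    (s₁ : ∀ e ∈ W₁.edges, e ∈ S) (s₂ : ∀ e ∈ W₂.edges, e ∈ S) (s₃ : ∀ e ∈ W₃.edges, e ∈ S)
    (d₁₂ : W₁.edges.Disjoint W₂.edges) (d₁₃ : W₁.edges.Disjoint W₃.edges)
    (d₂₃ : W₂.edges.Disjoint W₃.edges) : False := by
  set S' := S \ (W₁.edges ++ (W₂.edges ++ W₃.edges)).toFinset with hS'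
  have hmem : ∀ e, e ∈ S' ↔ e ∈ S ∧ e ∉ W₁.edges ∧ e ∉ W₂.edges ∧ e ∉ W₃.edges := fun e => by
    simp [hS']
  have hl : Linked G 2 S' (W₁.support ++ W₂.support).toFinset W₃.support.toFinset := by
    refine linked_of_le_cut (fun x y hxy => h.adj x y ((hmem _).1 hxy).1) ?_ fun X hA hB => ?_
    · rw [Finset.disjoint_left]
      intro z hz hz'
      rw [List.mem_toFinset] at hz hz'
      rcases List.mem_append.1 hz with hz | hz
      · exact h.disjoint_support hG n₁ n₃ s₁ s₃ d₁₃ hz hz'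
      · exact h.disjoint_support hG n₂ n₃ s₂ s₃ d₂₃ hz hz'
    · have hX₁ : ∀ z ∈ W₁.support, z ∈ X := fun z hz => hA (by simp [hz])
      have hX₂ : ∀ z ∈ W₂.support, z ∈ X := fun z hz => hA (by simp [hz])
      have hX₃ : ∀ z ∈ W₃.support, z ∉ X := fun z hz =>
        Finset.disjoint_right.1 hB (by simp [hz])
      have h1 := h.cuts X
      rw [sepNum_eq_one (a := a₁) (b := b₁)
          (by simp [hX₁ _ W₁.start_mem_support, hX₃ _ W₃.end_mem_support]),
        sepNum_eq_one (a := a₂) (b := b₂)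
          (by simp [hX₁ _ W₁.end_mem_support, hX₃ _ W₃.start_mem_support])] at h1
      have h2 : cut S X ≤ cut S' X := by
        refine Finset.card_le_card ?_
        rintro ⟨x, y⟩ hxy
        simp only [Finset.mem_filter, Finset.mem_univ, true_and] at hxy ⊢
        obtain ⟨hx, hy, hxy⟩ := hxy
        refine ⟨hx, hy, (hmem _).2 ⟨hxy, fun h' => hy ?_, fun h' => hy ?_, fun h' => ?_⟩⟩
        · exact hX₁ _ (W₁.snd_mem_support_of_mem_edges h')
        · exact hX₂ _ (W₂.snd_mem_support_of_mem_edges h')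
        · exact hX₃ _ (W₃.fst_mem_support_of_mem_edges h') hx
      omega
  obtain ⟨t, ht, r, hr, R, hR, hRS, t', ht', r', hr', R', hR', hRS', -⟩ := hl
  rw [List.mem_toFinset] at ht ht' hr hr'
  rw [List.mem_append] at ht ht'
  have f : ∀ e ∈ R.edges, e ∈ S ∧ e ∉ W₁.edges ∧ e ∉ W₂.edges ∧ e ∉ W₃.edges :=
    fun e he => (hmem e).1 (hRS e he)
  have f' : ∀ e ∈ R'.edges, (e ∈ S ∧ e ∉ W₁.edges ∧ e ∉ W₂.edges ∧ e ∉ W₃.edges) ∧ e ∉ R.edges :=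
    fun e he => by
      have := Finset.mem_sdiff.1 (hRS' e he)
      exact ⟨(hmem e).1 this.1, by simpa using this.2⟩
  have c₁ : W₁.edges.Disjoint R.edges := fun e he he' => (f e he').2.1 he
  have c₂ : W₂.edges.Disjoint R.edges := fun e he he' => (f e he').2.2.1 he
  have c₃ : W₃.edges.Disjoint R.edges := fun e he he' => (f e he').2.2.2 he
  have c₁' : W₁.edges.Disjoint R'.edges := fun e he he' => (f' e he').1.2.1 he
  have c₂' : W₂.edges.Disjoint R'.edges := fun e he he' => (f' e he').1.2.2.1 he
  have c₃' : W₃.edges.Disjoint R'.edges := fun e he he' => (f' e he').1.2.2.2 he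
  have c : R.edges.Disjoint R'.edges := fun e he he' => (f' e he').2 he
  have nR := hR.isTrail.edges_nodup
  have nR' := hR'.isTrail.edges_nodup
  rcases exists_split W₃ hr hr' with ⟨γ, ν, β, hW⟩ | ⟨γ, ν, β, hW⟩
  · rw [hW] at n₃ s₃ d₁₃ d₂₃ c₃ c₃'
    refine h.false_of_links hG (W := W₁) (w := W₂) (R := R) (R' := R') (γ := γ) (ν := ν) (β := β)
      ?_ (fun e he => ?_) ht ht'
    · simp only [List.nodup_append', List.disjoint_append_left, List.disjoint_append_right] at *
      casesm* _ ∧ _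
      constructorm* _ ∧ _ <;> first | assumption | exact List.Disjoint.symm (by assumption)
    · rcases List.mem_append.1 he with he | he
      · exact s₁ e he
      rcases List.mem_append.1 he with he | he
      · exact s₂ e he
      rcases List.mem_append.1 he with he | he
      · exact (f e he).1
      rcases List.mem_append.1 he with he | he
      · exact (f' e he).1.1
      · exact s₃ e he
  · rw [hW] at n₃ s₃ d₁₃ d₂₃ c₃ c₃'
    refine h.false_of_links hG (W := W₁) (w := W₂) (R := R') (R' := R) (γ := γ) (ν := ν) (β := β)
      ?_ (fun e he => ?_) ht' ht
    · simp only [List.nodup_append', List.disjoint_append_left, List.disjoint_append_right] at *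
      casesm* _ ∧ _
      constructorm* _ ∧ _ <;> first | assumption | exact List.Disjoint.symm (by assumption)
    · rcases List.mem_append.1 he with he | he
      · exact s₁ e he
      rcases List.mem_append.1 he with he | he
      · exact s₂ e he
      rcases List.mem_append.1 he with he | he
      · exact (f' e he).1.1
      rcases List.mem_append.1 he with he | he
      · exact (f e he).1
      · exact s₃ e he

end Bridgeless

end Bridgeless

end SkewedTheta

/-! ### The contradiction, and the cuts to be tested -/

namespace SkewedTheta

open SimpleGraph

section NoConfiguration

variable {V : Type*} [DecidableEq V] {G : SimpleGraph V} [Fintype V]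

namespace Bridgeless

variable {side : V → Bool} {S : Finset (Sym2 V)} {a₁ b₁ a₂ b₂ a₃ b₃ : V}

/-- Three disjoint walks along `S` and an ear would make four edges at `a₁`. -/
theorem false_of_three (h : Bridgeless G side S a₁ b₁ a₂ b₂ a₃ b₃) (hG : Host G)
    {l₁ l₂ l₃ : List (Sym2 V)} (n₁ : l₁.Nodup) (n₂ : l₂.Nodup) (n₃ : l₃.Nodup)
    (s₁ : ∀ e ∈ l₁, e ∈ S) (s₂ : ∀ e ∈ l₂, e ∈ S) (s₃ : ∀ e ∈ l₃, e ∈ S)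
    (d₁₂ : l₁.Disjoint l₂) (d₁₃ : l₁.Disjoint l₃) (d₂₃ : l₂.Disjoint l₃)
    (c₁ : 1 ≤ l₁.countP (a₁ ∈ ·)) (c₂ : 1 ≤ l₂.countP (a₁ ∈ ·)) (c₃ : 1 ≤ l₃.countP (a₁ ∈ ·)) :
    False := by
  obtain ⟨O₁, O₂, m₁, -, -, -, -, hO⟩ := h.exists_ears hG
  have hS : ∀ e ∈ S, e ∈ G.edgeSet := fun e => by
    induction e with
    | h x y => exact h.adj x y
  refine false_of_four hG.subcubic a₁ (l₁ := l₁) (l₂ := l₂) (l₃ := l₃) (l₄ := O₁.edges) ?_ ?_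
    c₁ c₂ c₃ (one_le_countP_left O₁ (h.ne_pair hG))
  · simp only [List.nodup_append', List.disjoint_append_right]
    exact ⟨n₁, ⟨n₂, ⟨n₃, m₁, (hO _ s₃).1⟩, d₂₃, (hO _ s₂).1⟩, d₁₂, d₁₃, (hO _ s₁).1⟩
  · intro e he
    simp only [List.mem_append] at he
    rcases he with he | he | he | he
    · exact hS e (s₁ e he)
    · exact hS e (s₂ e he)
    · exact hS e (s₃ e he)
    · exact Walk.edges_subset_edgeSet _ he

/-- The two pairs are separated by a set that is left by at most two edges in `S`: otherwise there
are three edge-disjoint walks from `{a₁, b₂}` to `{a₂, b₁}`, and every distribution of their ends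
leads to a contradiction. -/
theorem exists_cut (h : Bridgeless G side S a₁ b₁ a₂ b₂ a₃ b₃) (hG : Host G) :
    ∃ Y : Finset V, a₁ ∈ Y ∧ b₂ ∈ Y ∧ a₂ ∉ Y ∧ b₁ ∉ Y ∧ cut S Y ≤ 2 := by
  by_contra! hcon
  have k₁ := h.ne_left hG
  have k₂ := h.ne_pair hG
  have k₃ := h.exchange.ne_pair hG
  have k₄ := h.flip₁.flip₂.ne_left hG
  have hdis : Disjoint ({a₁, b₂} : Finset V) {a₂, b₁} := by
    simp only [Finset.disjoint_left, Finset.mem_insert, Finset.mem_singleton]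
    grind
  have hl : Linked G 3 S {a₁, b₂} {a₂, b₁} := by
    refine linked_of_le_cut h.adj hdis fun X hA hB => ?_
    exact hcon X (hA (by simp)) (hA (by simp)) (Finset.disjoint_right.1 hB (by simp))
      (Finset.disjoint_right.1 hB (by simp))
  obtain ⟨x₁, hx₁, y₁, hy₁, P₁, hP₁, s₁, x₂, hx₂, y₂, hy₂, P₂, hP₂, s₂, x₃, hx₃, y₃, hy₃, P₃, hP₃,
    s₃, -⟩ := hl
  have hne : ∀ {x y : V}, x ∈ ({a₁, b₂} : Finset V) → y ∈ ({a₂, b₁} : Finset V) → x ≠ y :=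
    fun hx hy hxy => Finset.disjoint_left.1 hdis hx (hxy ▸ hy)
  have n₁ := hP₁.isTrail.edges_nodup
  have n₂ := hP₂.isTrail.edges_nodup
  have n₃ := hP₃.isTrail.edges_nodup
  simp only [Finset.mem_sdiff, List.mem_toFinset] at s₂ s₃
  have d₁₂ : P₁.edges.Disjoint P₂.edges := fun e he he' => (s₂ e he').2 he
  have d₁₃ : P₁.edges.Disjoint P₃.edges := fun e he he' => (s₃ e he').1.2 he
  have d₂₃ : P₂.edges.Disjoint P₃.edges := fun e he he' => (s₃ e he').2 he
  replace s₂ := fun e he => (s₂ e he).1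
  replace s₃ := fun e he => (s₃ e he).1.1
  have c₁ := one_le_countP_left P₁ (hne hx₁ hy₁)
  have c₂ := one_le_countP_left P₂ (hne hx₂ hy₂)
  have c₃ := one_le_countP_left P₃ (hne hx₃ hy₃)
  have c₁' := one_le_countP_right P₁ (hne hx₁ hy₁)
  have c₂' := one_le_countP_right P₂ (hne hx₂ hy₂)
  have c₃' := one_le_countP_right P₃ (hne hx₃ hy₃)
  -- a walk from `a₁` to `b₁` and a disjoint one from `b₂` to `a₂`
  have walks : ∀ (P : G.Walk a₁ b₁) (Q : G.Walk b₂ a₂), (∀ e ∈ P.edges, e ∈ S) →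
      (∀ e ∈ Q.edges, e ∈ S) → P.edges.Disjoint Q.edges → False := fun P Q hP hQ hd =>
    h.toConfig.false_of_walks hG P Q.reverse hP (by simpa using hQ) (by simpa using hd)
  -- the same configuration read from `b₂`
  have h' := h.exchange.flip₁.flip₂
  simp only [Finset.mem_insert, Finset.mem_singleton] at hx₁ hx₂ hx₃ hy₁ hy₂ hy₃
  clear hne hdis hcon k₁ k₂ k₃ k₄ hP₁ hP₂ hP₃
  rcases hx₁ with rfl | rfl <;> rcases hx₂ with rfl | rfl <;> rcases hx₃ with rfl | rfl <;>
    rcases hy₁ with rfl | rfl <;> rcases hy₂ with rfl | rfl <;> rcases hy₃ with rfl | rfl <;>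
    first
    | exact h.false_of_three hG n₁ n₂ n₃ s₁ s₂ s₃ d₁₂ d₁₃ d₂₃ c₁ c₂ c₃
    | exact h'.false_of_three hG n₁ n₂ n₃ s₁ s₂ s₃ d₁₂ d₁₃ d₂₃ c₁ c₂ c₃
    | exact h.exchange.false_of_three hG n₁ n₂ n₃ s₁ s₂ s₃ d₁₂ d₁₃ d₂₃ c₁' c₂' c₃'
    | exact h.flip₁.false_of_three hG n₁ n₂ n₃ s₁ s₂ s₃ d₁₂ d₁₃ d₂₃ c₁' c₂' c₃'
    | exact walks P₁ P₂ s₁ s₂ d₁₂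
    | exact walks P₁ P₃ s₁ s₃ d₁₃
    | exact walks P₂ P₁ s₂ s₁ d₁₂.symm
    | exact walks P₂ P₃ s₂ s₃ d₂₃
    | exact walks P₃ P₁ s₃ s₁ d₁₃.symm
    | exact walks P₃ P₂ s₃ s₂ d₂₃.symm
    | exact h.false_of_fork hG n₁ n₂ n₃ s₁ s₂ s₃ d₁₂ d₁₃ d₂₃
    | exact h.false_of_fork hG n₁ n₃ n₂ s₁ s₃ s₂ d₁₃ d₁₂ d₂₃.symm
    | exact h.false_of_fork hG n₂ n₁ n₃ s₂ s₁ s₃ d₁₂.symm d₂₃ d₁₃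
    | exact h.false_of_fork hG n₂ n₃ n₁ s₂ s₃ s₁ d₂₃ d₁₂.symm d₁₃.symm
    | exact h.false_of_fork hG n₃ n₁ n₂ s₃ s₁ s₂ d₁₃.symm d₂₃.symm d₁₂
    | exact h.false_of_fork hG n₃ n₂ n₁ s₃ s₂ s₁ d₂₃.symm d₁₃.symm d₁₂.symm
    | exact h'.false_of_fork hG n₁ n₂ n₃ s₁ s₂ s₃ d₁₂ d₁₃ d₂₃
    | exact h'.false_of_fork hG n₁ n₃ n₂ s₁ s₃ s₂ d₁₃ d₁₂ d₂₃.symm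
    | exact h'.false_of_fork hG n₂ n₁ n₃ s₂ s₁ s₃ d₁₂.symm d₂₃ d₁₃
    | exact h'.false_of_fork hG n₂ n₃ n₁ s₂ s₃ s₁ d₂₃ d₁₂.symm d₁₃.symm
    | exact h'.false_of_fork hG n₃ n₁ n₂ s₃ s₁ s₂ d₁₃.symm d₂₃.symm d₁₂
    | exact h'.false_of_fork hG n₃ n₂ n₁ s₃ s₂ s₁ d₂₃.symm d₁₃.symm d₁₂.symm
    | exact h.false_of_parallel hG n₁ n₂ n₃ s₁ s₂ s₃ d₁₂ d₁₃ d₂₃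
    | exact h.false_of_parallel hG n₁ n₃ n₂ s₁ s₃ s₂ d₁₃ d₁₂ d₂₃.symm
    | exact h.false_of_parallel hG n₂ n₃ n₁ s₂ s₃ s₁ d₂₃ d₁₂.symm d₁₃.symm
    | exact h'.false_of_parallel hG n₁ n₂ n₃ s₁ s₂ s₃ d₁₂ d₁₃ d₂₃
    | exact h'.false_of_parallel hG n₁ n₃ n₂ s₁ s₃ s₂ d₁₃ d₁₂ d₂₃.symm
    | exact h'.false_of_parallel hG n₂ n₃ n₁ s₂ s₃ s₁ d₂₃ d₁₂.symm d₁₃.symm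

/-- The third pair cannot lie in the corner `X ∩ Y`: there it would be joined apart from the second
pair. -/
theorem false_of_corner (h : Bridgeless G side S a₁ b₁ a₂ b₂ a₃ b₃) (hG : Host G) {X Y : Finset V}
    (haX₁ : a₁ ∈ X) (hbX₁ : b₁ ∉ X) (hbX₂ : b₂ ∉ X)
    (hbY₁ : b₁ ∉ Y) (haY₂ : a₂ ∉ Y) (hX : cut S X ≤ 2) (hY : cut S Y ≤ 2)
    (ha₃ : a₃ ∈ X ∩ Y) (hb₃ : b₃ ∈ X ∩ Y) : False := by
  have h1 := cut_inter_add_cut_union S X Y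
  have h2 := h.two_le (X ∪ Y) a₁ (by simp) b₁ (by simp) (by simp [haX₁]) (by simp [hbX₁, hbY₁])
  refine h.rotate.false_of_disjoint hG (inside_subset S (X ∩ Y)ᶜ) (inside_subset S (X ∩ Y))
    (disjoint_inside S (X ∩ Y)).symm
    (conn_inside (m := 2) h.adj (by simp [haY₂]) (by simp [hbX₂]) (by rw [cut_compl]; omega) ?_ ?_)
    (conn_inside (m := 2) h.adj ha₃ hb₃ (by omega) ?_ ?_)
  · exact fun U hp hq => h.two_le U a₂ (by simp) b₂ (by simp) hp hq
  · exact fun U hp hq => h.two_le U b₂ (by simp) a₂ (by simp) hp hq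
  · exact fun U hp hq => h.two_le U a₃ (by simp) b₃ (by simp) hp hq
  · exact fun U hp hq => h.two_le U b₃ (by simp) a₃ (by simp) hp hq

theorem false (h : Bridgeless G side S a₁ b₁ a₂ b₂ a₃ b₃) (hG : Host G) : False := by
  obtain ⟨Y, y₁, y₂, y₃, y₄, hY⟩ := h.exists_cut hG
  obtain ⟨X, x₁, x₂, x₃, x₄, hX⟩ := h.flip₂.exists_cut hG
  have hX₃ : a₃ ∈ X ↔ b₃ ∈ X := by
    by_contra hc
    have := h.cuts X
    rw [sepNum_eq_one hc, sepNum_eq_one (a := a₁) (b := b₁) (by simp [x₁, x₄]),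
      sepNum_eq_one (a := a₂) (b := b₂) (by simp [x₂, x₃])] at this
    omega
  have hY₃ : a₃ ∈ Y ↔ b₃ ∈ Y := by
    by_contra hc
    have := h.cuts Y
    rw [sepNum_eq_one hc, sepNum_eq_one (a := a₁) (b := b₁) (by simp [y₁, y₄]),
      sepNum_eq_one (a := a₂) (b := b₂) (by simp [y₂, y₃])] at this
    omega
  have hX' : cut S Xᶜ ≤ 2 := by rwa [cut_compl]
  have hY' : cut S Yᶜ ≤ 2 := by rwa [cut_compl]
  by_cases hx : a₃ ∈ X <;> by_cases hy : a₃ ∈ Y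
  · exact h.false_of_corner hG x₁ x₄ x₃ y₄ y₃ hX hY (by simp [hx, hy])
      (by simp [← hX₃, ← hY₃, hx, hy])
  · exact h.exchange.false_of_corner hG (X := X) (Y := Yᶜ) x₂ x₃ x₄ (by simpa)
      (by simpa) hX hY' (by simp [hx, hy]) (by simp [← hX₃, ← hY₃, hx, hy])
  · exact h.exchange.flip₁.flip₂.false_of_corner hG (X := Xᶜ) (Y := Y) (by simpa)
      (by simpa) (by simpa) (by simpa) (by simpa) hX' hY (by simp [hx, hy])
      (by simp [← hX₃, ← hY₃, hx, hy])
  · exact h.flip₁.flip₂.false_of_corner hG (X := Xᶜ) (Y := Yᶜ) (by simpa) (by simpa)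
      (by simpa) (by simpa) (by simpa) hX' hY' (by simp [hx, hy])
      (by simp [← hX₃, ← hY₃, hx, hy])

end Bridgeless

theorem Config.false (hG : Host G) {side : V → Bool} {S : Finset (Sym2 V)} {a₁ b₁ a₂ b₂ a₃ b₃ : V}
    (h : Config G side S a₁ b₁ a₂ b₂ a₃ b₃) : False := by
  induction hn : S.card using Nat.strong_induction_on generalizing S a₁ b₁ a₂ b₂ a₃ b₃ with
  | _ n ih =>
    subst hn
    rcases h.two_le_cut_or_exists_smaller hG with h2 | ⟨S', _, _, _, _, _, _, h', hS'⟩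
    · exact Bridgeless.false ⟨h, h2⟩ hG
    · exact ih _ hS' h' rfl

theorem cut_mono {S T : Finset (Sym2 V)} (h : S ⊆ T) (X : Finset V) : cut S X ≤ cut T X :=
  Finset.card_le_card fun p hp => by
    simp only [Finset.mem_filter] at hp ⊢
    exact ⟨hp.1, hp.2.1, hp.2.2.1, h hp.2.2.2⟩

/-- A further edge is counted if it joins separated vertices. -/
theorem sepNum_add_cut_le {S : Finset (Sym2 V)} (X : Finset V) {a b : V} (h : s(a, b) ∉ S) :
    sepNum X a b + cut S X ≤ cut (insert s(a, b) S) X := by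
  wlog hab : a ∈ X generalizing a b
  · by_cases hb : b ∈ X
    · rw [sepNum_comm, Sym2.eq_swap]
      rw [Sym2.eq_swap] at h
      exact this h hb
    · rw [sepNum, if_pos (by simp [hab, hb]), zero_add]
      exact cut_mono (Finset.subset_insert _ _) X
  by_cases hb : b ∈ X
  · rw [sepNum, if_pos (by simp [hab, hb]), zero_add]
    exact cut_mono (Finset.subset_insert _ _) X
  · rw [sepNum_eq_one (by simp [hab, hb]), add_comm, Nat.add_one_le_iff]
    refine Finset.card_lt_card (Finset.ssubset_iff.2 ⟨(a, b), by simp [h], fun p hp => ?_⟩)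
    rcases Finset.mem_insert.1 hp with rfl | hp
    · simp [hab, hb]
    · simp only [Finset.mem_filter, Finset.mem_insert] at hp ⊢
      tauto

open Classical in
/-- If the even edges among the edges of `G` leave every vertex set in at least the number of the
odd ones whenever that number of even edges is at most two, then `G` contains a skewed theta. -/
theorem containsSkewedTheta_of_cut_le (hsub : Subcubic G) (hcon : TwoConnected G) {side : V → Bool}
    {x y : Fin 3 → V} (hodd : ∀ i, s(x i, y i) ∈ oddEdges G side)
    (hinj : Function.Injective fun i => s(x i, y i))
    (hcut : ∀ X : Finset V, cut (evenEdges G side).toFinset X ≤ 2 →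
      cut (oddEdges G side).toFinset X ≤ cut (evenEdges G side).toFinset X) :
    ContainsSkewedTheta G := by
  by_contra hno
  have heven : ∀ u v, s(u, v) ∈ (evenEdges G side).toFinset → G.Adj u v ∧ side u ≠ side v := by
    intro u v huv
    obtain ⟨u', v', h, h', he⟩ := Set.mem_toFinset.1 huv
    rcases Sym2.eq_iff.1 he with ⟨rfl, rfl⟩ | ⟨rfl, rfl⟩
    · exact ⟨h, h'⟩
    · exact ⟨h.symm, h'.symm⟩
  have hodd' : ∀ i, G.Adj (x i) (y i) ∧ side (x i) = side (y i) := by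
    intro i
    obtain ⟨u', v', h, h', he⟩ := hodd i
    rcases Sym2.eq_iff.1 he with ⟨h1, h2⟩ | ⟨h1, h2⟩
    · rw [h1, h2]
      exact ⟨h, h'⟩
    · rw [h1, h2]
      exact ⟨h.symm, h'.symm⟩
  have h01 : s(x 0, y 0) ≠ s(x 1, y 1) := hinj.ne (by decide)
  have h02 : s(x 0, y 0) ≠ s(x 2, y 2) := hinj.ne (by decide)
  have h12 : s(x 1, y 1) ≠ s(x 2, y 2) := hinj.ne (by decide)
  refine Config.false (G := G) ⟨hsub, hcon, hno⟩ (side := side)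
    (S := (evenEdges G side).toFinset) (a₁ := x 0) (b₁ := y 0) (a₂ := x 1) (b₂ := y 1)
    (a₃ := x 2) (b₃ := y 2) ⟨fun u v h => (heven u v h).1, fun u v h => (heven u v h).2,
      ⟨(hodd' 0).1.toWalk, (hodd' 1).1.toWalk, (hodd' 2).1.toWalk, ?_, fun e he => ?_, ?_, ?_, ?_⟩,
      fun X => ?_⟩
  · simp [h01, h02, h12]
  · have hne : ∀ i, e ≠ s(x i, y i) := by
      rintro i rfl
      exact (heven _ _ he).2 (hodd' i).2
    simp [hne]
  · simp [(hodd' 0).2]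
  · simp [(hodd' 1).2]
  · simp [(hodd' 2).2]
  · have b : ∀ a b : V, sepNum X a b ≤ 1 := fun a b => by
      unfold sepNum
      split_ifs <;> omega
    by_cases hX : cut (evenEdges G side).toFinset X ≤ 2
    · refine le_trans ?_ (hcut X hX)
      have c₁ := sepNum_add_cut_le X (S := ∅) (a := x 2) (b := y 2) (by simp)
      have c₂ := sepNum_add_cut_le X (S := insert s(x 2, y 2) ∅) (a := x 1) (b := y 1)
        (by simpa using h12)
      have c₃ := sepNum_add_cut_le X (S := insert s(x 1, y 1) (insert s(x 2, y 2) ∅)) (a := x 0)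
        (b := y 0) (by
          simp only [Finset.mem_insert, Finset.notMem_empty, or_false, not_or]
          exact ⟨h01, h02⟩)
      have c₄ : cut (insert s(x 0, y 0) (insert s(x 1, y 1) (insert s(x 2, y 2) ∅))) X ≤
          cut (oddEdges G side).toFinset X := by
        refine cut_mono (fun e he => Set.mem_toFinset.2 ?_) X
        simp only [Finset.mem_insert, Finset.notMem_empty, or_false] at he
        rcases he with rfl | rfl | rfl
        · exact hodd 0
        · exact hodd 1
        · exact hodd 2
      omega
    · have := b (x 0) (y 0)
      have := b (x 1) (y 1)
      have := b (x 2) (y 2)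
      omega

/-- `X` is the least set that contains `u₁` and `u₂` and is closed under passing along edges in `S`,
except from `u₁` to `w₁` and from `u₂` to `w₂`. -/
structure IsHull (S : Finset (Sym2 V)) (u₁ w₁ u₂ w₂ : V) (X : Finset V) : Prop where
  left : u₁ ∈ X
  right : u₂ ∈ X
  closed : ∀ x ∈ X, ∀ y, s(x, y) ∈ S → ¬ (x = u₁ ∧ y = w₁) → ¬ (x = u₂ ∧ y = w₂) → y ∈ X
  least : ∀ Z : Finset V, u₁ ∈ Z → u₂ ∈ Z → (∀ x ∈ Z, ∀ y, s(x, y) ∈ S → ¬ (x = u₁ ∧ y = w₁) →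
    ¬ (x = u₂ ∧ y = w₂) → y ∈ Z) → X ⊆ Z

/-- When a set violates the cut condition and is left by at most two edges in `S`, then so does one
of the hulls. -/
theorem cut_le_of_hull (hG : G.Connected) {S T : Finset (Sym2 V)}
    (hST : ∀ u v, G.Adj u v → s(u, v) ∈ S ∨ s(u, v) ∈ T) (hloop : ∀ u, s(u, u) ∉ S)
    (h : ∀ u₁ w₁ u₂ w₂, ∃ X, IsHull S u₁ w₁ u₂ w₂ X ∧ cut T X ≤ cut S X) (X : Finset V)
    (hX : cut S X ≤ 2) : cut T X ≤ cut S X := by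
  have hzero : ∀ {Z : Finset V}, cut S Z = 0 → ∀ x ∈ Z, ∀ y, s(x, y) ∈ S → y ∈ Z := by
    intro Z hZ x hx y hxy
    by_contra hy
    exact Finset.filter_eq_empty_iff.1 (Finset.card_eq_zero.1 hZ) (Finset.mem_univ (x, y))
      ⟨hx, hy, hxy⟩
  -- Otherwise a hull inside `Z` is left by no edge in `S`, hence by no edge at all.
  have hconn : ∀ Z : Finset V, Z.Nonempty → Z ≠ Finset.univ → cut S Z ≠ 0 := by
    rintro Z ⟨z, hz⟩ hne hZ
    obtain ⟨Y, hY, hTY⟩ := h z z z z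
    have hYZ : Y ⊆ Z := hY.least Z hz hz fun x hx y hxy _ _ => hzero hZ x hx y hxy
    have hSY : cut S Y = 0 := by
      refine Finset.card_eq_zero.2 (Finset.filter_eq_empty_iff.2 ?_)
      rintro ⟨x, y⟩ - ⟨hx, hy, hxy⟩
      have : ¬ (x = z ∧ y = z) := by
        rintro ⟨rfl, rfl⟩
        exact hloop _ hxy
      exact hy (hY.closed x hx y hxy this this)
    obtain ⟨y, hy⟩ : ∃ y, y ∉ Z := by
      by_contra! hc
      exact hne (Finset.eq_univ_iff_forall.2 hc)
    obtain ⟨p⟩ := hG.preconnected z y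
    obtain ⟨d, -, hd, hd'⟩ := p.exists_boundary_dart Y hY.left fun hc => hy (hYZ hc)
    have hTY' : cut T Y ≠ 0 := by
      refine (Finset.card_pos.2
        ⟨d.toProd, Finset.mem_filter.2 ⟨Finset.mem_univ _, hd, hd', ?_⟩⟩).ne'
      rcases hST _ _ d.adj with hS | hT
      · exact absurd (hzero hSY _ hd _ hS) hd'
      · exact hT
    omega
  rcases X.eq_empty_or_nonempty with rfl | hne
  · simp [cut]
  by_cases huniv : X = Finset.univ
  · subst huniv
    simp [cut_univ]
  have hpos := hconn X hne huniv
  obtain ⟨u₁, w₁, u₂, w₂, hu₁, hw₁, hu₂, hw₂, huw⟩ : ∃ u₁ w₁ u₂ w₂, u₁ ∈ X ∧ w₁ ∉ X ∧ u₂ ∈ X ∧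
      w₂ ∉ X ∧ ∀ x ∈ X, ∀ y ∉ X, s(x, y) ∈ S → x = u₁ ∧ y = w₁ ∨ x = u₂ ∧ y = w₂ := by
    have key : ∃ p q : V × V, Finset.univ.filter
        (fun p : V × V => p.1 ∈ X ∧ p.2 ∉ X ∧ s(p.1, p.2) ∈ S) = {p, q} := by
      have h12 : cut S X = 1 ∨ cut S X = 2 := by omega
      rcases h12 with h1 | h2
      · obtain ⟨p, hp⟩ := Finset.card_eq_one.1 h1
        exact ⟨p, p, by rw [hp]; simp⟩
      · obtain ⟨p, q, -, hpq⟩ := Finset.card_eq_two.1 h2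
        exact ⟨p, q, hpq⟩
    obtain ⟨⟨u₁, w₁⟩, ⟨u₂, w₂⟩, key⟩ := key
    have hk : ∀ x y, (x ∈ X ∧ y ∉ X ∧ s(x, y) ∈ S) ↔ (x = u₁ ∧ y = w₁ ∨ x = u₂ ∧ y = w₂) :=
      fun x y => by simpa using Finset.ext_iff.1 key (x, y)
    have h1 := (hk u₁ w₁).2 (by simp)
    have h2 := (hk u₂ w₂).2 (by simp)
    exact ⟨u₁, w₁, u₂, w₂, h1.1, h1.2.1, h2.1, h2.2.1,
      fun x hx y hy hxy => (hk x y).1 ⟨hx, hy, hxy⟩⟩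
  obtain ⟨Y, hY, hTY⟩ := h u₁ w₁ u₂ w₂
  have hYX : Y ⊆ X := hY.least X hu₁ hu₂ fun x hx y hxy h1 h2 => by
    by_contra hy
    rcases huw x hx y hy hxy with h3 | h3
    · exact h1 h3
    · exact h2 h3
  -- no edge in `S` leaves `X \ Y`
  have hXY : X = Y := by
    by_contra hc
    refine hconn (X \ Y) ?_ ?_ ?_
    · rw [Finset.sdiff_nonempty]
      exact fun h' => hc (h'.antisymm hYX)
    · intro h'
      have : u₁ ∈ X \ Y := h' ▸ Finset.mem_univ u₁
      exact (Finset.mem_sdiff.1 this).2 hY.left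
    · refine Finset.card_eq_zero.2 (Finset.filter_eq_empty_iff.2 ?_)
      rintro ⟨x, y⟩ - ⟨hx, hy, hxy⟩
      simp only [Finset.mem_sdiff, not_and, not_not] at hx hy hxy
      by_cases hyX : y ∈ X
      · refine hx.2 (hY.closed y (hy hyX) x (by rwa [Sym2.eq_swap]) ?_ ?_)
        · rintro ⟨-, rfl⟩
          exact hw₁ hx.1
        · rintro ⟨-, rfl⟩
          exact hw₂ hx.1
      · rcases huw x hx.1 y hyX hxy with ⟨rfl, -⟩ | ⟨rfl, -⟩
        · exact hx.2 hY.left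
        · exact hx.2 hY.right
  rw [hXY]
  exact hTY

end NoConfiguration

end SkewedTheta

/-! ### Programs and their running times -/

namespace Ram

open Polynomial

/-- A bound for the running time of a program none of whose loops is run through more than `X`
times. -/
noncomputable def Program.timeBound : Program → ℕ[X]
  | .skip => 1
  | .write _ i x => C (i.cost + x.cost + 1)
  | .seq c d => c.timeBound + d.timeBound + 1
  | .ite b c d => C b.cost + c.timeBound + d.timeBound + 1
  | .while b c => (X + 1) * (C b.cost + c.timeBound + 1)

/-- Started in `s`, the program `c` halts within the time bound for loops of length `ℓ`, in a store
that satisfies `Q`. -/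
def Runs (ℓ : ℕ) (c : Program) (s : Store) (Q : Store → Prop) : Prop :=
  ∃ t s', Exec c s t s' ∧ t ≤ c.timeBound.eval ℓ ∧ Q s'

namespace Runs

variable {ℓ : ℕ} {c d : Program} {s : Store} {P Q : Store → Prop}

theorem mono (h : Runs ℓ c s P) (hPQ : ∀ s, P s → Q s) : Runs ℓ c s Q := by
  obtain ⟨t, s', hc, ht, hs'⟩ := h
  exact ⟨t, s', hc, ht, hPQ s' hs'⟩

theorem skip (h : Q s) : Runs ℓ .skip s Q :=
  ⟨1, s, .skip s, by simp [Program.timeBound], h⟩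

theorem write {a : ℕ} {i x : Expr} (h : Q (s.write a (i.eval s) (x.eval s))) :
    Runs ℓ (.write a i x) s Q :=
  ⟨_, _, .write a i x s, by simp [Program.timeBound], h⟩

theorem seq (hc : Runs ℓ c s P) (hd : ∀ s', P s' → Runs ℓ d s' Q) : Runs ℓ (.seq c d) s Q := by
  obtain ⟨t, s', hc, ht, hs'⟩ := hc
  obtain ⟨t', s'', hd, ht', hs''⟩ := hd s' hs'
  refine ⟨_, s'', .seq hc hd, ?_, hs''⟩
  simp only [Program.timeBound, eval_add, eval_one]
  omega

theorem ite {b : Expr} (hc : b.eval s ≠ 0 → Runs ℓ c s Q) (hd : b.eval s = 0 → Runs ℓ d s Q) :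
    Runs ℓ (.ite b c d) s Q := by
  by_cases hb : b.eval s = 0
  · obtain ⟨t, s', hd, ht, hs'⟩ := hd hb
    refine ⟨_, s', .ite_false hb hd, ?_, hs'⟩
    simp only [Program.timeBound, eval_add, eval_one, eval_C]
    omega
  · obtain ⟨t, s', hc, ht, hs'⟩ := hc hb
    refine ⟨_, s', .ite_true hb hc, ?_, hs'⟩
    simp only [Program.timeBound, eval_add, eval_one, eval_C]
    omega

/-- A loop with an invariant that depends on the number of iterations. -/
theorem iterate {b : Expr} {n : ℕ} (hn : n ≤ ℓ) {Inv : ℕ → Store → Prop}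
    (hstep : ∀ k < n, ∀ s, Inv k s → b.eval s ≠ 0 ∧ Runs ℓ c s (Inv (k + 1)))
    (hend : ∀ s, Inv n s → b.eval s = 0) (h0 : Inv 0 s) : Runs ℓ (.while b c) s (Inv n) := by
  have key : ∀ m k s, k + m = n → Inv k s → ∃ t s', Exec (.while b c) s t s' ∧
      t ≤ (m + 1) * (b.cost + c.timeBound.eval ℓ + 1) ∧ Inv n s' := by
    intro m
    induction m with
    | zero =>
      intro k s hk hs
      obtain rfl : k = n := hk
      exact ⟨_, s, .while_false (hend s hs), by omega, hs⟩
    | succ m ih =>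
      intro k s hk hs
      obtain ⟨hb, t, s', hc, ht, hs'⟩ := hstep k (by omega) s hs
      obtain ⟨t', s'', hw, ht', hs''⟩ := ih (k + 1) s' (by omega) hs'
      refine ⟨_, s'', .while_true hb hc hw, ?_, hs''⟩
      rw [add_mul (m + 1) 1, one_mul]
      omega
  obtain ⟨t, s', hw, ht, hs'⟩ := key n 0 s (zero_add n) h0
  refine ⟨t, s', hw, ht.trans ?_, hs'⟩
  simp only [Program.timeBound, eval_add, eval_one, eval_C, eval_mul, eval_X]
  gcongr

end Runs

/-- The content of entry `0` of an array, which serves as a scalar variable. -/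
def Expr.var (a : ℕ) : Expr := .read a (.const 0)

@[simp]
theorem Expr.eval_var (s : Store) (a : ℕ) : (Expr.var a).eval s = s a 0 := rfl

/-- The loop in which the variable `a` runs from `0` to `n - 1`, where `n` is the first letter of
the input. -/
def Program.forLoop (a : ℕ) (c : Program) : Program :=
  .seq (.write a (.const 0) (.const 0))
    (.while (.lt (.var a) (.var 0)) (.seq c (.write a (.const 0) (.add (.var a) (.const 1)))))

theorem Store.write_apply (s : Store) (a i x b j : ℕ) :
    s.write a i x b j = if b = a ∧ j = i then x else s b j := rfl

namespace Runs

variable {ℓ n a : ℕ} {c : Program} {s : Store}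

/-- The rule for loops: the invariant `Inv k` holds before the iteration with number `k`, and it
does not depend on the loop variable. -/
theorem forLoop_nat (hn : n ≤ ℓ) {Inv : ℕ → Store → Prop}
    (hwrite : ∀ k s x, Inv k s → Inv k (s.write a 0 x)) (hread : ∀ k s, Inv k s → s 0 0 = n)
    (hbody : ∀ k < n, ∀ s, Inv k s → s a 0 = k →
      Runs ℓ c s fun s' => Inv (k + 1) s' ∧ s' a 0 = k)
    (h0 : Inv 0 s) : Runs ℓ (.forLoop a c) s (Inv n) := by
  refine seq (P := fun s => Inv 0 s ∧ s a 0 = 0) (write ⟨hwrite _ _ _ h0, by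
    simp [Store.write_apply, Expr.eval]⟩) fun s hs => ?_
  refine (iterate hn (Inv := fun k s => Inv k s ∧ s a 0 = k) ?_ ?_ hs).mono fun s hs => hs.1
  · rintro k hk s ⟨hs, hsa⟩
    refine ⟨by simp [Expr.eval, hsa, hread k s hs, hk], ?_⟩
    refine seq (hbody k hk s hs hsa) fun s' hs' => write ⟨hwrite _ _ _ hs'.1, ?_⟩
    simp [Store.write_apply, Expr.eval, hs'.2]
  · rintro s ⟨hs, hsa⟩
    simp [Expr.eval, hsa, hread n s hs]

/-- The rule for loops whose iterations may come in any order: `Inv D` holds when the indices in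
`D` have been treated. -/
theorem forLoop (hn : n ≤ ℓ) {Inv : Finset (Fin n) → Store → Prop}
    (hwrite : ∀ D s x, Inv D s → Inv D (s.write a 0 x)) (hread : ∀ D s, Inv D s → s 0 0 = n)
    (hbody : ∀ (i : Fin n) D, i ∉ D → ∀ s, Inv D s → s a 0 = i →
      Runs ℓ c s fun s' => Inv (insert i D) s' ∧ s' a 0 = i)
    (h0 : Inv ∅ s) : Runs ℓ (.forLoop a c) s (Inv Finset.univ) := by
  refine (forLoop_nat hn (Inv := fun k => Inv (Finset.univ.filter fun x => x.1 < k))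
    (fun k => hwrite _) (fun k => hread _) (fun k hk s hs hsa => ?_) (by simpa using h0)).mono ?_
  · have := hbody ⟨k, hk⟩ _ (by simp) s hs hsa
    convert this using 5
    ext x
    simp only [Finset.mem_filter, Finset.mem_univ, true_and, Finset.mem_insert, Fin.ext_iff]
    omega
  · intro s hs
    simpa using hs

/-- The rule for a double loop over all pairs of indices. -/
theorem forLoop_prod {b : ℕ} (hn : n ≤ ℓ) {Inv : Finset (Fin n × Fin n) → Store → Prop}
    (ha : ∀ D s x, Inv D s → Inv D (s.write a 0 x))
    (hb : ∀ D s x, Inv D s → Inv D (s.write b 0 x)) (hab : a ≠ b)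
    (hread : ∀ D s, Inv D s → s 0 0 = n)
    (hbody : ∀ (i j : Fin n) D, (i, j) ∉ D → ∀ s, Inv D s → s a 0 = i → s b 0 = j →
      Runs ℓ c s fun s' => Inv (insert (i, j) D) s' ∧ s' a 0 = i ∧ s' b 0 = j)
    (h0 : Inv ∅ s) : Runs ℓ (.forLoop a (.forLoop b c)) s (Inv Finset.univ) := by
  refine (forLoop hn (Inv := fun D => Inv (D ×ˢ Finset.univ)) (fun D => ha _) (fun D => hread _)
    (fun i D hi s hs hsa => ?_) (by simpa using h0)).mono ?_
  · refine (forLoop hn (Inv := fun E s => Inv (D ×ˢ Finset.univ ∪ {i} ×ˢ E) s ∧ s a 0 = i)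
      (fun E s x h => ⟨hb _ _ _ h.1, by simp [Store.write_apply, hab, h.2]⟩)
      (fun E s h => hread _ s h.1) (fun j E hj s hs hsb => ?_) ⟨by simpa using hs, hsa⟩).mono ?_
    · refine (hbody i j _ (by simp [hi, hj]) s hs.1 hs.2 hsb).mono fun s' hs' =>
        ⟨⟨?_, hs'.2.1⟩, hs'.2.2⟩
      convert hs'.1 using 1
      ext ⟨x, y⟩
      simp only [Finset.mem_union, Finset.mem_product, Finset.mem_insert, Finset.mem_univ,
        Finset.mem_singleton, Prod.mk.injEq]
      tauto
    · rintro s' ⟨hs', hs'a⟩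
      refine ⟨?_, hs'a⟩
      convert hs' using 1
      ext ⟨x, y⟩
      simp only [Finset.mem_union, Finset.mem_product, Finset.mem_insert, Finset.mem_univ,
        Finset.mem_singleton]
      tauto
  · intro s hs
    simpa using hs

/-- Exhaustive search with a loop: `A` is an invariant, `F` says that the search has succeeded, and
`R i` says that it was unsuccessful at `i`. -/
theorem search (hn : n ≤ ℓ) {A F : Store → Prop} {R : Fin n → Prop}
    (hA : ∀ s x, A s → A (s.write a 0 x)) (hF : ∀ s x, F (s.write a 0 x) ↔ F s)
    (hread : ∀ s, A s → s 0 0 = n)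
    (hbody : ∀ (i : Fin n) s, A s ∧ s a 0 = i →
      Runs ℓ c s fun s' => (A s' ∧ s' a 0 = i) ∧ (F s → F s') ∧ (F s' ∨ R i))
    (h0 : A s) :
    Runs ℓ (.forLoop a c) s fun s' => A s' ∧ (F s → F s') ∧ (F s' ∨ ∀ i, R i) := by
  refine (forLoop hn (Inv := fun D s' => A s' ∧ (F s → F s') ∧ (F s' ∨ ∀ i ∈ D, R i))
    (fun D s' x h => ?_) (fun D s' h => hread s' h.1) (fun i D _ s' hs' hs'a => ?_)
    ⟨h0, id, by simp⟩).mono fun s' hs' => by simpa using hs'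
  · rw [hF]
    exact ⟨hA _ _ h.1, h.2⟩
  · refine (hbody i s' ⟨hs'.1, hs'a⟩).mono fun s'' h => ⟨⟨h.1.1, h.2.1 ∘ hs'.2.1, ?_⟩, h.1.2⟩
    rcases hs'.2.2 with h1 | h1
    · exact .inl (h.2.1 h1)
    · refine h.2.2.imp_right fun h2 j hj => ?_
      rcases Finset.mem_insert.1 hj with rfl | hj
      · exact h2
      · exact h1 j hj

end Runs

/-! ### Truth values -/

namespace Expr

/-- The negation of a truth value. -/
def not (x : Expr) : Expr := .sub (.const 1) x

/-- The conjunction of two truth values. -/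
def and (x y : Expr) : Expr := .sub (.add x y) (.const 1)

open Classical in
/-- The value of `x` in the store `s` is the truth value of `P`. -/
def Decides (s : Store) (x : Expr) (P : Prop) : Prop := x.eval s = if P then 1 else 0

variable {s : Store} {x y : Expr} {P Q : Prop}

theorem Decides.not (h : Decides s x P) : Decides s x.not (¬ P) := by
  unfold Decides Expr.not at *
  simp only [eval, h]
  split_ifs <;> simp_all

theorem Decides.and (hx : Decides s x P) (hy : Decides s y Q) : Decides s (x.and y) (P ∧ Q) := by
  unfold Decides Expr.and at *
  simp only [eval, hx, hy]
  split_ifs <;> simp_all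

theorem decides_eq (h : x.eval s = y.eval s ↔ P) : Decides s (.eq x y) P := by
  classical
  exact if_congr h rfl rfl

theorem Decides.ne_zero_iff (h : Decides s x P) : x.eval s ≠ 0 ↔ P := by
  unfold Decides at h
  rw [h]
  split_ifs <;> simp_all

theorem Decides.eq_zero_iff (h : Decides s x P) : x.eval s = 0 ↔ ¬ P := by
  rw [← h.ne_zero_iff, not_not]

end Expr

end Ram

/-! ### The input word and the answers -/

namespace SkewedTheta

open Ram Ram.Expr

section Encoding

/-- Row `i` of a matrix that is written row by row starts at position `i * m`. -/
theorem getD_flatMap {α : Type*} (f : α → List ℕ) (m : ℕ) (l : List α)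
    (hf : ∀ x ∈ l, (f x).length = m) {i j : ℕ} (hi : i < l.length) (hj : j < m) :
    (l.flatMap f).getD (i * m + j) 0 = (f l[i]).getD j 0 := by
  induction l generalizing i with
  | nil => simp at hi
  | cons x l ih =>
    have hx := hf x (by simp)
    rw [List.flatMap_cons]
    cases i with
    | zero =>
      rw [zero_mul, zero_add, List.getD_append _ _ _ _ (by omega)]
      rfl
    | succ i =>
      rw [add_mul, one_mul, List.getD_append_right _ _ _ _ (by omega), hx,
        show i * m + m + j - m = i * m + j by omega,
        ih (fun y hy => hf y (by simp [hy])) (by simpa using hi)]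
      rfl

theorem length_flatMap_eq {α : Type*} (f : α → List ℕ) (m : ℕ) (l : List α)
    (hf : ∀ x ∈ l, (f x).length = m) : (l.flatMap f).length = l.length * m := by
  induction l with
  | nil => simp
  | cons x l ih =>
    rw [List.flatMap_cons, List.length_append, hf x (by simp), ih fun y hy => hf y (by simp [hy]),
      List.length_cons]
    ring

variable (I : Input)

open Classical in
theorem Input.getD_adj (i j : Fin I.n) :
    I.encode.getD (1 + i * I.n + j) 0 = if I.graph.Adj i j then 1 else 0 := by
  have hlt : (i : ℕ) * I.n + j < I.n * I.n := by
    calc (i : ℕ) * I.n + j < i * I.n + I.n := by omega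
      _ = (i + 1) * I.n := by ring
      _ ≤ I.n * I.n := Nat.mul_le_mul_right _ i.2
  have hlen := length_flatMap_eq (fun i : Fin I.n => (List.finRange I.n).map fun j =>
    if I.graph.Adj i j then 1 else 0) I.n (List.finRange I.n) (by simp)
  rw [List.length_finRange] at hlen
  rw [Input.encode, List.append_assoc, List.getD_append _ _ _ _ (by
    rw [List.length_cons, hlen]; omega), add_assoc, add_comm 1, List.getD_cons_succ,
    getD_flatMap _ I.n _ (by simp) (by simp) j.2]
  rw [List.getD_eq_getElem _ _ (by simp)]
  simp

theorem Input.getD_side (i : Fin I.n) :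
    I.encode.getD (1 + I.n * I.n + i) 0 = if I.side i then 1 else 0 := by
  classical
  have hlen := length_flatMap_eq (fun i : Fin I.n => (List.finRange I.n).map fun j =>
    if I.graph.Adj i j then 1 else 0) I.n (List.finRange I.n) (by simp)
  rw [List.length_finRange] at hlen
  have hdec : I.encode = (I.n ::
    ((List.finRange I.n).flatMap fun i =>
      (List.finRange I.n).map fun j => if I.graph.Adj i j then 1 else 0) ++
    ((List.finRange I.n).map fun i => if I.side i then 1 else 0) ++
    ((List.finRange 3).flatMap fun i => [(I.fst i : ℕ), (I.snd i : ℕ)])) := by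
    unfold Input.encode
    congr!
  rw [hdec, List.getD_append _ _ _ _ (by
      rw [List.length_append, List.length_cons, hlen, List.length_map, List.length_finRange]
      omega),
    List.getD_append_right _ _ _ _ (by rw [List.length_cons, hlen]; omega), List.length_cons, hlen,
    show 1 + I.n * I.n + i - (I.n * I.n + 1) = i by omega, List.getD_eq_getElem _ _ (by simp)]
  simp

theorem Input.le_length : I.n ≤ I.encode.length := by
  simp only [Input.encode, List.length_append, List.length_map, List.length_finRange]
  omega

end Encoding

section Correctness

open Classical in
/-- The even edges. -/
noncomputable def Input.evens (I : Input) : Finset (Sym2 (Fin I.n)) :=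
  (evenEdges I.graph I.side).toFinset

open Classical in
/-- The odd edges. -/
noncomputable def Input.odds (I : Input) : Finset (Sym2 (Fin I.n)) :=
  (oddEdges I.graph I.side).toFinset

variable {I : Input}

theorem Input.mem_evens {u v : Fin I.n} :
    s(u, v) ∈ I.evens ↔ I.graph.Adj u v ∧ I.side u ≠ I.side v := by
  classical
  rw [Input.evens, Set.mem_toFinset]
  constructor
  · rintro ⟨u', v', h, h', he⟩
    rcases Sym2.eq_iff.1 he with ⟨rfl, rfl⟩ | ⟨rfl, rfl⟩
    · exact ⟨h, h'⟩
    · exact ⟨h.symm, h'.symm⟩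
  · exact fun h => ⟨u, v, h.1, h.2, rfl⟩

theorem Input.mem_odds {u v : Fin I.n} :
    s(u, v) ∈ I.odds ↔ I.graph.Adj u v ∧ I.side u = I.side v := by
  classical
  rw [Input.odds, Set.mem_toFinset]
  constructor
  · rintro ⟨u', v', h, h', he⟩
    rcases Sym2.eq_iff.1 he with ⟨rfl, rfl⟩ | ⟨rfl, rfl⟩
    · exact ⟨h, h'⟩
    · exact ⟨h.symm, h'.symm⟩
  · exact fun h => ⟨u, v, h.1, h.2, rfl⟩

/-- Each edge leaving `X` corresponds to exactly one ordered pair that points out of `X`. -/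
theorem ncard_edgesLeaving_inter {V : Type*} [DecidableEq V] [Fintype V] {G : SimpleGraph V}
    (X : Finset V) (S : Finset (Sym2 V)) (hS : ∀ u v, s(u, v) ∈ S → G.Adj u v) :
    (edgesLeaving G X ∩ S).ncard = cut S X := by
  have h : edgesLeaving G X ∩ S = (fun p : V × V => s(p.1, p.2)) ''
      (Finset.univ.filter fun p : V × V => p.1 ∈ X ∧ p.2 ∉ X ∧ s(p.1, p.2) ∈ S) := by
    ext e
    constructor
    · rintro ⟨⟨u, v, -, hu, hv, rfl⟩, hS⟩
      exact ⟨(u, v), by simpa using ⟨hu, hv, hS⟩, rfl⟩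
    · rintro ⟨⟨u, v⟩, h, rfl⟩
      simp only [Finset.coe_filter, Finset.mem_univ, true_and, Set.mem_ofPred_eq] at h
      exact ⟨⟨u, v, hS u v h.2.2, h.1, h.2.1, rfl⟩, h.2.2⟩
  rw [h, Set.InjOn.ncard_image, Set.ncard_coe_finset]
  · rfl
  · rintro ⟨u, v⟩ h ⟨u', v'⟩ h' heq
    simp only [Finset.coe_filter, Finset.mem_univ, true_and, Set.mem_ofPred_eq] at h h' heq
    rcases Sym2.eq_iff.1 heq with ⟨rfl, rfl⟩ | ⟨rfl, rfl⟩
    · rfl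
    · exact absurd h.1 h'.2.1

/-- The ordered pairs that point out of a set with more odd than even leaving edges form a correct
answer; such a set is not empty and neither is its complement. -/
theorem correct_of_cut_lt {X : Finset (Fin I.n)} {L : List (Fin I.n × Fin I.n)} (hL : L.Nodup)
    (hmem : ∀ p, p ∈ L ↔ p.1 ∈ X ∧ p.2 ∉ X ∧ I.graph.Adj p.1 p.2)
    (hcut : cut I.evens X < cut I.odds X) : (Answer.edges L).Correct I := by
  refine ⟨List.Nodup.map_on ?_ hL, edgesLeaving I.graph X, fun e => ?_, ⟨X, ?_, ?_, rfl⟩, ?_⟩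
  · rintro ⟨u, v⟩ h ⟨u', v'⟩ h' heq
    rw [hmem] at h h'
    rcases Sym2.eq_iff.1 heq with ⟨rfl, rfl⟩ | ⟨rfl, rfl⟩
    · rfl
    · exact absurd h.1 h'.2.1
  · rw [List.mem_map]
    constructor
    · rintro ⟨u, v, h, hu, hv, rfl⟩
      exact ⟨(u, v), (hmem _).2 ⟨hu, hv, h⟩, rfl⟩
    · rintro ⟨⟨u, v⟩, h, rfl⟩
      rw [hmem] at h
      exact ⟨u, v, h.2.2, h.1, h.2.1, rfl⟩
  · obtain ⟨p, hp⟩ := Finset.card_pos.1 ((Nat.zero_le _).trans_lt hcut)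
    exact ⟨p.1, (Finset.mem_filter.1 hp).2.1⟩
  · obtain ⟨p, hp⟩ := Finset.card_pos.1 ((Nat.zero_le _).trans_lt hcut)
    exact ⟨p.2, (Finset.mem_filter.1 hp).2.2.1⟩
  · have h1 := ncard_edgesLeaving_inter X I.evens fun u v h => (Input.mem_evens.1 h).1
    have h2 := ncard_edgesLeaving_inter X I.odds fun u v h => (Input.mem_odds.1 h).1
    rw [Input.evens, Set.coe_toFinset, ← Input.evens] at h1
    rw [Input.odds, Set.coe_toFinset, ← Input.odds] at h2
    rw [h1, h2]
    exact hcut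

/-- If no hull violates the cut condition, then the verdict is correct. -/
theorem correct_skewedTheta (hI : I.Admissible)
    (h : ∀ u₁ w₁ u₂ w₂, ∃ X, IsHull I.evens u₁ w₁ u₂ w₂ X ∧ cut I.odds X ≤ cut I.evens X) :
    Answer.skewedTheta.Correct I := by
  obtain ⟨h2, hsub, hodd, hinj⟩ := hI
  refine containsSkewedTheta_of_cut_le hsub h2 (side := I.side) (x := I.fst) (y := I.snd) hodd hinj
    fun X hX => ?_
  have := cut_le_of_hull h2.2.1 (S := I.evens) (T := I.odds) ?_ ?_ h X
  · simp only [Input.evens, Input.odds] at this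
    convert this (by convert hX)
  · intro u v huv
    rw [Input.mem_evens, Input.mem_odds]
    tauto
  · intro u hu
    exact (Input.mem_evens.1 hu).2 rfl

end Correctness

end SkewedTheta

/-! ### The algorithm and the computation of hulls -/

namespace SkewedTheta

open Ram Ram.Expr

section Algorithm

/-- The expression for the adjacency of the vertices in the variables `11` and `12`; array `2` holds
the offsets of the rows of the adjacency matrix. -/
def adjExpr : Expr := .read 0 (.add (.read 2 (.var 11)) (.var 12))

/-- The expression for the vertices in the variables `11` and `12` being in the same class; variable
`3` holds the offset of the classes. -/
def sameExpr : Expr :=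
  .eq (.read 0 (.add (.var 3) (.var 11))) (.read 0 (.add (.var 3) (.var 12)))

/-- One step of the computation of a hull, which is stored in array `9`: if the vertex in `11`
belongs to it and the edge to the vertex in `12` is even and may be used, then the latter is
added. -/
def closeStep : Program :=
  .ite (((Expr.read 9 (.var 11)).and (adjExpr.and sameExpr.not)).and
      (((Expr.eq (.var 11) (.var 4)).and (.eq (.var 12) (.var 5))).not.and
        ((Expr.eq (.var 11) (.var 6)).and (.eq (.var 12) (.var 7))).not))
    (.write 9 (.var 12) (.const 1)) .skip

/-- The computation of the hull for the vertices in the variables `4`, `5`, `6`, `7`. -/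
def hull : Program :=
  .seq (.forLoop 11 (.write 9 (.var 11) (.const 0)))
    (.seq (.write 9 (.var 4) (.const 1))
      (.seq (.write 9 (.var 6) (.const 1))
        (.forLoop 10 (.forLoop 11 (.forLoop 12 closeStep)))))

/-- One step of the inspection of the edges that leave the hull: if the vertices in `11` and `12`
form such an edge, it is appended to the output, at the position in variable `15`, and counted in
variable `13` or `14`. -/
def countStep : Program :=
  .ite (((Expr.read 9 (.var 11)).and (Expr.read 9 (.var 12)).not).and adjExpr)
    (.seq (.write 1 (.var 15) (.var 11))
      (.seq (.write 1 (.add (.var 15) (.const 1)) (.var 12))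
        (.seq (.write 15 (.const 0) (.add (.var 15) (.const 2)))
          (.ite sameExpr (.write 13 (.const 0) (.add (.var 13) (.const 1)))
            (.write 14 (.const 0) (.add (.var 14) (.const 1)))))))
    .skip

/-- The list of the edges that leave the hull, and their numbers. -/
def count : Program :=
  .seq (.write 1 (.const 1) (.const 1))
    (.seq (.write 15 (.const 0) (.const 2))
      (.seq (.write 13 (.const 0) (.const 0))
        (.seq (.write 14 (.const 0) (.const 0)) (.forLoop 11 (.forLoop 12 countStep)))))

/-- The test of a hull; variable `8` tells whether a suitable cut has been found. -/
def trial : Program :=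
  .ite (.var 8) .skip
    (.seq hull (.seq count (.ite (.lt (.var 14) (.var 13))
      (.seq (.write 1 (.const 0) (.sub (.var 15) (.const 1))) (.write 8 (.const 0) (.const 1)))
      .skip)))

/-- The computation of the offsets. -/
def offsets : Program :=
  .seq (.write 3 (.const 0) (.const 1))
    (.forLoop 11 (.seq (.write 2 (.var 11) (.var 3))
      (.write 3 (.const 0) (.add (.var 3) (.var 0)))))

/-- The algorithm: test all hulls, and report a skewed theta if no suitable cut has been found. -/
def algorithm : Program :=
  .seq offsets
    (.seq (.forLoop 4 (.forLoop 5 (.forLoop 6 (.forLoop 7 trial))))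
      (.ite (.var 8) .skip
        (.seq (.write 1 (.const 0) (.const 1)) (.write 1 (.const 1) (.const 0)))))

variable {I : Input} {ℓ : ℕ} {s : Store}

/-- Array `0` holds the input, and the offsets are in place. -/
structure Ready (I : Input) (s : Store) : Prop where
  input : s 0 = fun i => I.encode.getD i 0
  row : ∀ i < I.n, s 2 i = 1 + i * I.n
  side : s 3 0 = 1 + I.n * I.n

theorem Ready.write (h : Ready I s) {a i x : ℕ} (ha : a = 1 ∨ 4 ≤ a) :
    Ready I (s.write a i x) := by
  have h0 : 0 ≠ a := by omega
  have h2 : 2 ≠ a := by omega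
  have h3 : 3 ≠ a := by omega
  exact ⟨by funext j; simp [Store.write_apply, h0, h.input],
    fun i hi => by simp [Store.write_apply, h2, h.row i hi],
    by simp [Store.write_apply, h3, h.side]⟩

theorem Ready.read (h : Ready I s) : s 0 0 = I.n := by
  rw [h.input]
  rfl

theorem Ready.decides_adj (h : Ready I s) {i j : Fin I.n} (hi : s 11 0 = i) (hj : s 12 0 = j) :
    Decides s adjExpr (I.graph.Adj i j) := by
  simp only [Decides, adjExpr, eval, eval_var, h.input, hi, hj, h.row i i.2]
  exact I.getD_adj i j

theorem Ready.decides_same (h : Ready I s) {i j : Fin I.n} (hi : s 11 0 = i) (hj : s 12 0 = j) :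
    Decides s sameExpr (I.side i = I.side j) := by
  refine decides_eq ?_
  simp only [eval, eval_var, h.input, hi, hj, h.side, I.getD_side]
  cases I.side i <;> cases I.side j <;> simp

/-- Array `9` holds the characteristic function of `X`. -/
def Stores (s : Store) {n : ℕ} (X : Finset (Fin n)) : Prop :=
  ∀ x : Fin n, s 9 x = if x ∈ X then 1 else 0

theorem Stores.write {n : ℕ} {X : Finset (Fin n)} (h : Stores s X) {a i x : ℕ} (ha : a ≠ 9) :
    Stores (s.write a i x) X := fun y => by
  simp [Store.write_apply, ha.symm, h y]

theorem Stores.insert {n : ℕ} {X : Finset (Fin n)} (h : Stores s X) (i : Fin n) :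
    Stores (s.write 9 i 1) (insert i X) := fun y => by
  have := h y
  by_cases hy : y = i
  · simp [Store.write_apply, hy]
  · simp [Store.write_apply, hy, this, Fin.val_inj]

theorem Stores.decides {n : ℕ} {X : Finset (Fin n)} (h : Stores s X) {a : ℕ} {i : Fin n}
    (hi : s a 0 = i) : Decides s (.read 9 (.var a)) (i ∈ X) := by
  classical
  simp only [Decides, eval, eval_var, hi, h i]
  congr

/-- The state of the store during the test of the hull for `u₁`, `w₁`, `u₂`, `w₂`. -/
structure Testing (I : Input) (u₁ w₁ u₂ w₂ : Fin I.n) (s : Store) : Prop extends Ready I s where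
  first : s 4 0 = u₁
  second : s 5 0 = w₁
  third : s 6 0 = u₂
  fourth : s 7 0 = w₂
  unfound : s 8 0 = 0

variable {u₁ w₁ u₂ w₂ : Fin I.n}

theorem Testing.write (h : Testing I u₁ w₁ u₂ w₂ s) {a i x : ℕ} (ha : a = 1 ∨ 9 ≤ a) :
    Testing I u₁ w₁ u₂ w₂ (s.write a i x) := by
  have h4 : 4 ≠ a := by omega
  have h5 : 5 ≠ a := by omega
  have h6 : 6 ≠ a := by omega
  have h7 : 7 ≠ a := by omega
  have h8 : 8 ≠ a := by omega
  exact ⟨h.toReady.write (by omega), by simp [Store.write_apply, h4, h.first],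
    by simp [Store.write_apply, h5, h.second], by simp [Store.write_apply, h6, h.third],
    by simp [Store.write_apply, h7, h.fourth], by simp [Store.write_apply, h8, h.unfound]⟩

/-- The moves that are admitted in the computation of a hull. -/
def Move (I : Input) (u₁ w₁ u₂ w₂ x y : Fin I.n) : Prop :=
  s(x, y) ∈ I.evens ∧ ¬ (x = u₁ ∧ y = w₁) ∧ ¬ (x = u₂ ∧ y = w₂)

/-- The set `X` contains `u₁` and `u₂` and is contained in their hull. -/
structure Partial (I : Input) (u₁ w₁ u₂ w₂ : Fin I.n) (X : Finset (Fin I.n)) : Prop where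
  left : u₁ ∈ X
  right : u₂ ∈ X
  least : ∀ Z : Finset (Fin I.n), u₁ ∈ Z → u₂ ∈ Z →
    (∀ x ∈ Z, ∀ y, Move I u₁ w₁ u₂ w₂ x y → y ∈ Z) → X ⊆ Z

theorem Partial.insert {X : Finset (Fin I.n)} (h : Partial I u₁ w₁ u₂ w₂ X) {x y : Fin I.n}
    (hx : x ∈ X) (hxy : Move I u₁ w₁ u₂ w₂ x y) : Partial I u₁ w₁ u₂ w₂ (insert y X) :=
  ⟨Finset.mem_insert_of_mem h.left, Finset.mem_insert_of_mem h.right, fun Z h1 h2 hZ =>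
    Finset.insert_subset (hZ x (h.least Z h1 h2 hZ hx) y hxy) (h.least Z h1 h2 hZ)⟩

theorem Partial.isHull {X : Finset (Fin I.n)} (h : Partial I u₁ w₁ u₂ w₂ X)
    (hX : ∀ x ∈ X, ∀ y, Move I u₁ w₁ u₂ w₂ x y → y ∈ X) : IsHull I.evens u₁ w₁ u₂ w₂ X :=
  ⟨h.left, h.right, fun x hx y h1 h2 h3 => hX x hx y ⟨h1, h2, h3⟩,
    fun Z h1 h2 hZ => h.least Z h1 h2 fun x hx y h3 => hZ x hx y h3.1 h3.2.1 h3.2.2⟩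

theorem runs_closeStep (h : Testing I u₁ w₁ u₂ w₂ s) {i j : Fin I.n} (hi : s 11 0 = i)
    (hj : s 12 0 = j) {X : Finset (Fin I.n)} (hX : Stores s X) {Q : Store → Prop}
    (hyes : i ∈ X → Move I u₁ w₁ u₂ w₂ i j → Q (s.write 9 j 1))
    (hno : ¬ (i ∈ X ∧ Move I u₁ w₁ u₂ w₂ i j) → Q s) : Runs ℓ closeStep s Q := by
  have hcond := ((hX.decides hi).and ((h.decides_adj hi hj).and (h.decides_same hi hj).not)).and
    (((decides_eq (s := s) (x := .var 11) (y := .var 4) (P := i = u₁)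
      (by simp [hi, h.first, Fin.val_inj])).and (decides_eq (x := .var 12) (y := .var 5)
      (P := j = w₁) (by simp [hj, h.second, Fin.val_inj]))).not.and
    ((decides_eq (x := .var 11) (y := .var 6) (P := i = u₂)
      (by simp [hi, h.third, Fin.val_inj])).and (decides_eq (x := .var 12) (y := .var 7)
      (P := j = w₂) (by simp [hj, h.fourth, Fin.val_inj]))).not)
  have hiff : ((i ∈ X ∧ I.graph.Adj i j ∧ ¬ I.side i = I.side j) ∧
      ¬ (i = u₁ ∧ j = w₁) ∧ ¬ (i = u₂ ∧ j = w₂)) ↔ i ∈ X ∧ Move I u₁ w₁ u₂ w₂ i j := by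
    rw [Move, Input.mem_evens]
    tauto
  refine Runs.ite (fun hc => Runs.write ?_) fun hc => Runs.skip (hno ?_)
  · have := hiff.1 (hcond.ne_zero_iff.1 hc)
    simpa [eval, hj] using hyes this.1 this.2
  · exact fun h' => hcond.eq_zero_iff.1 hc (hiff.2 h')

/-- After a round, every vertex that is one move away from the set at its beginning has been added.
-/
theorem runs_round (hℓ : I.n ≤ ℓ) {k : ℕ} (h : Testing I u₁ w₁ u₂ w₂ s) (hk : s 10 0 = k)
    {X : Finset (Fin I.n)} (hX : Stores s X) (hp : Partial I u₁ w₁ u₂ w₂ X) :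
    Runs ℓ (.forLoop 11 (.forLoop 12 closeStep)) s fun s' => Testing I u₁ w₁ u₂ w₂ s' ∧
      s' 10 0 = k ∧ ∃ Y, Stores s' Y ∧ Partial I u₁ w₁ u₂ w₂ Y ∧ X ⊆ Y ∧
        ∀ x ∈ X, ∀ y, Move I u₁ w₁ u₂ w₂ x y → y ∈ Y := by
  refine (Runs.forLoop_prod hℓ (Inv := fun D s' => Testing I u₁ w₁ u₂ w₂ s' ∧ s' 10 0 = k ∧
      ∃ Y, Stores s' Y ∧ Partial I u₁ w₁ u₂ w₂ Y ∧ X ⊆ Y ∧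
        ∀ x ∈ X, ∀ y, (x, y) ∈ D → Move I u₁ w₁ u₂ w₂ x y → y ∈ Y) ?_ ?_ (by decide) ?_ ?_
      ⟨h, hk, X, hX, hp, subset_rfl, by simp⟩).mono ?_
  · rintro D s' x ⟨h1, h2, Y, h3, h4⟩
    exact ⟨h1.write (by omega), by simpa [Store.write_apply] using h2, Y, h3.write (by omega), h4⟩
  · rintro D s' x ⟨h1, h2, Y, h3, h4⟩
    exact ⟨h1.write (by omega), by simpa [Store.write_apply] using h2, Y, h3.write (by omega), h4⟩
  · exact fun D s' h' => h'.1.read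
  · rintro i j D - s' ⟨h1, h2, Y, h3, h4, h5, h6⟩ hi hj
    refine runs_closeStep h1 hi hj h3 (fun hiY hij => ?_) fun hno => ?_
    · refine ⟨⟨h1.write (by omega), by simpa [Store.write_apply] using h2, insert j Y, h3.insert j,
        h4.insert hiY hij, h5.trans (Finset.subset_insert _ _), fun x hx y hxy hm => ?_⟩,
        by simpa [Store.write_apply] using hi, by simpa [Store.write_apply] using hj⟩
      rcases Finset.mem_insert.1 hxy with hxy | hxy
      · rw [(Prod.mk.inj hxy).2]
        exact Finset.mem_insert_self _ _
      · exact Finset.mem_insert_of_mem (h6 x hx y hxy hm)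
    · refine ⟨⟨h1, h2, Y, h3, h4, h5, fun x hx y hxy hm => ?_⟩, hi, hj⟩
      rcases Finset.mem_insert.1 hxy with hxy | hxy
      · obtain ⟨rfl, rfl⟩ := Prod.mk.inj hxy
        exact absurd ⟨h5 hx, hm⟩ hno
      · exact h6 x hx y hxy hm
  · rintro s' ⟨h1, h2, Y, h3, h4, h5, h6⟩
    exact ⟨h1, h2, Y, h3, h4, h5, fun x hx y => h6 x hx y (Finset.mem_univ _)⟩

/-- Each round either enlarges the set or leaves a closed set unchanged, so that `n` rounds
suffice. -/
theorem runs_hull (hℓ : I.n ≤ ℓ) (h : Testing I u₁ w₁ u₂ w₂ s) :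
    Runs ℓ hull s fun s' => Testing I u₁ w₁ u₂ w₂ s' ∧
      ∃ X, Stores s' X ∧ IsHull I.evens u₁ w₁ u₂ w₂ X := by
  refine Runs.seq (P := fun s' => Testing I u₁ w₁ u₂ w₂ s' ∧ Stores s' (∅ : Finset (Fin I.n))) ?_
    fun s₁ h₁ => Runs.seq (P := fun s' => Testing I u₁ w₁ u₂ w₂ s' ∧ Stores s' {u₁}) ?_
    fun s₂ h₂ => Runs.seq (P := fun s' => Testing I u₁ w₁ u₂ w₂ s' ∧ Stores s' {u₁, u₂}) ?_
    fun s₃ h₃ => ?_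
  · refine (Runs.forLoop hℓ (Inv := fun D s' => Testing I u₁ w₁ u₂ w₂ s' ∧
      ∀ x ∈ D, s' 9 (x : Fin I.n) = 0) ?_ (fun D s' h' => h'.1.read) ?_ ⟨h, by simp⟩).mono ?_
    · exact fun D s' x h' => ⟨h'.1.write (by omega), by simpa [Store.write_apply] using h'.2⟩
    · refine fun i D _ s' h' hi => Runs.write ⟨⟨h'.1.write (by omega), fun x hx => ?_⟩,
        by simpa [Store.write_apply] using hi⟩
      rcases Finset.mem_insert.1 hx with rfl | hx
      · simp [Store.write_apply, eval, hi]
      · simp [Store.write_apply, eval, h'.2 x hx]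
    · exact fun s' h' => ⟨h'.1, fun x => by simp [h'.2 x (Finset.mem_univ x)]⟩
  · refine Runs.write ⟨h₁.1.write (by omega), ?_⟩
    have := h₁.2.insert u₁
    simpa [eval, h₁.1.first] using this
  · refine Runs.write ⟨h₂.1.write (by omega), ?_⟩
    have := h₂.2.insert u₂
    rw [Finset.pair_comm]
    simpa [eval, h₂.1.third] using this
  · refine (Runs.forLoop_nat hℓ (Inv := fun k s' => Testing I u₁ w₁ u₂ w₂ s' ∧
      ∃ X, Stores s' X ∧ Partial I u₁ w₁ u₂ w₂ X ∧
        (IsHull I.evens u₁ w₁ u₂ w₂ X ∨ k < X.card)) ?_ (fun k s' h' => h'.1.read) ?_ ?_).mono ?_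
    · rintro k s' x ⟨h1, X, h2, h3⟩
      exact ⟨h1.write (by omega), X, h2.write (by omega), h3⟩
    · rintro k hk s' ⟨h1, X, h2, h3, h4⟩ hs'
      refine (runs_round hℓ h1 hs' h2 h3).mono ?_
      rintro s'' ⟨h5, h6, Y, h7, h8, h9, h10⟩
      refine ⟨⟨h5, Y, h7, h8, ?_⟩, h6⟩
      rcases h4 with h4 | h4
      · have hYX : Y = X := (h8.least X h4.left h4.right fun x hx y hxy =>
          h4.closed x hx y hxy.1 hxy.2.1 hxy.2.2).antisymm h9
        exact .inl (hYX ▸ h4)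
      · by_cases hXY : X = Y
        · subst hXY
          exact .inl (h8.isHull h10)
        · have := Finset.card_lt_card (h9.ssubset_of_ne hXY)
          exact .inr (by omega)
    · exact ⟨h₃.1, {u₁, u₂}, h₃.2, ⟨by simp, by simp, fun Z h1 h2 _ => by
        simp [Finset.insert_subset_iff, h1, h2]⟩, .inr (Finset.card_pos.2 ⟨u₁, by simp⟩)⟩
    · rintro s' ⟨h1, X, h2, h3, h4⟩
      refine ⟨h1, X, h2, h4.resolve_right ?_⟩
      have := Finset.card_le_univ X
      rw [Fintype.card_fin] at this
      omega

end Algorithm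

end SkewedTheta

/-! ### The search -/

namespace SkewedTheta

open Ram Ram.Expr

section Search

variable {I : Input} {ℓ : ℕ} {s : Store} {u₁ w₁ u₂ w₂ : Fin I.n}

/-- Array `1` holds the output `1` followed by the pairs in `L`, except for its length, and
variable `15` points to the first entry behind it. -/
structure Lists {n : ℕ} (s : Store) (L : List (Fin n × Fin n)) : Prop where
  head : s 1 1 = 1
  pos : s 15 0 = 2 + 2 * L.length
  tail : (List.range (2 * L.length)).map (fun i => s 1 (i + 2)) =
    L.flatMap fun e => [(e.1 : ℕ), (e.2 : ℕ)]

theorem Lists.write {n : ℕ} {L : List (Fin n × Fin n)} (h : Lists s L) {a i x : ℕ}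
    (ha : a ≠ 1 ∧ a ≠ 15) : Lists (s.write a i x) L :=
  ⟨by simp [Store.write_apply, ha.1.symm, h.head], by simp [Store.write_apply, ha.2.symm, h.pos],
    by simpa [Store.write_apply, ha.1.symm] using h.tail⟩

theorem Lists.append {n : ℕ} {L : List (Fin n × Fin n)} (h : Lists s L) (p : Fin n × Fin n) :
    Lists (((s.write 1 (s 15 0) p.1).write 1 (s 15 0 + 1) p.2).write 15 0 (s 15 0 + 2))
      (L ++ [p]) := by
  have hpos := h.pos
  refine ⟨?_, ?_, ?_⟩
  · have h1 : 1 ≠ s 15 0 := by omega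
    simp [Store.write_apply, h1, h.head]
    omega
  · simp [Store.write_apply]
    omega
  · rw [List.length_append, List.length_singleton, mul_add, mul_one, List.range_add,
      List.map_append, List.flatMap_append, ← h.tail]
    congr 1
    · refine List.map_congr_left fun i hi => ?_
      rw [List.mem_range] at hi
      have h1 : i + 2 ≠ s 15 0 := by omega
      have h2 : i + 2 ≠ s 15 0 + 1 := by omega
      simp [Store.write_apply, h1]
      omega
    · simp [Store.write_apply, List.range_succ, hpos, add_comm 2]

theorem Lists.output_eq {n : ℕ} {L : List (Fin n × Fin n)} (h : Lists s L)
    (hlen : s 1 0 = s 15 0 - 1) : output s = (Answer.edges L).encode := by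
  rw [output, hlen, h.pos, show 2 + 2 * L.length - 1 = 2 * L.length + 1 by omega,
    List.range_succ_eq_map, List.map_cons, List.map_map, Answer.encode, ← h.tail, h.head]
  rfl

/-- The number of the pairs in `D` that form an edge in `S` leaving `X`. -/
def cutOn {n : ℕ} (S : Finset (Sym2 (Fin n))) (X : Finset (Fin n)) (D : Finset (Fin n × Fin n)) :
    ℕ :=
  (D.filter fun p => p.1 ∈ X ∧ p.2 ∉ X ∧ s(p.1, p.2) ∈ S).card

theorem cutOn_insert {n : ℕ} {S : Finset (Sym2 (Fin n))} {X : Finset (Fin n)}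
    {D : Finset (Fin n × Fin n)} {p : Fin n × Fin n} (hp : p ∉ D) :
    cutOn S X (insert p D) =
      cutOn S X D + if p.1 ∈ X ∧ p.2 ∉ X ∧ s(p.1, p.2) ∈ S then 1 else 0 := by
  rw [cutOn, Finset.filter_insert]
  split_ifs
  · rw [Finset.card_insert_of_notMem (by simp [hp])]
    rfl
  · rfl

/-- The edges that leave `X` have been listed and counted, as far as the pairs in `D` are
concerned. -/
structure Counted (I : Input) (X : Finset (Fin I.n)) (D : Finset (Fin I.n × Fin I.n)) (s : Store) :
    Prop where
  list : ∃ L : List (Fin I.n × Fin I.n), L.Nodup ∧ Lists s L ∧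
    ∀ p, p ∈ L ↔ p ∈ D ∧ p.1 ∈ X ∧ p.2 ∉ X ∧ I.graph.Adj p.1 p.2
  odd : s 13 0 = cutOn I.odds X D
  even : s 14 0 = cutOn I.evens X D

theorem Counted.write {X : Finset (Fin I.n)} {D : Finset (Fin I.n × Fin I.n)} (h : Counted I X D s)
    {a i x : ℕ} (ha : a ≠ 1 ∧ a ≠ 15 ∧ a ≠ 13 ∧ a ≠ 14) : Counted I X D (s.write a i x) := by
  obtain ⟨⟨L, h1, h2, h3⟩, h4, h5⟩ := h
  exact ⟨⟨L, h1, h2.write ⟨ha.1, ha.2.1⟩, h3⟩, by simp [Store.write_apply, ha.2.2.1.symm, h4],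
    by simp [Store.write_apply, ha.2.2.2.symm, h5]⟩

theorem runs_countStep (h : Testing I u₁ w₁ u₂ w₂ s) {i j : Fin I.n} (hi : s 11 0 = i)
    (hj : s 12 0 = j) {X : Finset (Fin I.n)} (hX : Stores s X) {D : Finset (Fin I.n × Fin I.n)}
    (hD : (i, j) ∉ D) (hC : Counted I X D s) :
    Runs ℓ countStep s fun s' => (Testing I u₁ w₁ u₂ w₂ s' ∧ Stores s' X ∧
      Counted I X (insert (i, j) D) s') ∧ s' 11 0 = i ∧ s' 12 0 = j := by
  have hcond := ((hX.decides hi).and (hX.decides hj).not).and (h.decides_adj hi hj)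
  have hC' := hC
  obtain ⟨⟨L, h1, h2, h3⟩, h4, h5⟩ := hC'
  refine Runs.ite (fun hc => ?_) fun hc => Runs.skip ?_
  · obtain ⟨⟨hiX, hjX⟩, hij⟩ := hcond.ne_zero_iff.1 hc
    refine Runs.seq (Runs.write (Q := fun s' => s' = s.write 1 (s 15 0) i) (by simp [hi])) ?_
    rintro _ rfl
    refine Runs.seq (Runs.write
      (Q := fun s' => s' = (s.write 1 (s 15 0) i).write 1 (s 15 0 + 1) j)
      (by simp [eval, Store.write_apply, hj])) ?_
    rintro _ rfl
    refine Runs.seq (Runs.write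
      (Q := fun s' => s' = ((s.write 1 (s 15 0) i).write 1 (s 15 0 + 1) j).write 15 0 (s 15 0 + 2))
      (by simp [eval, Store.write_apply])) ?_
    intro s₁ hs₁
    have t₁ : Testing I u₁ w₁ u₂ w₂ s₁ := by
      rw [hs₁]
      exact ((h.write (by omega)).write (by omega)).write (by omega)
    have x₁ : Stores s₁ X := by
      rw [hs₁]
      exact ((hX.write (by omega)).write (by omega)).write (by omega)
    have i₁ : s₁ 11 0 = i := by simpa [hs₁, Store.write_apply] using hi
    have j₁ : s₁ 12 0 = j := by simpa [hs₁, Store.write_apply] using hj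
    have l₁ : Lists s₁ (L ++ [(i, j)]) := by
      rw [hs₁]
      exact h2.append (i, j)
    have o₁ : s₁ 13 0 = cutOn I.odds X D := by simpa [hs₁, Store.write_apply] using h4
    have e₁ : s₁ 14 0 = cutOn I.evens X D := by simpa [hs₁, Store.write_apply] using h5
    have n₁ : (L ++ [(i, j)]).Nodup :=
      List.nodup_append'.2 ⟨h1, by simp, by simpa using fun h' => hD ((h3 (i, j)).1 h').1⟩
    have m₁ : ∀ p, p ∈ L ++ [(i, j)] ↔
        p ∈ insert (i, j) D ∧ p.1 ∈ X ∧ p.2 ∉ X ∧ I.graph.Adj p.1 p.2 := by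
      intro p
      rw [List.mem_append, List.mem_singleton, h3, Finset.mem_insert]
      constructor
      · rintro (h' | rfl)
        · exact ⟨.inr h'.1, h'.2⟩
        · exact ⟨.inl rfl, hiX, hjX, hij⟩
      · rintro ⟨h' | h', h''⟩
        · exact .inr h'
        · exact .inl ⟨h', h''⟩
    have hsame := t₁.decides_same i₁ j₁
    refine Runs.ite (fun hc => Runs.write ?_) fun hc => Runs.write ?_
    · have hside := hsame.ne_zero_iff.1 hc
      refine ⟨⟨t₁.write (by omega), x₁.write (by omega), ⟨_, n₁, l₁.write (by omega), m₁⟩, ?_, ?_⟩,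
        by simpa [Store.write_apply] using i₁, by simpa [Store.write_apply] using j₁⟩
      · simp [Store.write_apply, eval, o₁, cutOn_insert hD, Input.mem_odds, hiX, hjX, hij, hside]
      · simp [Store.write_apply, e₁, cutOn_insert hD, Input.mem_evens, hside]
    · have hside := hsame.eq_zero_iff.1 hc
      refine ⟨⟨t₁.write (by omega), x₁.write (by omega), ⟨_, n₁, l₁.write (by omega), m₁⟩, ?_, ?_⟩,
        by simpa [Store.write_apply] using i₁, by simpa [Store.write_apply] using j₁⟩
      · simp [Store.write_apply, o₁, cutOn_insert hD, Input.mem_odds, hside]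
      · simp [Store.write_apply, eval, e₁, cutOn_insert hD, Input.mem_evens, hiX, hjX, hij, hside]
  · have hno := hcond.eq_zero_iff.1 hc
    refine ⟨⟨h, hX, ⟨L, h1, h2, fun p => ?_⟩, ?_, ?_⟩, hi, hj⟩
    · rw [h3, Finset.mem_insert]
      constructor
      · exact fun h' => ⟨.inr h'.1, h'.2⟩
      · rintro ⟨rfl | h', h''⟩
        · exact absurd ⟨⟨h''.1, h''.2.1⟩, h''.2.2⟩ hno
        · exact ⟨h', h''⟩
    · rw [cutOn_insert hD, if_neg, h4, add_zero]
      rw [Input.mem_odds]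
      tauto
    · rw [cutOn_insert hD, if_neg, h5, add_zero]
      rw [Input.mem_evens]
      tauto

theorem runs_count (hℓ : I.n ≤ ℓ) (h : Testing I u₁ w₁ u₂ w₂ s) {X : Finset (Fin I.n)}
    (hX : Stores s X) :
    Runs ℓ count s fun s' => Testing I u₁ w₁ u₂ w₂ s' ∧ Counted I X Finset.univ s' := by
  refine Runs.seq (Runs.write (Q := fun s' => s' = s.write 1 1 1) rfl) ?_
  rintro _ rfl
  refine Runs.seq (Runs.write (Q := fun s' => s' = (s.write 1 1 1).write 15 0 2) rfl) ?_
  rintro _ rfl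
  refine Runs.seq (Runs.write
    (Q := fun s' => s' = ((s.write 1 1 1).write 15 0 2).write 13 0 0) rfl) ?_
  rintro _ rfl
  refine Runs.seq (Runs.write
    (Q := fun s' => s' = (((s.write 1 1 1).write 15 0 2).write 13 0 0).write 14 0 0) rfl) ?_
  intro s₁ hs₁
  refine (Runs.forLoop_prod hℓ (Inv := fun D s' => Testing I u₁ w₁ u₂ w₂ s' ∧ Stores s' X ∧
      Counted I X D s') ?_ ?_ (by decide) (fun D s' h' => h'.1.read) ?_ ?_).mono ?_
  · exact fun D s' x h' => ⟨h'.1.write (by omega), h'.2.1.write (by omega), h'.2.2.write (by omega)⟩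
  · exact fun D s' x h' => ⟨h'.1.write (by omega), h'.2.1.write (by omega), h'.2.2.write (by omega)⟩
  · exact fun i j D hD s' h' hi hj => runs_countStep h'.1 hi hj h'.2.1 hD h'.2.2
  · rw [hs₁]
    refine ⟨(((h.write (by omega)).write (by omega)).write (by omega)).write (by omega),
      (((hX.write (by omega)).write (by omega)).write (by omega)).write (by omega),
      ⟨[], List.nodup_nil, ⟨?_, ?_, ?_⟩, by simp⟩, ?_, ?_⟩
    all_goals simp [Store.write_apply, cutOn]
  · exact fun s' h' => ⟨h'.1, h'.2.2⟩

/-- The invariant of the search: once a cut has been found, the output is in place. -/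
structure Searching (I : Input) (s : Store) : Prop extends Ready I s where
  found : s 8 0 ≠ 0 → ∃ answer : Answer I.n, answer.Correct I ∧ output s = answer.encode

theorem Searching.write (h : Searching I s) {a i x : ℕ} (ha : 4 ≤ a ∧ a ≠ 8) :
    Searching I (s.write a i x) := by
  have h1 : 1 ≠ a := by omega
  refine ⟨h.toReady.write (by omega), fun h8 => ?_⟩
  obtain ⟨answer, hc, ho⟩ := h.found (by simpa [Store.write_apply, ha.2.symm] using h8)
  refine ⟨answer, hc, ?_⟩
  rw [← ho]
  simp [output, Store.write_apply, h1]

/-- The test of the hull for `u₁`, `w₁`, `u₂`, `w₂` is unsuccessful. -/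
def Rejected (I : Input) (u₁ w₁ u₂ w₂ : Fin I.n) : Prop :=
  ∃ X, IsHull I.evens u₁ w₁ u₂ w₂ X ∧ cut I.odds X ≤ cut I.evens X

theorem runs_trial (hℓ : I.n ≤ ℓ)
    (h : (((Searching I s ∧ s 4 0 = u₁) ∧ s 5 0 = w₁) ∧ s 6 0 = u₂) ∧ s 7 0 = w₂) :
    Runs ℓ trial s fun s' =>
      ((((Searching I s' ∧ s' 4 0 = u₁) ∧ s' 5 0 = w₁) ∧ s' 6 0 = u₂) ∧ s' 7 0 = w₂) ∧
        (s 8 0 ≠ 0 → s' 8 0 ≠ 0) ∧ (s' 8 0 ≠ 0 ∨ Rejected I u₁ w₁ u₂ w₂) := by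
  refine Runs.ite (fun h8 => Runs.skip ⟨h, id, .inl h8⟩) fun h8 => ?_
  rw [eval_var] at h8
  obtain ⟨⟨⟨⟨h0, h4⟩, h5⟩, h6⟩, h7⟩ := h
  refine Runs.seq (runs_hull hℓ ⟨h0.toReady, h4, h5, h6, h7, h8⟩) ?_
  rintro s₁ ⟨t₁, X, x₁, hX⟩
  refine Runs.seq (runs_count hℓ t₁ x₁) ?_
  rintro s₂ ⟨t₂, ⟨L, l1, l2, l3⟩, ho, he⟩
  have ho' : s₂ 13 0 = cut I.odds X := ho
  have he' : s₂ 14 0 = cut I.evens X := he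
  refine Runs.ite (fun hc => ?_) fun hc => Runs.skip ?_
  · have hlt : cut I.evens X < cut I.odds X := by
      by_contra hlt
      simp [eval, ho', he', hlt] at hc
    refine Runs.seq (Runs.write (Q := fun s' => s' = s₂.write 1 0 (s₂ 15 0 - 1)) rfl) ?_
    rintro _ rfl
    refine Runs.write ⟨⟨⟨⟨⟨⟨(t₂.toReady.write (by omega)).write (by omega), fun _ => ?_⟩, ?_⟩, ?_⟩,
      ?_⟩, ?_⟩, ?_, ?_⟩
    · refine ⟨.edges L, correct_of_cut_lt (X := X) l1 (by simpa using l3) hlt, ?_⟩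
      refine Lists.output_eq ⟨?_, ?_, ?_⟩ ?_
      · simpa [Store.write_apply] using l2.head
      · simpa [Store.write_apply] using l2.pos
      · simpa [Store.write_apply] using l2.tail
      · simp [Store.write_apply]
    · simpa [Store.write_apply] using t₂.first
    · simpa [Store.write_apply] using t₂.second
    · simpa [Store.write_apply] using t₂.third
    · simpa [Store.write_apply] using t₂.fourth
    · simp [Store.write_apply, eval]
    · simp [Store.write_apply, eval]
  · have hle : cut I.odds X ≤ cut I.evens X := by
      by_contra hlt
      simp [eval, ho', he', not_le.1 hlt] at hc
    exact ⟨⟨⟨⟨⟨⟨t₂.toReady, fun h' => absurd t₂.unfound h'⟩, t₂.first⟩, t₂.second⟩, t₂.third⟩,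
      t₂.fourth⟩, fun h' => absurd h8 h', .inr ⟨X, hX, hle⟩⟩

theorem runs_search (hℓ : I.n ≤ ℓ) (h : Searching I s) :
    Runs ℓ (.forLoop 4 (.forLoop 5 (.forLoop 6 (.forLoop 7 trial)))) s fun s' =>
      Searching I s' ∧ (s 8 0 ≠ 0 → s' 8 0 ≠ 0) ∧
        (s' 8 0 ≠ 0 ∨ ∀ u₁ w₁ u₂ w₂, Rejected I u₁ w₁ u₂ w₂) := by
  refine Runs.search hℓ (F := fun s => s 8 0 ≠ 0) (A := Searching I)
    (fun s x h' => h'.write (by omega)) (by simp [Store.write_apply])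
    (fun s h' => h'.toReady.read) (fun u₁ s hs => ?_) h
  refine Runs.search hℓ (F := fun s => s 8 0 ≠ 0) (A := fun s => Searching I s ∧ s 4 0 = u₁)
    (fun s x h' => ⟨h'.1.write (by omega), by simpa [Store.write_apply] using h'.2⟩)
    (by simp [Store.write_apply]) (fun s h' => h'.1.toReady.read) (fun w₁ s hs => ?_) hs
  refine Runs.search hℓ (F := fun s => s 8 0 ≠ 0)
    (A := fun s => (Searching I s ∧ s 4 0 = u₁) ∧ s 5 0 = w₁)
    (fun s x h' => ⟨⟨h'.1.1.write (by omega), by simpa [Store.write_apply] using h'.1.2⟩,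
      by simpa [Store.write_apply] using h'.2⟩)
    (by simp [Store.write_apply]) (fun s h' => h'.1.1.toReady.read) (fun u₂ s hs => ?_) hs
  exact Runs.search hℓ (F := fun s => s 8 0 ≠ 0)
    (A := fun s => ((Searching I s ∧ s 4 0 = u₁) ∧ s 5 0 = w₁) ∧ s 6 0 = u₂)
    (fun s x h' => ⟨⟨⟨h'.1.1.1.write (by omega), by simpa [Store.write_apply] using h'.1.1.2⟩,
      by simpa [Store.write_apply] using h'.1.2⟩, by simpa [Store.write_apply] using h'.2⟩)
    (by simp [Store.write_apply]) (fun s h' => h'.1.1.1.toReady.read)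
    (fun w₂ s hs => runs_trial hℓ hs) hs

theorem runs_offsets (hℓ : I.n ≤ ℓ) :
    Runs ℓ offsets (initial I.encode) fun s => Searching I s := by
  refine Runs.seq (Runs.write (Q := fun s' => s' = (initial I.encode).write 3 0 1) rfl) ?_
  rintro _ rfl
  refine (Runs.forLoop_nat hℓ (Inv := fun k s => (s 0 = fun i => I.encode.getD i 0) ∧
    (∀ i < k, s 2 i = 1 + i * I.n) ∧ s 3 0 = 1 + k * I.n ∧ s 8 0 = 0) ?_ ?_ ?_ ?_).mono ?_
  · rintro k s x ⟨h1, h2, h3, h4⟩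
    exact ⟨by funext i; simp [Store.write_apply, h1],
      fun i hi => by simpa [Store.write_apply] using h2 i hi,
      by simpa [Store.write_apply] using h3, by simpa [Store.write_apply] using h4⟩
  · rintro k s ⟨h1, -⟩
    rw [h1]
    rfl
  · rintro k hk s ⟨h1, h2, h3, h4⟩ hs
    have h0 : s 0 0 = I.n := by
      rw [h1]
      rfl
    refine Runs.seq (Runs.write (Q := fun s' => s' = s.write 2 k (1 + k * I.n))
      (by simp [hs, h3])) ?_
    rintro _ rfl
    refine Runs.write ⟨⟨?_, ?_, ?_, ?_⟩, ?_⟩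
    · funext i
      simp [Store.write_apply, h1]
    · intro i hi
      by_cases hik : i = k
      · simp [Store.write_apply, hik]
      · simpa [Store.write_apply, hik] using h2 i (by omega)
    · simp only [Store.write_apply, eval, eval_var]
      simp [h0, h3]
      ring
    · simpa [Store.write_apply] using h4
    · simpa [Store.write_apply] using hs
  · refine ⟨?_, by simp, by simp [Store.write_apply], by simp [Store.write_apply, initial]⟩
    funext i
    simp [Store.write_apply, initial]
  · rintro s ⟨h1, h2, h3, h4⟩
    exact ⟨⟨h1, h2, h3⟩, fun h' => absurd h4 h'⟩

theorem runs_algorithm (hI : I.Admissible) (hℓ : I.n ≤ ℓ) :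
    Runs ℓ algorithm (initial I.encode) fun s =>
      ∃ answer : Answer I.n, answer.Correct I ∧ output s = answer.encode := by
  refine Runs.seq (runs_offsets hℓ) fun s₁ h₁ => Runs.seq (runs_search hℓ h₁) ?_
  rintro s₂ ⟨h₂, -, h₃⟩
  refine Runs.ite (fun h8 => Runs.skip (h₂.found h8)) fun h8 => ?_
  have hcorrect := correct_skewedTheta hI (h₃.resolve_left fun h' => h' h8)
  refine Runs.seq (Runs.write (Q := fun s' => s' = s₂.write 1 0 1) rfl) ?_
  rintro _ rfl
  refine Runs.write ⟨.skewedTheta, hcorrect, ?_⟩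
  simp [output, Store.write_apply, eval, Answer.encode]

end Search

end SkewedTheta

theorem lemma3p7 :
    ∃ (algorithm : Ram.Program) (p : Polynomial ℕ),
      ∀ I : SkewedTheta.Input, I.Admissible →
        ∃ answer : SkewedTheta.Answer I.n, answer.Correct I ∧
          Ram.OutputsWithin algorithm I.encode answer.encode (p.eval I.encode.length) := by
  refine ⟨SkewedTheta.algorithm, SkewedTheta.algorithm.timeBound, fun I hI => ?_⟩
  obtain ⟨t, s, hexec, ht, answer, hcorrect, hout⟩ := SkewedTheta.runs_algorithm hI I.le_length
  exact ⟨answer, hcorrect, t, s, hexec, ht, hout⟩
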